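/- **Model.** $G$ is a simple connected graph with $n$ anonymous, memoryless nodes and maximum degree $\Delta$; at each node $v$ the incident edges carry distinct port numbers $1,\dots,\deg v$, assigned independently at the two ends of an edge. There are $k\le n$ robots with IDs $1,\dots,k$, all placed initially on one node (a rooted configuration). All robots run the same deterministic algorithm, which may depend on $k$ but not on $n$, $\Delta$, $f$ or the graph; the ID is available to a robot only through its initial memory content, and local computation is not charged. Time is divided into synchronous rounds. In each round, every robot that has neither crashed nor terminated reads its own memory, the degree of its node, the port through which it entered the node in the preceding round (if it moved then), and the memories and entry ports of the other non-crashed robots at the same node; from this it computes its new memory content (a bit string) and either stays or leaves through a port of its choice, arriving at the other end of the edge by the next round. A terminated robot never moves or changes its memory again. Up to $f\le k$ robots, chosen by an adversary, may crash, each at the beginning of an arbitrary round (possibly the first); a crashed robot disappears permanently together with its memory content. **Theorem (Crash faults, rooted initial configuration).** There are deterministic algorithms $A_k$ ($k\in\mathbb N$) and a constant $C$ such that for all $f\le k\le n$, every connected port-labelled $n$-node graph $G$ with maximum degree $\Delta$, every starting node, and every crash pattern with at most $f$ crashes, the execution of $A_k$ by $k$ robots satisfies: 1. (Dispersion in $O(k^2)$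 rounds.) After $7k^2$ rounds, and at all later times, every robot that has not crashed has terminated and no two robots that have not crashed are on the same node. 2. (Memory.) At all times, the memory of every robot that has not crashed consists of at most $C\log_2(k+\Delta)$ bits. -/

import Mathlib

namespace Dispersion

/-- The memory content of a robot: a string of bits. -/
abbrev Memory := List Bool

/-- A port labelling: at each node `v` the incident edges (equivalently, since the graph is simple,
the neighbours of `v`) carry distinct port numbers `1, …, deg v`. The two ends of an edge are
labelled independently of each other. -/
structure PortLabelling {n : ℕ} (G : SimpleGraph (Fin n)) [DecidableRel G.Adj] where
  neighbor : ∀ v : Fin n, (Finset.Icc 1 (G.degree v)) ≃ (G.neighborSet v)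

/-- Leaving node `v` through port `p`: the node that is reached and the port through which it is
entered. A number that is not a port of `v` makes the robot stay. -/
def PortLabelling.traverse {n : ℕ} {G : SimpleGraph (Fin n)} [DecidableRel G.Adj]
    (P : PortLabelling G) (v : Fin n) (p : ℕ) : Fin n × Option ℕ :=
  if h : p ∈ Finset.Icc 1 (G.degree v) then
    let w : G.neighborSet v := P.neighbor v ⟨p, h⟩
    (w.1, some ((P.neighbor w.1).symm ⟨v, SimpleGraph.Adj.symm w.2⟩).1)
  else (v, none)

/-- What a robot knows about itself, and what co-located robots can read of it: its memory and the
port through which it entered its node in the preceding round (`none` if it did not move then). -/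
abbrev LocalInfo := Memory × Option ℕ

/-- Everything that a robot can observe in a round. Nodes are anonymous and have no memory, so all
that it learns about its node is the degree. -/
structure Observation where
  degree : ℕ
  own : LocalInfo
  others : Multiset LocalInfo

/-- A deterministic algorithm. All robots run the same program; the ID only enters through the
initial memory content. In a round, a robot that has not terminated maps its observation to its
new memory content and an exit port (`none`: stay). `halted` tells from the memory content of a
robot whether the robot has terminated. -/
structure Algorithm where
  init : ℕ → Memory
  act : Observation → Memory × Option ℕ
  halted : Memory → Bool

/-- The state of a robot on a graph with node set `Fin n`. -/
structure RobotState (n : ℕ) where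
  pos : Fin n
  mem : Memory
  entry : Option ℕ

/-- A robot with crash time `crash i` takes part exactly in the rounds `t < crash i`; it never
crashes if `crash i = ⊤`. -/
def Alive {k : ℕ} (crash : Fin k → ℕ∞) (t : ℕ) (i : Fin k) : Prop :=
  (t : ℕ∞) < crash i

open Classical in
/-- The observation of robot `i` in round `t`, when the robots are in the states `c`. Crashed robots
cannot be sensed. -/
noncomputable def observe {n k : ℕ} (G : SimpleGraph (Fin n)) [DecidableRel G.Adj]
    (crash : Fin k → ℕ∞) (t : ℕ) (c : Fin k → RobotState n) (i : Fin k) : Observation where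
  degree := G.degree (c i).pos
  own := ((c i).mem, (c i).entry)
  others := (Finset.univ.filter
    (fun j => j ≠ i ∧ Alive crash t j ∧ (c j).pos = (c i).pos)).val.map
      (fun j => ((c j).mem, (c j).entry))

open Classical in
/-- The execution: `A.config P root crash t i` is the state of robot `i` (whose ID is `i + 1`) at
the beginning of round `t`, when all robots start at `root`. The state of a crashed robot is
meaningless: it is just left unchanged, and no robot reads it. -/
noncomputable def Algorithm.config {n k : ℕ} {G : SimpleGraph (Fin n)} [DecidableRel G.Adj]
    (A : Algorithm) (P : PortLabelling G) (root : Fin n) (crash : Fin k → ℕ∞) :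
    ℕ → Fin k → RobotState n
  | 0 => fun i => ⟨root, A.init (i.val + 1), none⟩
  | t + 1 => fun i =>
      let c := A.config P root crash t
      if ¬ Alive crash t i then c i
      else if A.halted (c i).mem = true then ⟨(c i).pos, (c i).mem, none⟩
      else
        let a := A.act (observe G crash t c i)
        match a.2 with
        | none => ⟨(c i).pos, a.1, none⟩
        | some p =>
            let m := P.traverse (c i).pos p
            ⟨m.1, a.1, m.2⟩

/-- Fault-tolerant dispersion has been achieved at time `t`: no two robots that are still alive
share a node, and all of them have terminated. -/
def Algorithm.DispersedAt {n k : ℕ} {G : SimpleGraph (Fin n)} [DecidableRel G.Adj]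
    (A : Algorithm) (P : PortLabelling G) (root : Fin n) (crash : Fin k → ℕ∞) (t : ℕ) : Prop :=
  (∀ i j : Fin k, Alive crash t i → Alive crash t j → i ≠ j →
    (A.config P root crash t i).pos ≠ (A.config P root crash t j).pos) ∧
  (∀ i : Fin k, Alive crash t i → A.halted (A.config P root crash t i).mem = true)

end Dispersion

/-! The free robots stay together at one node, the base, and carry out a depth-first search whose
data are stored by the settled robots. In even rounds the settled robots are at home. In odd rounds
each of them, except the base robot, walks through its arrow one step towards the base, and then it
returns. So in odd rounds the robots at the base see the living children of the base, together with
the ports that lead to them, and a crashed child becomes noticeable by its absence. In odd rounds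
the free robots leave the base to probe its ports one by one, and they arrive in even rounds, when
homes are manned. At an empty node the robot with the smallest ID settles, the node becomes the
base, and the old base turns its arrow towards it. From an occupied node they return, and the base
robot counts the node if its arrow leads back. When all ports have been probed, fewer visitors than
counted means that a child is missing, and the scan starts again. Otherwise the free robots walk to
a child not yet visited in this epoch, or else back to an open child (arrows point to the base, so
the predecessor in the search is also a child), or else they start a new epoch. The invariant `Good`
uses the set `W` of all nodes that have ever been homes. Pointers lead from all of `W` to the base,
also from abandoned homes, and `W.card` plus the number of free robots is at most `k`. As long as no
settled robot has crashed in the epoch, `Calm` says that the open robots form the stack of the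
search. If the search came to an end in a calm epoch, all of `W` would be manned and completely
scanned; by connectivity `W` would contain all nodes, although it has at most `k - 1 < n` elements.
So only a crash leads to a new epoch (`Good.hurt_of_visited`). The running time is measured by the
potential `pot`, which is at most `3 * k ^ 2 - 2 * k` after the first round. Probing, walking,
settling and starting an epoch all lower it, and so does a crash (`Good.crash`). The effects on
abstract states are computed in `Good.occupied`, `Good.walk`, `Good.newEpoch`, `Good.settleNew` and
`Good.settleHere`; `OddRel.next_state`, `NearRel.next_state` and `FarRel.next_state` relate them to
actual rounds, and `Progress.step` obtains a loss of at least one in two rounds while free robots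
remain. Once all robots are settled, they only commute between home and arrow, and all are at home
when the clock stops at `6 * k ^ 2`. The numbers stored grow by at most one per round, which gives
the memory bound. -/

namespace Dispersion

/-! ### Memory contents -/

/-- What a robot keeps in its memory besides the clock. A robot is either *settled* at a node, its
home, or still *free*. -/
@[ext]
structure Rec where
  /-- the ID -/
  id : ℕ
  /-- whether the robot has a home -/
  settled : Bool
  /-- the port of the home that leads towards the free robots (`0` at the base) -/
  arrow : ℕ
  /-- the next port of the home to be probed; `0` when all ports have been probed -/
  port : ℕ
  /-- whether the free robots are out to probe a port -/
  probing : Bool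
  /-- the number of robots whose arrows are known to lead to the home -/
  count : ℕ
  /-- the last epoch in which the home has been visited -/
  stamp : ℕ
  /-- of a settled robot: its subtree is still being searched in this epoch; of a free robot: the
  arrow of the robot found by the last probe leads back -/
  flag : Bool

instance : Inhabited Rec := ⟨⟨0, false, 0, 0, false, 0, 0, false⟩⟩

def ofBits : List Bool → ℕ
  | [] => 0
  | b :: l => Nat.bit b (ofBits l)

theorem ofBits_bits (n : ℕ) : ofBits n.bits = n := by
  induction n using Nat.binaryRec' with
  | zero => simp [ofBits]
  | bit b n h ih => rw [Nat.bits_append_bit n b h, ofBits, ih]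

def Rec.code (t : ℕ) (r : Rec) : ℕ :=
  Nat.pair t (Nat.pair r.id (Nat.pair r.settled.toNat (Nat.pair r.arrow (Nat.pair r.port
    (Nat.pair r.probing.toNat (Nat.pair r.count (Nat.pair r.stamp r.flag.toNat)))))))

def enc (t : ℕ) (r : Rec) : Memory := (r.code t).bits

def decClock (m : Memory) : ℕ := (ofBits m).unpair.1

def decRec (m : Memory) : Rec :=
  let x := (ofBits m).unpair.2.unpair
  let y := x.2.unpair
  let z := y.2.unpair
  let u := z.2.unpair
  let v := u.2.unpair
  let w := v.2.unpair
  let s := w.2.unpair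
  ⟨x.1, y.1 == 1, z.1, u.1, v.1 == 1, w.1, s.1, s.2 == 1⟩

@[simp] theorem decClock_enc (t : ℕ) (r : Rec) : decClock (enc t r) = t := by
  simp [decClock, enc, ofBits_bits, Rec.code]

@[simp] theorem decRec_enc (t : ℕ) (r : Rec) : decRec (enc t r) = r := by
  have h : ∀ b : Bool, (b.toNat == 1) = b := by decide
  simp [decRec, enc, ofBits_bits, Rec.code, h]

/-- All numbers in a record are less than `B`. -/
structure Rec.Below (r : Rec) (B : ℕ) : Prop where
  id : r.id < B
  arrow : r.arrow < B
  port : r.port < B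
  count : r.count < B
  stamp : r.stamp < B

theorem Rec.Below.mono {r : Rec} {B B' : ℕ} (h : r.Below B) (hB : B ≤ B') : r.Below B' :=
  ⟨h.1.trans_le hB, h.2.trans_le hB, h.3.trans_le hB, h.4.trans_le hB, h.5.trans_le hB⟩

/-- `Nat.pair a b` is less than `(max a b + 1) ^ 2`, so each further pairing doubles the exponent of
`B`. -/
theorem pair_lt_pow {B a b e : ℕ} (he : 1 ≤ e) (ha : a < B) (hb : b < B ^ e) :
    Nat.pair a b < B ^ (2 * e) := by
  have h1 : a < B ^ e := ha.trans_le (Nat.le_self_pow (by omega) B)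
  refine (Nat.pair_lt_max_add_one_sq a b).trans_le ?_
  rw [mul_comm, pow_mul]
  exact Nat.pow_le_pow_left (by omega) 2

theorem enc_length_le {r : Rec} {t B : ℕ} (hB : 2 ≤ B) (ht : t < B) (hr : r.Below B) :
    (enc t r).length ≤ 256 * B.size := by
  have hb : ∀ b : Bool, b.toNat < B := fun b => by cases b <;> simp <;> omega
  have h0 : r.flag.toNat < B ^ 1 := by simpa using hb r.flag
  have h1 := pair_lt_pow (by norm_num) hr.stamp h0
  have h2 := pair_lt_pow (by norm_num) hr.count h1
  have h3 := pair_lt_pow (by norm_num) (hb r.probing) h2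
  have h4 := pair_lt_pow (by norm_num) hr.port h3
  have h5 := pair_lt_pow (by norm_num) hr.arrow h4
  have h6 := pair_lt_pow (by norm_num) (hb r.settled) h5
  have h7 := pair_lt_pow (by norm_num) hr.id h6
  have h8 := pair_lt_pow (by norm_num) ht h7
  rw [enc, Nat.size_eq_bits_len, Nat.size_le]
  -- Nine numbers need eight nested pairings, and `2 ^ 8 = 256`.
  calc r.code t < B ^ 256 := by simpa [Rec.code] using h8
    _ ≤ (2 ^ B.size) ^ 256 := Nat.pow_le_pow_left (Nat.lt_size_self B).le _
    _ = 2 ^ (256 * B.size) := by rw [← pow_mul, mul_comm]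

/-! ### The algorithm -/

/-- A robot as it is seen by the robots at the same node: its record and its entry port. -/
abbrev Seen := Rec × Option ℕ

/-- A record among the robots seen that has the property `p`. -/
noncomputable def pick (S : Multiset Seen) (p : Rec → Prop) : Rec :=
  Classical.epsilon fun r => p r ∧ ∃ y, (r, y) ∈ S

/-- The ports through which the robots with property `p` have entered. -/
def portsOf (V : Multiset Seen) (p : Rec → Prop) : Set ℕ :=
  {q | ∃ x ∈ V, p x.1 ∧ x.2 = some q}

/-- What the base robot and the free robots at the base are going to do. -/
structure Plan where
  /-- the new record of the base robot -/
  base : Rec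
  /-- the port through which the free robots leave -/
  exit : Option ℕ
  /-- whether they are going to probe a port -/
  probe : Bool
  /-- the new epoch -/
  epoch : ℕ

/-- The record of the base robot once it has heard about the result of a probe. -/
def Rec.absorb (r : Rec) (hit : Bool) : Rec :=
  { r with count := if r.probing = true ∧ hit = true then r.count + 1 else r.count }

/-- The next port to be probed. -/
def Rec.next (r : Rec) : ℕ := if r.probing then r.port + 1 else r.port

open Classical in
/-- The decision at a base of degree `deg` with record `b` in epoch `e`, in presence of the
visitors `V`. -/
noncomputable def plan (deg : ℕ) (b : Rec) (e : ℕ) (V : Multiset Seen) : Plan :=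
  if b.next ≠ 0 ∧ b.next ≤ deg then
    ⟨{ b with port := b.next, probing := true, flag := true }, some b.next, true, e⟩
  else if Multiset.card V < b.count then
    ⟨{ b with port := 1, probing := true, count := 0, flag := true }, some 1, true, e⟩
  else if (portsOf V fun r => r.stamp ≠ e).Nonempty then
    let q := sInf (portsOf V fun r => r.stamp ≠ e)
    ⟨{ b with port := 0, probing := false, arrow := q, count := b.count - 1, flag := true },
      some q, false, e⟩
  else if (portsOf V fun r => r.stamp = e ∧ r.flag = true).Nonempty then
    let q := sInf (portsOf V fun r => r.stamp = e ∧ r.flag = true)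
    ⟨{ b with port := 0, probing := false, arrow := q, count := b.count - 1, flag := false },
      some q, false, e⟩
  else ⟨{ b with port := 0, probing := false, stamp := e + 1 }, none, false, e + 1⟩

/-- The record of a settled robot when the free robots have walked to its home. -/
def Rec.arrive (r : Rec) (e : ℕ) : Rec :=
  { r with arrow := 0, count := if r.port = 0 then r.count + 1 else r.count, stamp := e }

/-- The record of a free robot when it settles. -/
def Rec.fresh (r : Rec) : Rec :=
  { r with settled := true, arrow := 0, port := 1, probing := false, count := 0, flag := false }

/-- A probed port becomes the arrow, when the free robots do not return. -/
def Rec.commit (r : Rec) : Rec := { r with arrow := r.port, probing := false }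

open Classical in
/-- In even rounds the settled robots are at home. -/
noncomputable def actEven (r : Rec) (entry : Option ℕ) (S : Multiset Seen) : Rec × Option ℕ :=
  if r.settled = true then
    if r.arrow = 0 then (r, none)
    else if ∃ x ∈ S, x.1.settled = false ∧ x.1.probing = false then
      (r.arrive (pick S fun x => x.settled = false).stamp, none)
    else (r, some r.arrow)
  else if ∃ x ∈ S, x.1.settled = true then
    ({ r with
        probing := false
        flag := decide (∃ x ∈ S, x.1.settled = true ∧ entry = some x.1.arrow) },
      if r.probing = true then entry else none)
  else if ∀ x ∈ S, r.id ≤ x.1.id then (r.fresh, none)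
  else ({ r with probing := false }, none)

open Classical in
/-- In odd rounds the settled robots are at the nodes to which their arrows lead. -/
noncomputable def actOdd (deg : ℕ) (r : Rec) (entry : Option ℕ) (S : Multiset Seen) :
    Rec × Option ℕ :=
  if r.settled = true ∧ r.arrow ≠ 0 then (r, entry)
  else
    let V := S.filter fun x => x.1.settled = true ∧ x.1.arrow ≠ 0
    if r.settled = true then
      if ∃ x ∈ S, x.1.settled = false then
        let g := pick S fun x => x.settled = false
        ((plan deg (r.absorb g.flag) g.stamp V).base, none)
      else if r.probing = true then (r.commit, none)
      else (r, none)
    else if ∃ x ∈ S, x.1.settled = true ∧ x.1.arrow = 0 then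
      let b := pick S fun x => x.settled = true ∧ x.arrow = 0
      let d := plan deg (b.absorb r.flag) r.stamp V
      ({ r with probing := d.probe, stamp := d.epoch }, d.exit)
    else (r, none)

noncomputable def actRec (t deg : ℕ) (r : Rec) (entry : Option ℕ) (S : Multiset Seen) :
    Rec × Option ℕ :=
  if Even t then actEven r entry S else actOdd deg r entry S

/-- The algorithm for `k` robots. -/
noncomputable def pingPong (k : ℕ) : Algorithm where
  init i := enc 0 ⟨i, false, 0, 0, false, 0, 0, false⟩
  act o :=
    let t := decClock o.own.1
    let a := actRec t o.degree (decRec o.own.1) o.own.2 (o.others.map (Prod.map decRec _root_.id))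
    (enc (t + 1) a.1, a.2)
  halted m := decide (6 * k ^ 2 ≤ decClock m)

/-- For at most one robot there is nothing to do. -/
def idle : Algorithm where
  init _ := []
  act _ := ([], none)
  halted _ := true

/-! ### Ports -/

section Ports

variable {n : ℕ} {G : SimpleGraph (Fin n)} [DecidableRel G.Adj] (P : PortLabelling G)

/-- The node to which a port leads. -/
def PortLabelling.target (v : Fin n) (p : ℕ) : Fin n := (P.traverse v p).1

theorem PortLabelling.traverse_symm {v w : Fin n} (h : G.Adj v w) :
    P.traverse v ((P.neighbor v).symm ⟨w, h⟩).1 =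
      (w, some ((P.neighbor w).symm ⟨v, h.symm⟩).1) := by
  rw [PortLabelling.traverse, dif_pos ((P.neighbor v).symm ⟨w, h⟩).2]
  have key : ∀ x : G.neighborSet v, x = ⟨w, h⟩ →
      (x.1, some ((P.neighbor x.1).symm ⟨v, SimpleGraph.Adj.symm x.2⟩).1) =
        (w, some ((P.neighbor w).symm ⟨v, h.symm⟩).1) := by
    rintro _ rfl
    rfl
  exact key _ (by simp)

theorem PortLabelling.traverse_of_mem {v : Fin n} {p : ℕ} (h : p ∈ Finset.Icc 1 (G.degree v)) :
    ∃ q ∈ Finset.Icc 1 (G.degree (P.target v p)), G.Adj v (P.target v p) ∧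
      P.traverse v p = (P.target v p, some q) ∧ P.traverse (P.target v p) q = (v, some p) := by
  obtain ⟨⟨w, hw⟩, hp⟩ := (P.neighbor v).symm.surjective ⟨p, h⟩
  obtain rfl : ((P.neighbor v).symm ⟨w, hw⟩).1 = p := by rw [hp]
  have h1 := P.traverse_symm hw
  have ht : P.target v ((P.neighbor v).symm ⟨w, hw⟩).1 = w := by rw [PortLabelling.target, h1]
  rw [ht]
  exact ⟨_, ((P.neighbor w).symm ⟨v, SimpleGraph.Adj.symm hw⟩).2, hw, h1,
    P.traverse_symm (SimpleGraph.Adj.symm hw)⟩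

theorem PortLabelling.traverse_of_notMem {v : Fin n} {p : ℕ}
    (h : p ∉ Finset.Icc 1 (G.degree v)) : P.traverse v p = (v, none) := by
  simp [PortLabelling.traverse, h]

theorem PortLabelling.adj_target {v : Fin n} {p : ℕ} (h : p ∈ Finset.Icc 1 (G.degree v)) :
    G.Adj v (P.target v p) := (P.traverse_of_mem h).choose_spec.2.1

theorem PortLabelling.target_inj {v : Fin n} {p q : ℕ} (hp : p ∈ Finset.Icc 1 (G.degree v))
    (hq : q ∈ Finset.Icc 1 (G.degree v)) (h : P.target v p = P.target v q) : p = q := by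
  have h' : P.neighbor v ⟨p, hp⟩ = P.neighbor v ⟨q, hq⟩ := by
    apply Subtype.ext
    simpa [PortLabelling.target, PortLabelling.traverse, hp, hq] using h
  simpa using (P.neighbor v).injective h'

theorem PortLabelling.exists_port {v w : Fin n} (h : G.Adj v w) :
    ∃ p ∈ Finset.Icc 1 (G.degree v), P.target v p = w := by
  refine ⟨((P.neighbor v).symm ⟨w, h⟩).1, ((P.neighbor v).symm ⟨w, h⟩).2, ?_⟩
  have h2 := ((P.neighbor v).symm ⟨w, h⟩).2
  rw [PortLabelling.target, PortLabelling.traverse, dif_pos h2]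
  simp

theorem PortLabelling.entry_le {v : Fin n} {p q : ℕ} (h : (P.traverse v p).2 = some q) :
    q ∈ Finset.Icc 1 (G.degree (P.target v p)) := by
  by_cases hp : p ∈ Finset.Icc 1 (G.degree v)
  · obtain ⟨q', hq', -, h1, -⟩ := P.traverse_of_mem hp
    rw [h1] at h
    simp only [Option.some.injEq] at h
    exact h ▸ hq'
  · rw [P.traverse_of_notMem hp] at h
    simp at h

/-- The effect of a move: the node reached and the entry port. -/
def PortLabelling.move (v : Fin n) : Option ℕ → Fin n × Option ℕ
  | none => (v, none)
  | some p => P.traverse v p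

/-- A robot that leaves its home and then goes back through its entry port is home again. -/
theorem PortLabelling.move_back (v : Fin n) (p : ℕ) :
    (P.move (P.traverse v p).1 (P.traverse v p).2).1 = v := by
  by_cases hp : p ∈ Finset.Icc 1 (G.degree v)
  · obtain ⟨q', hq', -, h1, h2⟩ := P.traverse_of_mem hp
    rw [h1]
    simp [PortLabelling.move, h2]
  · simp [P.traverse_of_notMem hp, PortLabelling.move]

end Ports

/-! ### Executions in terms of records -/

/-- The state of a robot, with its record instead of its memory. -/
structure Rob (n : ℕ) where
  pos : Fin n
  info : Rec
  entry : Option ℕ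

section Run

variable {n k : ℕ} {G : SimpleGraph (Fin n)} [DecidableRel G.Adj] (P : PortLabelling G)

/-- What robot `i` sees of the other robots when `S` is the set of robots that are alive. -/
def scene (S : Finset (Fin k)) (c : Fin k → Rob n) (i : Fin k) : Multiset Seen :=
  (S.filter fun j => j ≠ i ∧ (c j).pos = (c i).pos).val.map fun j => ((c j).info, (c j).entry)

theorem mem_scene {S : Finset (Fin k)} {c : Fin k → Rob n} {i : Fin k} {x : Seen} :
    x ∈ scene S c i ↔
      ∃ j ∈ S, j ≠ i ∧ (c j).pos = (c i).pos ∧ ((c j).info, (c j).entry) = x := by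
  simp [scene, and_assoc]

/-- The action of robot `i` in round `t`. -/
noncomputable def action (t : ℕ) (G : SimpleGraph (Fin n)) [DecidableRel G.Adj]
    (S : Finset (Fin k)) (c : Fin k → Rob n) (i : Fin k) : Rec × Option ℕ :=
  actRec t (G.degree (c i).pos) (c i).info (c i).entry (scene S c i)

noncomputable def step (t : ℕ) (S : Finset (Fin k)) (c : Fin k → Rob n) (i : Fin k) : Rob n :=
  ⟨(P.move (c i).pos (action t G S c i).2).1, (action t G S c i).1,
    (P.move (c i).pos (action t G S c i).2).2⟩

def RobotState.view (s : RobotState n) : Rob n := ⟨s.pos, decRec s.mem, s.entry⟩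

open Classical in
/-- The robots that are alive in round `t`. -/
noncomputable def aliveSet (crash : Fin k → ℕ∞) (t : ℕ) : Finset (Fin k) :=
  Finset.univ.filter (Alive crash t)

theorem mem_aliveSet {crash : Fin k → ℕ∞} {t : ℕ} {i : Fin k} :
    i ∈ aliveSet crash t ↔ Alive crash t i := by simp [aliveSet]

theorem aliveSet_anti (crash : Fin k → ℕ∞) {s t : ℕ} (h : s ≤ t) :
    aliveSet crash t ⊆ aliveSet crash s := by
  intro i hi
  rw [mem_aliveSet] at hi ⊢
  exact lt_of_le_of_lt (by exact_mod_cast h) hi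

variable (root : Fin n) (crash : Fin k → ℕ∞)

noncomputable def views (t : ℕ) (i : Fin k) : Rob n :=
  ((pingPong k).config P root crash t i).view

theorem views_zero (i : Fin k) :
    views P root crash 0 i = ⟨root, ⟨i + 1, false, 0, 0, false, 0, 0, false⟩, none⟩ := by
  simp [views, Algorithm.config, pingPong, RobotState.view]

theorem observe_others (A : Algorithm) (t : ℕ) (i : Fin k) :
    (observe G crash t (A.config P root crash t) i).others.map (Prod.map decRec _root_.id) =
      scene (aliveSet crash t) (fun j => (A.config P root crash t j).view) i := by
  rw [observe, scene, Multiset.map_map]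
  congr 2
  ext j
  simp only [Finset.mem_filter, Finset.mem_univ, true_and, mem_aliveSet]
  simp only [RobotState.view]
  tauto

/-- The stored clock gives the parity of the round and shows that the robot has not halted, so a
round of the encoded algorithm is `step` on decoded records. -/
theorem config_succ {t : ℕ} (ht : t < 6 * k ^ 2) {i : Fin k} (hi : i ∈ aliveSet crash t)
    (hc : decClock ((pingPong k).config P root crash t i).mem = t) :
    (pingPong k).config P root crash (t + 1) i =
      ⟨(step P t (aliveSet crash t) (views P root crash t) i).pos,
        enc (t + 1) (step P t (aliveSet crash t) (views P root crash t) i).info,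
        (step P t (aliveSet crash t) (views P root crash t) i).entry⟩ := by
  have hi' : Alive crash t i := mem_aliveSet.1 hi
  have hh : ¬ (pingPong k).halted ((pingPong k).config P root crash t i).mem = true := by
    simp only [pingPong, decide_eq_true_eq] at hc ⊢
    omega
  have ha : (pingPong k).act (observe G crash t ((pingPong k).config P root crash t) i) =
      (enc (t + 1) (action t G (aliveSet crash t) (views P root crash t) i).1,
        (action t G (aliveSet crash t) (views P root crash t) i).2) := by
    have ho := observe_others P root crash (pingPong k) t i
    have hc' : decClock (observe G crash t ((pingPong k).config P root crash t) i).own.1 = t := hc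
    simp only [pingPong] at ho hc' ⊢
    rw [ho, hc']
    rfl
  rw [Algorithm.config]
  simp only [hi', not_true_eq_false, if_false, hh, ha]
  rw [step]
  cases (action t G (aliveSet crash t) (views P root crash t) i).2 <;> rfl

theorem clock_eq {t : ℕ} (ht : t ≤ 6 * k ^ 2) {i : Fin k} (hi : i ∈ aliveSet crash t) :
    decClock ((pingPong k).config P root crash t i).mem = t := by
  induction t with
  | zero => simp [Algorithm.config, pingPong]
  | succ t ih =>
    have hi' := aliveSet_anti crash t.le_succ hi
    rw [config_succ P root crash (by omega) hi' (ih (by omega) hi')]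
    simp

theorem views_succ {t : ℕ} (ht : t < 6 * k ^ 2) {i : Fin k} (hi : i ∈ aliveSet crash t) :
    views P root crash (t + 1) i = step P t (aliveSet crash t) (views P root crash t) i := by
  rw [views, config_succ P root crash ht hi (clock_eq P root crash ht.le hi)]
  simp [RobotState.view]

theorem mem_eq_enc {t : ℕ} (ht : t ≤ 6 * k ^ 2) {i : Fin k} (hi : i ∈ aliveSet crash t) :
    ((pingPong k).config P root crash t i).mem = enc t (views P root crash t i).info := by
  cases t with
  | zero => simp [views, Algorithm.config, pingPong, RobotState.view]
  | succ t =>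
    have hi' := aliveSet_anti crash t.le_succ hi
    rw [views_succ P root crash (by omega) hi', config_succ P root crash (by omega) hi'
      (clock_eq P root crash (by omega) hi')]

/-- After the last round of the algorithm nothing changes any more. -/
theorem config_of_le {t : ℕ} (ht : 6 * k ^ 2 ≤ t) {i : Fin k} (hi : i ∈ aliveSet crash t) :
    ((pingPong k).config P root crash t i).pos =
        ((pingPong k).config P root crash (6 * k ^ 2) i).pos ∧
      ((pingPong k).config P root crash t i).mem =
        ((pingPong k).config P root crash (6 * k ^ 2) i).mem := by
  induction t, ht using Nat.le_induction with
  | base => simp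
  | succ t ht ih =>
    have hi' := aliveSet_anti crash t.le_succ hi
    obtain ⟨h1, h2⟩ := ih hi'
    have h3 := clock_eq P root crash le_rfl (aliveSet_anti crash ht hi')
    have hh : (pingPong k).halted ((pingPong k).config P root crash t i).mem = true := by
      rw [h2]
      simp only [pingPong, decide_eq_true_eq] at h3 ⊢
      omega
    rw [Algorithm.config]
    simp only [mem_aliveSet.1 hi', not_true_eq_false, if_false, hh, if_true]
    exact ⟨h1, h2⟩

end Run

/-! ### Abstract states -/

/-- An abstract state of the search: the records and homes of the robots, the node `base` at which
the free robots are, the nodes `W` that have been homes so far, the pointers `par` of the nodes in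
`W` towards the base, the epoch, and whether a settled robot has crashed during this epoch. -/
structure Abs (n k : ℕ) where
  rc : Fin k → Rec
  hm : Fin k → Fin n
  base : Fin n
  W : Finset (Fin n)
  par : Fin n → Fin n
  ep : ℕ
  hurt : Prop

section Abstract

open Classical

variable {n k : ℕ} {G : SimpleGraph (Fin n)} [DecidableRel G.Adj] (P : PortLabelling G)

/-- Robot `i` is alive and has a home. -/
def Abs.At (X : Abs n k) (S : Finset (Fin k)) (i : Fin k) : Prop :=
  i ∈ S ∧ (X.rc i).settled = true

/-- Node `u` is the home of a robot that is alive. -/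
def Abs.Live (X : Abs n k) (S : Finset (Fin k)) (u : Fin n) : Prop := ∃ j, X.At S j ∧ X.hm j = u

/-- Robot `i` has been visited in this epoch, and its search goes on. -/
def Abs.Open (X : Abs n k) (i : Fin k) : Prop :=
  X.hm i ≠ X.base ∧ (X.rc i).stamp = X.ep ∧ (X.rc i).flag = true

/-- According to the record `r` of the robot with home `v`, the neighbour `u` has been probed. -/
def Scanned (r : Rec) (v u : Fin n) : Prop :=
  r.port = 0 ∨ ∃ q ∈ Finset.Icc 1 (G.degree v), P.target v q = u ∧
    (q < r.port ∨ q = r.port ∧ r.probing = true)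

/-- Abandoned homes stay in `W` and remain kids, so that a crash shows up as an excess of `count`
over the live kids. Neighbours not yet probed are left out, since the robot cannot have counted
them. -/
noncomputable def Abs.kids (X : Abs n k) (r : Rec) (v : Fin n) : Finset (Fin n) :=
  X.W.filter fun u => u ≠ X.base ∧ X.par u = v ∧ Scanned P r v u

noncomputable def Abs.liveKids (X : Abs n k) (S : Finset (Fin k)) (r : Rec) (v : Fin n) :
    Finset (Fin n) := (X.kids P r v).filter (X.Live S)

/-- What holds in an epoch until a settled robot crashes. -/
structure Calm (S : Finset (Fin k)) (X : Abs n k) : Prop where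
  base_live : X.Live S X.base
  closed : ∀ i, X.At S i → X.hm i ≠ X.base → (X.rc i).stamp = X.ep → (X.rc i).flag = false →
    (X.rc i).port = 0 ∧ ∀ u ∈ X.W, u ≠ X.base → X.par u = X.hm i →
      ∃ j, X.At S j ∧ X.hm j = u ∧ (X.rc j).stamp = X.ep
  opened : ∀ i, X.At S i → X.Open i → X.par (X.hm i) = X.base ∨
    ∃ j, X.At S j ∧ X.Open j ∧ X.hm j = X.par (X.hm i)
  opened_inj : ∀ i j, X.At S i → X.At S j → X.Open i → X.Open j →
    X.par (X.hm i) = X.par (X.hm j) → i = j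

/-- The invariant of the search when `S` is the set of robots that are alive. -/
structure Good (S : Finset (Fin k)) (X : Abs n k) : Prop where
  base_mem : X.base ∈ X.W
  hm_mem : ∀ i, X.At S i → X.hm i ∈ X.W
  hm_inj : ∀ i j, X.At S i → X.At S j → X.hm i = X.hm j → i = j
  at_base : ∀ i, X.At S i → X.hm i = X.base → (X.rc i).arrow = 0 ∧ (X.rc i).stamp = X.ep
  arrow_mem : ∀ i, X.At S i → X.hm i ≠ X.base →
    (X.rc i).arrow ∈ Finset.Icc 1 (G.degree (X.hm i))
  target_arrow : ∀ i, X.At S i → X.hm i ≠ X.base →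
    P.target (X.hm i) (X.rc i).arrow = X.par (X.hm i)
  not_probing : ∀ i, X.At S i → X.hm i ≠ X.base → (X.rc i).probing = false
  port_eq : ∀ i, X.At S i → X.hm i ≠ X.base → (X.rc i).port ≠ 0 → (X.rc i).port = (X.rc i).arrow
  adj : ∀ u ∈ X.W, u ≠ X.base → G.Adj u (X.par u)
  chain : ∀ w ∈ X.W, Relation.ReflTransGen (fun a b => a ∈ X.W ∧ X.par a = b) w X.base
  kids_le : ∀ i, X.At S i → (X.kids P (X.rc i) (X.hm i)).card ≤ (X.rc i).count
  done : ∀ i, X.At S i → (X.rc i).port = 0 → (X.rc i).probing = false ∧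
    ∀ u, G.Adj (X.hm i) u → u ∈ X.W
  port_le : ∀ i, X.At S i → (X.rc i).port ≤ G.degree (X.hm i)
  scan : ∀ i, X.At S i → ∀ q, 1 ≤ q → q < (X.rc i).port → P.target (X.hm i) q ∈ X.W
  probed : ∀ i, X.At S i → (X.rc i).probing = true → P.target (X.hm i) (X.rc i).port ∈ X.W
  card_le : X.W.card + (S.filter fun i => (X.rc i).settled = false).card ≤ k
  stamp_le : ∀ i, X.At S i → (X.rc i).stamp ≤ X.ep
  calm : ¬ X.hurt → Calm S X

/-- A bound for the number of probes until the scan of the ports ends. -/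
def scanCost (k : ℕ) (r : Rec) : ℕ :=
  if r.port = 0 then 0 else k - 1 - r.port - r.probing.toNat

/-- The first `k - 2` of a settled robot is a reserve: if it crashes, the robot it points to misses
a child and may need a new scan of up to `k - 2` probes. Missing children have such scans already
credited. The last term is 2 before the visit in the current epoch, 1 for an open robot, and 0 for a
closed one or at the base. A free robot owns the reserve, its first scan, and 2 for the move by
which it settles. -/
noncomputable def weight (S : Finset (Fin k)) (X : Abs n k) (i : Fin k) : ℕ :=
  if (X.rc i).settled = true then
    (k - 2) + scanCost k (X.rc i) +
      (k - 2) * ((X.rc i).count - (X.liveKids P S (X.rc i) (X.hm i)).card) +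
      if (X.rc i).stamp = X.ep then if (X.rc i).flag = true ∧ X.hm i ≠ X.base then 1 else 0 else 2
  else 2 * (k - 2) + 2

/-- The potential, which decreases in every two rounds. -/
noncomputable def pot (S : Finset (Fin k)) (X : Abs n k) : ℕ :=
  S.card ^ 2 + (if X.hurt then 2 * S.card else 0) + ∑ i ∈ S, weight P S X i

theorem sum_ite_le {ι : Type*} (T : Finset ι) (p : ι → Prop) [DecidablePred p] (d : ℕ)
    (hp : ∀ i ∈ T, ∀ j ∈ T, p i → p j → i = j) : ∑ i ∈ T, (if p i then d else 0) ≤ d := by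
  rw [← Finset.sum_filter, Finset.sum_const, smul_eq_mul]
  have : (T.filter p).card ≤ 1 := by
    rw [Finset.card_le_one]
    intro a ha b hb
    rw [Finset.mem_filter] at ha hb
    exact hp a ha.1 b hb.1 ha.2 hb.2
  nlinarith

/-! ### Crashes, and changes of the record at the base -/

variable {P} {S : Finset (Fin k)} {X : Abs n k}

/-- The reserve `k - 2` of the crashed robot pays for the child that is now missing. The square
drops by `2 * (S.card - 1) + 1`, which covers a new `hurt` term and leaves one. -/
theorem Good.crash_one (h : Good P S X) {i₀ : Fin k} (hi₀ : i₀ ∈ S) :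
    ∃ hurt : Prop, Good P (S.erase i₀) { X with hurt := hurt } ∧
      pot P (S.erase i₀) { X with hurt := hurt } + 1 ≤ pot P S X := by
  set Y : Abs n k := { X with hurt := X.hurt ∨ (X.rc i₀).settled = true } with hY
  have sub : ∀ i, Y.At (S.erase i₀) i → X.At S i := fun i hi => ⟨Finset.mem_of_mem_erase hi.1, hi.2⟩
  refine ⟨X.hurt ∨ (X.rc i₀).settled = true, ?_, ?_⟩
  · refine ⟨h.base_mem, fun i hi => h.hm_mem i (sub i hi),
      fun i j hi hj => h.hm_inj i j (sub i hi) (sub j hj), fun i hi => h.at_base i (sub i hi),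
      fun i hi => h.arrow_mem i (sub i hi), fun i hi => h.target_arrow i (sub i hi),
      fun i hi => h.not_probing i (sub i hi), fun i hi => h.port_eq i (sub i hi), h.adj, h.chain,
      fun i hi => h.kids_le i (sub i hi), fun i hi => h.done i (sub i hi),
      fun i hi => h.port_le i (sub i hi), fun i hi => h.scan i (sub i hi),
      fun i hi => h.probed i (sub i hi), ?_, fun i hi => h.stamp_le i (sub i hi), ?_⟩
    · refine le_trans ?_ h.card_le
      gcongr
      exact Finset.erase_subset _ _
    · intro hh
      -- Without `hurt` the crashed robot was free, so no settled robot has been lost.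
      have hf : ¬ (X.rc i₀).settled = true := fun h => hh (Or.inr h)
      have hc := h.calm fun h => hh (Or.inl h)
      have sup : ∀ i, X.At S i → Y.At (S.erase i₀) i := by
        intro i hi
        refine ⟨Finset.mem_erase.2 ⟨?_, hi.1⟩, hi.2⟩
        rintro rfl
        exact hf hi.2
      refine ⟨?_, ?_, ?_, ?_⟩
      · obtain ⟨j, hj, hj'⟩ := hc.base_live
        exact ⟨j, sup j hj, hj'⟩
      · intro i hi h1 h2 h3
        obtain ⟨h4, h5⟩ := hc.closed i (sub i hi) h1 h2 h3
        refine ⟨h4, fun u hu h6 h7 => ?_⟩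
        obtain ⟨j, hj, hj'⟩ := h5 u hu h6 h7
        exact ⟨j, sup j hj, hj'⟩
      · intro i hi h1
        refine (hc.opened i (sub i hi) h1).imp _root_.id ?_
        rintro ⟨j, hj, hj'⟩
        exact ⟨j, sup j hj, hj'⟩
      · exact fun i j hi hj => hc.opened_inj i j (sub i hi) (sub j hj)
  · have hcard : S.card = (S.erase i₀).card + 1 := (Finset.card_erase_add_one hi₀).symm
    have key : ∑ i ∈ S.erase i₀, weight P (S.erase i₀) Y i ≤ ∑ i ∈ S, weight P S X i := by
      rw [← Finset.sum_erase_add _ _ hi₀]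
      have h1 : ∀ i ∈ S.erase i₀, weight P (S.erase i₀) Y i ≤ weight P S X i +
          if (X.rc i).settled = true ∧ X.par (X.hm i₀) = X.hm i then k - 2 else 0 := by
        intro i hi
        by_cases hs : (X.rc i).settled = true
        swap
        · simp [weight, hY, hs]
        have h2 : (X.liveKids P S (X.rc i) (X.hm i)).erase (X.hm i₀) ⊆
            Y.liveKids P (S.erase i₀) (X.rc i) (X.hm i) := by
          intro u hu
          simp only [Abs.liveKids, Finset.mem_erase, Finset.mem_filter] at hu ⊢
          obtain ⟨hu, h3, j, hj, rfl⟩ := hu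
          refine ⟨h3, j, ⟨Finset.mem_erase.2 ⟨?_, hj.1⟩, hj.2⟩, rfl⟩
          rintro rfl
          exact hu rfl
        have h3 := Finset.card_le_card h2
        simp only [weight, hY, hs, if_true, true_and]
        simp only [hY] at h3
        by_cases h4 : X.par (X.hm i₀) = X.hm i
        · have h5 := Finset.pred_card_le_card_erase (s := X.liveKids P S (X.rc i) (X.hm i))
            (a := X.hm i₀)
          rw [if_pos h4]
          have h6 : (X.rc i).count - (Y.liveKids P (S.erase i₀) (X.rc i) (X.hm i)).card ≤
            (X.rc i).count - (X.liveKids P S (X.rc i) (X.hm i)).card + 1 := by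
            simp only [hY]
            omega
          have h7 := Nat.mul_le_mul_left (k - 2) h6
          rw [mul_add, mul_one] at h7
          simp only [hY] at h7
          omega
        · rw [if_neg h4]
          rw [Finset.erase_eq_of_notMem] at h3
          · have h7 := Nat.mul_le_mul_left (k - 2) (Nat.sub_le_sub_left h3 (X.rc i).count)
            omega
          · simp only [Abs.liveKids, Abs.kids, Finset.mem_filter]
            tauto
      -- Homes are distinct, so at most one robot misses the crashed one as a child.
      have h2 := sum_ite_le (S.erase i₀)
        (fun i => (X.rc i).settled = true ∧ X.par (X.hm i₀) = X.hm i) (k - 2) (by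
          intro i hi j hj h1 h2
          exact h.hm_inj i j ⟨Finset.mem_of_mem_erase hi, h1.1⟩ ⟨Finset.mem_of_mem_erase hj, h2.1⟩
            (h1.2.symm.trans h2.2))
      have h3 : k - 2 ≤ weight P S X i₀ := by
        rw [weight]
        split_ifs <;> omega
      have h4 := Finset.sum_le_sum h1
      rw [Finset.sum_add_distrib] at h4
      omega
    rw [pot, pot, hcard]
    change _ + _ + ∑ i ∈ S.erase i₀, weight P (S.erase i₀) Y i + 1 ≤ _
    have hsq : ((S.erase i₀).card + 1) ^ 2 = (S.erase i₀).card ^ 2 + 2 * (S.erase i₀).card + 1 := by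
      ring
    simp only
    split_ifs <;> omega

/-- The invariant survives crashes, and the potential decreases. -/
theorem Good.crash (h : Good P S X) {T : Finset (Fin k)} (hT : T ⊆ S) :
    ∃ hurt : Prop, Good P T { X with hurt := hurt } ∧
      pot P T { X with hurt := hurt } + S.card ≤ pot P S X + T.card := by
  induction hd : (S \ T).card generalizing S X with
  | zero =>
    have : S = T := Finset.Subset.antisymm
      (Finset.sdiff_eq_empty_iff_subset.1 (Finset.card_eq_zero.1 hd)) hT
    subst this
    exact ⟨X.hurt, h, le_rfl⟩
  | succ d ih =>
    obtain ⟨i, hi⟩ : (S \ T).Nonempty := Finset.card_pos.1 (by omega)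
    obtain ⟨hi1, hi2⟩ := Finset.mem_sdiff.1 hi
    obtain ⟨hurt, h1, h2⟩ := h.crash_one hi1
    have hsub : T ⊆ S.erase i := fun j hj => Finset.mem_erase.2 ⟨by rintro rfl; exact hi2 hj, hT hj⟩
    obtain ⟨hurt', h3, h4⟩ := ih h1 hsub (by
      rw [Finset.erase_sdiff_comm, Finset.card_erase_of_mem hi, hd, Nat.add_sub_cancel])
    refine ⟨hurt', h3, ?_⟩
    have := Finset.card_erase_add_one hi1
    simp only at h4
    omega

/-- The robot at the base may change its record. -/
theorem Good.setBase (h : Good P S X) {b : Fin k} (hb : X.At S b) (hbb : X.hm b = X.base)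
    {r : Rec} (hs : r.settled = true) (ha : r.arrow = 0) (he : r.stamp = X.ep)
    (hk : (X.kids P r X.base).card ≤ r.count)
    (hd : r.port = 0 → r.probing = false ∧ ∀ u, G.Adj X.base u → u ∈ X.W)
    (hp : r.port ≤ G.degree X.base)
    (hq : ∀ q, 1 ≤ q → q < r.port → P.target X.base q ∈ X.W)
    (hpr : r.probing = true → P.target X.base r.port ∈ X.W) :
    Good P S { X with rc := Function.update X.rc b r } := by
  set Y : Abs n k := { X with rc := Function.update X.rc b r } with hY
  have hrb : Y.rc b = r := by simp [hY]
  have hrn : ∀ i, i ≠ b → Y.rc i = X.rc i := fun i hi => by simp [hY, hi]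
  have hset : ∀ i, ((Y.rc i).settled = true ↔ (X.rc i).settled = true) := by
    intro i
    by_cases hi : i = b
    · subst hi; simp [hrb, hs, hb.2]
    · rw [hrn i hi]
  have hat : ∀ i, Y.At S i ↔ X.At S i := fun i => and_congr_right fun _ => hset i
  have hoff : ∀ i, X.At S i → X.hm i ≠ X.base → Y.rc i = X.rc i := by
    intro i _ h2
    exact hrn i fun h => h2 (h ▸ hbb)
  have hopen : ∀ i, X.At S i → (Y.Open i ↔ X.Open i) := by
    intro i hi
    refine and_congr_right fun h1 => ?_
    rw [hoff i hi h1]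
  refine ⟨h.base_mem, fun i hi => h.hm_mem i ((hat i).1 hi),
      fun i j hi hj => h.hm_inj i j ((hat i).1 hi) ((hat j).1 hj), ?_, ?_, ?_, ?_, ?_, h.adj, h.chain,
      ?_, ?_, ?_, ?_, ?_, ?_, ?_, ?_⟩
  · intro i hi h1
    by_cases hib : i = b
    · rw [hib, hrb]; exact ⟨ha, he⟩
    · rw [hrn i hib]; exact h.at_base i ((hat i).1 hi) h1
  · intro i hi h1
    rw [hoff i ((hat i).1 hi) h1]; exact h.arrow_mem i ((hat i).1 hi) h1
  · intro i hi h1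
    rw [hoff i ((hat i).1 hi) h1]; exact h.target_arrow i ((hat i).1 hi) h1
  · intro i hi h1
    rw [hoff i ((hat i).1 hi) h1]; exact h.not_probing i ((hat i).1 hi) h1
  · intro i hi h1
    rw [hoff i ((hat i).1 hi) h1]; exact h.port_eq i ((hat i).1 hi) h1
  · intro i hi
    by_cases hib : i = b
    · subst hib; rw [hrb, show Y.hm i = X.base from hbb]; exact hk
    · rw [hrn i hib]; exact h.kids_le i ((hat i).1 hi)
  · intro i hi
    by_cases hib : i = b
    · subst hib; rw [hrb, show Y.hm i = X.base from hbb]; exact hd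
    · rw [hrn i hib]; exact h.done i ((hat i).1 hi)
  · intro i hi
    by_cases hib : i = b
    · subst hib; rw [hrb, show Y.hm i = X.base from hbb]; exact hp
    · rw [hrn i hib]; exact h.port_le i ((hat i).1 hi)
  · intro i hi
    by_cases hib : i = b
    · subst hib; rw [hrb, show Y.hm i = X.base from hbb]; exact hq
    · rw [hrn i hib]; exact h.scan i ((hat i).1 hi)
  · intro i hi
    by_cases hib : i = b
    · subst hib; rw [hrb, show Y.hm i = X.base from hbb]; exact hpr
    · rw [hrn i hib]; exact h.probed i ((hat i).1 hi)
  · have : (S.filter fun i => (Y.rc i).settled = false) =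
        S.filter fun i => (X.rc i).settled = false := by
      refine Finset.filter_congr fun i _ => ?_
      have := hset i
      simp only [← Bool.not_eq_true]
      tauto
    rw [this]
    exact h.card_le
  · intro i hi
    by_cases hib : i = b
    · subst hib; rw [hrb]; exact he.le
    · rw [hrn i hib]; exact h.stamp_le i ((hat i).1 hi)
  · intro hh
    have hc := h.calm hh
    refine ⟨?_, ?_, ?_, ?_⟩
    · obtain ⟨j, hj, hj'⟩ := hc.base_live
      exact ⟨j, (hat j).2 hj, hj'⟩
    · intro i hi h1 h2 h3
      rw [hoff i ((hat i).1 hi) h1] at h2 h3 ⊢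
      obtain ⟨h4, h5⟩ := hc.closed i ((hat i).1 hi) h1 h2 h3
      refine ⟨h4, fun u hu h6 h7 => ?_⟩
      obtain ⟨j, hj, rfl, hj'⟩ := h5 u hu h6 h7
      refine ⟨j, (hat j).2 hj, rfl, ?_⟩
      rw [hoff j hj h6]
      exact hj'
    · intro i hi h1
      refine (hc.opened i ((hat i).1 hi) ((hopen i ((hat i).1 hi)).1 h1)).imp _root_.id ?_
      rintro ⟨j, hj, hj', hj''⟩
      exact ⟨j, (hat j).2 hj, (hopen j hj).2 hj', hj''⟩
    · intro i j hi hj h1 h2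
      exact hc.opened_inj i j ((hat i).1 hi) ((hat j).1 hj) ((hopen i ((hat i).1 hi)).1 h1)
        ((hopen j ((hat j).1 hj)).1 h2)

/-- The weights of the other robots involve `b` only through `Abs.Live`, which does not change as
long as `b` remains settled. -/
theorem pot_setBase {b : Fin k} (hb : X.At S b) {r : Rec} (hs : r.settled = true) {d : ℕ}
    (hw : weight P S { X with rc := Function.update X.rc b r } b + d ≤ weight P S X b) :
    pot P S { X with rc := Function.update X.rc b r } + d ≤ pot P S X := by
  have hlive : ∀ u, Abs.Live { X with rc := Function.update X.rc b r } S u = X.Live S u := by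
    intro u
    simp only [Abs.Live, Abs.At, eq_iff_iff]
    refine exists_congr fun j => ?_
    by_cases hj : j = b
    · subst hj; simp [hs, hb.2]
    · simp [hj]
  have hne : ∀ i ∈ S.erase b, weight P S { X with rc := Function.update X.rc b r } i =
      weight P S X i := by
    intro i hi
    have hi' : i ≠ b := (Finset.mem_erase.1 hi).1
    simp only [weight, Abs.liveKids, hlive, Function.update_of_ne hi', Abs.kids]
  have h1 : ∑ i ∈ S.erase b, weight P S { X with rc := Function.update X.rc b r } i =
    ∑ i ∈ S.erase b, weight P S X i := Finset.sum_congr rfl hne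
  have h2 := Finset.sum_erase_add S (weight P S X) hb.1
  have h3 := Finset.sum_erase_add S
    (weight P S { X with rc := Function.update X.rc b r }) hb.1
  simp only [pot] at h1 h2 h3 ⊢
  omega

end Abstract

/-! ### Moving the base to an adjacent node -/

section Rebase

open Classical

variable {n k : ℕ} {G : SimpleGraph (Fin n)} [DecidableRel G.Adj] (P : PortLabelling G)

theorem kids_congr (X : Abs n k) {r r' : Rec} (v : Fin n) (h : r.port = r'.port)
    (h' : r.probing = r'.probing) : X.kids P r v = X.kids P r' v := by
  ext u
  have : Scanned P r v u ↔ Scanned P r' v u := by simp only [Scanned, h, h']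
  simp only [Abs.kids, Finset.mem_filter, this]

theorem liveKids_congr (X : Abs n k) (S : Finset (Fin k)) {r r' : Rec} (v : Fin n)
    (h : r.port = r'.port) (h' : r.probing = r'.probing) :
    X.liveKids P S r v = X.liveKids P S r' v := by
  rw [Abs.liveKids, kids_congr P X v h h', Abs.liveKids]

/-- The base moves to the adjacent node `x`, the home of robot `j` in the new state `Y`. -/
structure Rebase (S : Finset (Fin k)) (X Y : Abs n k) (j : Fin k) (x : Fin n) : Prop where
  ne : x ≠ X.base
  adj : G.Adj X.base x
  base : Y.base = x
  W : Y.W = insert x X.W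
  par : Y.par = Function.update X.par X.base x
  ep : Y.ep = X.ep
  hurt : Y.hurt = X.hurt
  hm : ∀ i, i ≠ j → Y.hm i = X.hm i
  hm_j : Y.hm j = x
  mem : j ∈ S
  settled : ∀ i, i ≠ j → (Y.rc i).settled = (X.rc i).settled
  settled_j : (Y.rc j).settled = true
  arrow_j : (Y.rc j).arrow = 0
  stamp_j : (Y.rc j).stamp = X.ep
  probing_j : (Y.rc j).probing = false
  port_j : (Y.rc j).port = 1 ∨ X.At S j ∧ (Y.rc j).port = (X.rc j).port
  old_j : X.At S j → X.hm j = x ∧ X.par x = X.base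
  away : ∀ i, X.At S i → i ≠ j → X.hm i ≠ x
  off : ∀ i, X.At S i → i ≠ j → X.hm i ≠ X.base → Y.rc i = X.rc i
  arrow_mem : ∀ b, X.At S b → X.hm b = X.base →
    (Y.rc b).arrow ∈ Finset.Icc 1 (G.degree X.base)
  target : ∀ b, X.At S b → X.hm b = X.base → P.target X.base (Y.rc b).arrow = x
  port_b : ∀ b, X.At S b → X.hm b = X.base → (Y.rc b).port = (X.rc b).port
  port_eq : ∀ b, X.At S b → X.hm b = X.base → (Y.rc b).port ≠ 0 → (Y.rc b).port = (Y.rc b).arrow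
  probing_b : ∀ b, X.At S b → X.hm b = X.base → (Y.rc b).probing = false
  probing_old : ∀ b, X.At S b → X.hm b = X.base → (X.rc b).probing = false
  stamp_b : ∀ b, X.At S b → X.hm b = X.base → (Y.rc b).stamp = X.ep

variable {P} {S : Finset (Fin k)} {X Y : Abs n k} {j : Fin k} {x : Fin n}

namespace Rebase

theorem at_iff (R : Rebase P S X Y j x) {i : Fin k} (hi : i ≠ j) : Y.At S i ↔ X.At S i := by
  rw [Abs.At, Abs.At, R.settled i hi]

theorem at_j (R : Rebase P S X Y j x) : Y.At S j := ⟨R.mem, R.settled_j⟩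

theorem at_of (R : Rebase P S X Y j x) {i : Fin k} (hi : X.At S i) : Y.At S i := by
  by_cases h : i = j
  · exact h ▸ R.at_j
  · exact (R.at_iff h).2 hi

theorem ne_j (R : Rebase P S X Y j x) {b : Fin k} (hb : X.At S b) (hbb : X.hm b = X.base) :
    b ≠ j := by
  rintro rfl
  exact R.ne ((R.old_j hb).1.symm.trans hbb)

theorem hm_of (R : Rebase P S X Y j x) {i : Fin k} (hi : X.At S i) : Y.hm i = X.hm i := by
  by_cases h : i = j
  · subst h
    rw [R.hm_j, (R.old_j hi).1]
  · exact R.hm i h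

theorem live_iff (R : Rebase P S X Y j x) {u : Fin n} (hu : u ≠ x) :
    Y.Live S u ↔ X.Live S u := by
  constructor
  · rintro ⟨i, hi, rfl⟩
    have hij : i ≠ j := by
      rintro rfl
      exact hu R.hm_j
    exact ⟨i, (R.at_iff hij).1 hi, (R.hm i hij).symm⟩
  · rintro ⟨i, hi, rfl⟩
    exact ⟨i, R.at_of hi, R.hm_of hi⟩

/-- The new base `x` is nobody's kid, and the old base now points to `x`, hence not to `v`. -/
theorem kids_of_ne (R : Rebase P S X Y j x) (r : Rec) {v : Fin n} (hv : v ≠ x) :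
    Y.kids P r v = (X.kids P r v).erase x := by
  ext u
  simp only [Abs.kids, R.base, R.W, R.par, Finset.mem_filter, Finset.mem_insert, Finset.mem_erase]
  by_cases hu : u = X.base
  · subst hu
    simp only [Function.update_self, ne_eq, not_true_eq_false, false_and, and_false, iff_false]
    tauto
  · rw [Function.update_of_ne hu]
    tauto

theorem kids_self (R : Rebase P S X Y j x) (h : Good P S X) (r : Rec) :
    Y.kids P r x = X.kids P r x ∪ if Scanned P r x X.base then {X.base} else ∅ := by
  ext u
  simp only [Abs.kids, R.base, R.W, R.par, Finset.mem_filter, Finset.mem_insert, Finset.mem_union]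
  by_cases hu : u = X.base
  · subst hu
    have := R.ne.symm
    have := h.base_mem
    split_ifs with hs <;> simp [*]
  · rw [Function.update_of_ne hu]
    have h1 : (u ∈ if Scanned P r x X.base then ({X.base} : Finset (Fin n)) else ∅) ↔ False := by
      split_ifs <;> simp [hu]
    have h2 : u ∈ X.W → X.par u = x → u ≠ x := by
      rintro h3 h4 rfl
      have := h.adj u h3 hu
      rw [h4] at this
      exact this.ne rfl
    rw [h1]
    tauto

/-- A living robot at `x` can only be `j`, which points to the old base; so no home other than the
old base loses a live kid. -/
theorem notMem_kids (R : Rebase P S X Y j x) {r : Rec} {v : Fin n} (hv : v ≠ X.base) :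
    x ∉ X.liveKids P S r v := by
  intro h
  simp only [Abs.liveKids, Abs.kids, Finset.mem_filter] at h
  obtain ⟨⟨-, -, h1, -⟩, i, hi, h2⟩ := h
  have hij : i = j := by
    by_contra hij
    exact R.away i hi hij h2
  subst hij
  rw [(R.old_j hi).2] at h1
  exact hv h1.symm

theorem liveKids_of_ne (R : Rebase P S X Y j x) (r : Rec) {v : Fin n} (hv : v ≠ x) :
    Y.liveKids P S r v = (X.liveKids P S r v).erase x := by
  ext u
  simp only [Abs.liveKids, R.kids_of_ne r hv, Finset.mem_filter, Finset.mem_erase, and_assoc]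
  refine and_congr_right fun h1 => and_congr_right fun _ => ?_
  exact R.live_iff h1

/-- A fresh scan has not covered any port yet, and an interrupted one stands at the arrow, that is,
at the port to the old base, which is still to be probed again. This is why `Rec.arrive` raises
`count` only if `port = 0`. -/
theorem not_scanned (R : Rebase P S X Y j x) (h : Good P S X) (hj : (Y.rc j).port ≠ 0) :
    ¬ Scanned P (Y.rc j) x X.base := by
  rintro (h1 | ⟨q, hq, h1, h2 | ⟨-, h2⟩⟩)
  · exact hj h1
  · obtain h3 | ⟨h3, h4⟩ := R.port_j
    · rw [Finset.mem_Icc] at hq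
      omega
    · obtain ⟨rfl, h6⟩ := R.old_j h3
      have h7 := h.target_arrow j h3 R.ne
      have h8 := P.target_inj hq (h.arrow_mem j h3 R.ne) (h1.trans (h7.trans h6).symm)
      have h9 := h.port_eq j h3 R.ne (h4 ▸ hj)
      omega
  · rw [R.probing_j] at h2
    exact absurd h2 (by decide)

theorem card_kids_self (R : Rebase P S X Y j x) (h : Good P S X) :
    (Y.kids P (Y.rc j) x).card ≤ (X.kids P (Y.rc j) x).card +
      if (Y.rc j).port = 0 then 1 else 0 := by
  rw [R.kids_self h]
  refine (Finset.card_union_le _ _).trans ?_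
  gcongr
  split_ifs with h1 h2 h2
  · simp
  · exact absurd h1 (R.not_scanned h h2)
  · simp
  · simp

/-- This serves both for walking to a visitor and for settling at a probed node. Only the counts at
the old base and at `x` need attention: every other kid set can only lose `x`. -/
theorem good (R : Rebase P S X Y j x) (h : Good P S X)
    (hb : ∀ b, X.At S b → X.hm b = X.base →
      ((X.kids P (X.rc b) X.base).erase x).card ≤ (Y.rc b).count)
    (hj : (X.kids P (Y.rc j) x).card + (if (Y.rc j).port = 0 then 1 else 0) ≤ (Y.rc j).count)
    (hcard : Y.W.card + (S.filter fun i => (Y.rc i).settled = false).card ≤ k)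
    (hcalm : Calm S X → Calm S Y) : Good P S Y := by
  have hsub : ∀ {u}, u ∈ X.W → u ∈ Y.W := fun hu => by
    rw [R.W]; exact Finset.mem_insert_of_mem hu
  have hpar : ∀ {u}, u ≠ X.base → Y.par u = X.par u := fun hu => by
    rw [R.par, Function.update_of_ne hu]
  have hparb : Y.par X.base = x := by rw [R.par, Function.update_self]
  -- all robots are the new base robot, the old base robot, or unchanged
  have hcases : ∀ i, Y.At S i → i = j ∨ (i ≠ j ∧ X.At S i ∧ Y.hm i = X.hm i ∧ X.hm i ≠ x ∧
      (X.hm i = X.base ∨ X.hm i ≠ X.base ∧ Y.rc i = X.rc i)) := by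
    intro i hi
    by_cases hij : i = j
    · exact Or.inl hij
    · have hi' := (R.at_iff hij).1 hi
      refine Or.inr ⟨hij, hi', R.hm i hij, R.away i hi' hij, ?_⟩
      by_cases hib : X.hm i = X.base
      · exact Or.inl hib
      · exact Or.inr ⟨hib, R.off i hi' hij hib⟩
  have hmj : Y.hm j = Y.base := by rw [R.hm_j, R.base]
  refine ⟨?_, ?_, ?_, ?_, ?_, ?_, ?_, ?_, ?_, ?_, ?_, ?_, ?_, ?_, ?_, hcard, ?_, ?_⟩
  · rw [R.base, R.W]; exact Finset.mem_insert_self _ _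
  · intro i hi
    obtain rfl | ⟨-, h1, h2, -, -⟩ := hcases i hi
    · rw [R.hm_j, R.W]; exact Finset.mem_insert_self _ _
    · rw [h2]; exact hsub (h.hm_mem i h1)
  · intro i i' hi hi' he
    obtain rfl | ⟨-, h1, h2, h3, -⟩ := hcases i hi <;>
      obtain rfl | ⟨-, h1', h2', h3', -⟩ := hcases i' hi'
    · rfl
    · rw [R.hm_j, h2'] at he; exact absurd he.symm h3'
    · rw [R.hm_j, h2] at he; exact absurd he h3
    · rw [h2, h2'] at he; exact h.hm_inj i i' h1 h1' he
  · intro i hi he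
    obtain rfl | ⟨-, h1, h2, h3, -⟩ := hcases i hi
    · exact ⟨R.arrow_j, by rw [R.stamp_j, R.ep]⟩
    · rw [h2, R.base] at he; exact absurd he h3
  · intro i hi he
    obtain rfl | ⟨-, h1, h2, h3, h4 | ⟨h4, h5⟩⟩ := hcases i hi
    · exact absurd hmj he
    · rw [h2, h4]; exact R.arrow_mem i h1 h4
    · rw [h2, h5]; exact h.arrow_mem i h1 h4
  · intro i hi he
    obtain rfl | ⟨-, h1, h2, h3, h4 | ⟨h4, h5⟩⟩ := hcases i hi
    · exact absurd hmj he
    · rw [h2, h4, hparb]; exact R.target i h1 h4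
    · rw [h2, h5, hpar h4]; exact h.target_arrow i h1 h4
  · intro i hi he
    obtain rfl | ⟨-, h1, h2, h3, h4 | ⟨h4, h5⟩⟩ := hcases i hi
    · exact absurd hmj he
    · exact R.probing_b i h1 h4
    · rw [h5]; exact h.not_probing i h1 h4
  · intro i hi he
    obtain rfl | ⟨-, h1, h2, h3, h4 | ⟨h4, h5⟩⟩ := hcases i hi
    · exact absurd hmj he
    · exact R.port_eq i h1 h4
    · rw [h5]; exact h.port_eq i h1 h4
  · intro u hu he
    rw [R.W, Finset.mem_insert] at hu
    rw [R.base] at he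
    by_cases hub : u = X.base
    · rw [hub, hparb]; exact R.adj
    · rw [hpar hub]; exact h.adj u (hu.resolve_left he) hub
  · have h1 : Relation.ReflTransGen (fun a b => a ∈ Y.W ∧ Y.par a = b) X.base x :=
      Relation.ReflTransGen.single ⟨hsub h.base_mem, hparb⟩
    intro w hw
    rw [R.W, Finset.mem_insert] at hw
    rw [R.base]
    obtain rfl | hw := hw
    · exact Relation.ReflTransGen.refl
    -- An old chain is followed until it meets the old base, and from there the new pointer leads to
    -- `x`.
    · refine Relation.ReflTransGen.head_induction_on (h.chain w hw) h1 ?_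
      rintro a b ⟨ha, hab⟩ - ih
      by_cases hab' : a = X.base
      · rw [hab']; exact h1
      · exact Relation.ReflTransGen.head ⟨hsub ha, (hpar hab').trans hab⟩ ih
  · intro i hi
    obtain rfl | ⟨hij, h1, h2, h3, h4 | ⟨h4, h5⟩⟩ := hcases i hi
    · rw [R.hm_j]; exact (R.card_kids_self h).trans hj
    · rw [h2, h4, R.kids_of_ne _ R.ne.symm, kids_congr P X X.base (R.port_b i h1 h4)
        ((R.probing_b i h1 h4).trans (R.probing_old i h1 h4).symm)]
      exact hb i h1 h4
    · rw [h2, h5, R.kids_of_ne _ h3]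
      exact (Finset.card_le_card (Finset.erase_subset _ _)).trans (h.kids_le i h1)
  · intro i hi he
    obtain rfl | ⟨hij, h1, h2, h3, h4 | ⟨h4, h5⟩⟩ := hcases i hi
    · refine ⟨R.probing_j, ?_⟩
      obtain h6 | ⟨h6, h7⟩ := R.port_j
      · omega
      · obtain ⟨-, h8⟩ := h.done i h6 (h7 ▸ he)
        rw [R.hm_j, ← (R.old_j h6).1]
        exact fun u hu => hsub (h8 u hu)
    · refine ⟨R.probing_b i h1 h4, fun u hu => hsub ?_⟩
      rw [R.port_b i h1 h4] at he
      exact (h.done i h1 he).2 u (h2 ▸ hu)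
    · rw [h5] at he ⊢
      exact ⟨(h.done i h1 he).1, fun u hu => hsub ((h.done i h1 he).2 u (h2 ▸ hu))⟩
  · intro i hi
    obtain rfl | ⟨hij, h1, h2, h3, h4 | ⟨h4, h5⟩⟩ := hcases i hi
    · rw [R.hm_j]
      obtain h6 | ⟨h6, h7⟩ := R.port_j
      · rw [h6]
        exact (G.degree_pos_iff_exists_adj x).2 ⟨_, R.adj.symm⟩
      · rw [h7, ← (R.old_j h6).1]; exact h.port_le i h6
    · rw [h2, R.port_b i h1 h4]; exact h.port_le i h1
    · rw [h2, h5]; exact h.port_le i h1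
  · intro i hi q hq hq'
    obtain rfl | ⟨hij, h1, h2, h3, h4 | ⟨h4, h5⟩⟩ := hcases i hi
    · obtain h6 | ⟨h6, h7⟩ := R.port_j
      · omega
      · rw [h7] at hq'
        rw [R.hm_j, ← (R.old_j h6).1]
        exact hsub (h.scan i h6 q hq hq')
    · rw [R.port_b i h1 h4] at hq'
      rw [h2]; exact hsub (h.scan i h1 q hq hq')
    · rw [h5] at hq'
      rw [h2]; exact hsub (h.scan i h1 q hq hq')
  · intro i hi he
    obtain rfl | ⟨hij, h1, h2, h3, h4 | ⟨h4, h5⟩⟩ := hcases i hi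
    · rw [R.probing_j] at he; exact absurd he (by decide)
    · rw [R.probing_b i h1 h4] at he; exact absurd he (by decide)
    · rw [h5] at he ⊢
      rw [h2]; exact hsub (h.probed i h1 he)
  · intro i hi
    rw [R.ep]
    obtain rfl | ⟨hij, h1, h2, h3, h4 | ⟨h4, h5⟩⟩ := hcases i hi
    · rw [R.stamp_j]
    · rw [R.stamp_b i h1 h4]
    · rw [h5]; exact h.stamp_le i h1
  · intro hh
    exact hcalm (h.calm (R.hurt ▸ hh))

theorem open_iff (R : Rebase P S X Y j x) {i : Fin k} (hi : X.At S i) (hij : i ≠ j)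
    (hib : X.hm i ≠ X.base) : Y.Open i ↔ X.Open i := by
  have h1 := R.away i hi hij
  rw [Abs.Open, Abs.Open, R.off i hi hij hib, R.hm i hij, R.base, R.ep]
  tauto

/-- The old base is pushed onto the stack: it becomes open and points to the new base. By `hx` the
node `x` is not on the stack, so the pointers within the stack survive. -/
theorem calm_forward (R : Rebase P S X Y j x) (h : Good P S X)
    (hb : ∀ b, X.At S b → X.hm b = X.base → (Y.rc b).flag = true)
    (hx : ∀ i, X.At S i → X.Open i → X.hm i ≠ x) (hc : Calm S X) : Calm S Y := by
  have hpar : ∀ {u}, u ≠ X.base → Y.par u = X.par u := fun hu => by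
    rw [R.par, Function.update_of_ne hu]
  have hparb : Y.par X.base = x := by rw [R.par, Function.update_self]
  obtain ⟨b, hb1, hb2⟩ := hc.base_live
  have hbj := R.ne_j hb1 hb2
  have hbo : Y.Open b :=
    ⟨by rw [R.hm b hbj, R.base, hb2]; exact R.ne.symm, by rw [R.stamp_b b hb1 hb2, R.ep],
      hb b hb1 hb2⟩
  have hnj : ¬ Y.Open j := fun h => h.1 (by rw [R.hm_j, R.base])
  -- an open robot is the old base robot or has been open
  have hopen : ∀ i, Y.At S i → Y.Open i → i = b ∨ (i ≠ j ∧ X.At S i ∧ X.Open i) := by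
    intro i hi ho
    have hij : i ≠ j := by rintro rfl; exact hnj ho
    have hi' := (R.at_iff hij).1 hi
    by_cases hib : X.hm i = X.base
    · exact Or.inl (h.hm_inj i b hi' hb1 (hib.trans hb2.symm))
    · exact Or.inr ⟨hij, hi', (R.open_iff hi' hij hib).1 ho⟩
  have hparx : ∀ i, X.At S i → X.Open i → X.par (X.hm i) ≠ x := by
    intro i hi ho he
    obtain h1 | ⟨i', h1, h2, h3⟩ := hc.opened i hi ho
    · exact R.ne (he.symm.trans h1)
    · exact hx i' h1 h2 (h3.trans he)
  refine ⟨⟨j, R.at_j, by rw [R.hm_j, R.base]⟩, ?_, ?_, ?_⟩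
  · intro i hi h1 h2 h3
    have hij : i ≠ j := by rintro rfl; exact h1 (by rw [R.hm_j, R.base])
    have hi' := (R.at_iff hij).1 hi
    have hib : X.hm i ≠ X.base := by
      intro hib
      rw [hb i hi' hib] at h3
      exact absurd h3 (by decide)
    rw [R.off i hi' hij hib] at h2 h3 ⊢
    rw [R.ep] at h2 ⊢
    rw [R.hm i hij, R.base] at *
    obtain ⟨h4, h5⟩ := hc.closed i hi' hib h2 h3
    refine ⟨h4, fun u hu h6 h7 => ?_⟩
    rw [R.W, Finset.mem_insert] at hu
    by_cases hub : u = X.base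
    · rw [hub, hparb] at h7; exact absurd h7.symm h1
    · rw [hpar hub] at h7
      obtain ⟨i', h8, rfl, h9⟩ := h5 u (hu.resolve_left h6) hub h7
      have hij' : i' ≠ j := by
        rintro rfl
        exact h6 (R.old_j h8).1
      exact ⟨i', R.at_of h8, R.hm i' hij', by rw [R.off i' h8 hij' hub]; exact h9⟩
  · intro i hi ho
    obtain rfl | ⟨hij, hi', ho'⟩ := hopen i hi ho
    · rw [R.hm i hbj, hb2, hparb, R.base]; exact Or.inl rfl
    · rw [R.hm i hij, hpar ho'.1]
      right
      obtain h1 | ⟨i', h1, h2, h3⟩ := hc.opened i hi' ho'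
      · exact ⟨b, R.at_of hb1, hbo, by rw [R.hm b hbj, hb2, h1]⟩
      · have hij' : i' ≠ j := by
          rintro rfl
          exact hx i' h1 h2 (R.old_j h1).1
        exact ⟨i', R.at_of h1, (R.open_iff h1 hij' h2.1).2 h2, by rw [R.hm i' hij', h3]⟩
  · intro i i' hi hi' ho ho' he
    obtain rfl | ⟨hij, h1, h2⟩ := hopen i hi ho <;>
      obtain rfl | ⟨hij', h1', h2'⟩ := hopen i' hi' ho'
    · rfl
    · rw [R.hm i hbj, hb2, hparb, R.hm i' hij', hpar h2'.1] at he
      exact absurd he.symm (hparx i' h1' h2')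
    · rw [R.hm i' hbj, hb2, hparb, R.hm i hij, hpar h2.1] at he
      exact absurd he (hparx i h1 h2)
    · rw [R.hm i hij, R.hm i' hij', hpar h2.1, hpar h2'.1] at he
      exact hc.opened_inj i i' h1 h1' h2 h2' he

/-- The robot `j` is popped from the stack and the old base is closed. Closing it requires that all
its children are manned and visited, which is `hk`. -/
theorem calm_back (R : Rebase P S X Y j x)
    (hj : X.At S j) (hjo : X.Open j)
    (hb : ∀ b, X.At S b → X.hm b = X.base → (Y.rc b).flag = false ∧ (X.rc b).port = 0)
    (hk : ∀ u ∈ X.W, u ≠ X.base → X.par u = X.base →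
      ∃ i, X.At S i ∧ X.hm i = u ∧ (X.rc i).stamp = X.ep) (hc : Calm S X) : Calm S Y := by
  have hpar : ∀ {u}, u ≠ X.base → Y.par u = X.par u := fun hu => by
    rw [R.par, Function.update_of_ne hu]
  have hparb : Y.par X.base = x := by rw [R.par, Function.update_self]
  have hnj : ¬ Y.Open j := fun h => h.1 (by rw [R.hm_j, R.base])
  have hopen : ∀ i, Y.At S i → Y.Open i → i ≠ j ∧ X.At S i ∧ X.Open i := by
    intro i hi ho
    have hij : i ≠ j := by rintro rfl; exact hnj ho
    have hi' := (R.at_iff hij).1 hi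
    refine ⟨hij, hi', (R.open_iff hi' hij ?_).1 ho⟩
    intro hib
    have h1 := ho.2.2
    rw [(hb i hi' hib).1] at h1
    exact absurd h1 (by decide)
  obtain ⟨hjx, hjb⟩ := R.old_j hj
  refine ⟨⟨j, R.at_j, by rw [R.hm_j, R.base]⟩, ?_, ?_, ?_⟩
  · intro i hi h1 h2 h3
    have hij : i ≠ j := by rintro rfl; exact h1 (by rw [R.hm_j, R.base])
    have hi' := (R.at_iff hij).1 hi
    rw [R.hm i hij, R.base] at *
    have key : (X.rc i).port = 0 ∧ ∀ u ∈ X.W, u ≠ X.base → X.par u = X.hm i →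
        ∃ j, X.At S j ∧ X.hm j = u ∧ (X.rc j).stamp = X.ep := by
      by_cases hib : X.hm i = X.base
      · rw [hib]
        exact ⟨(hb i hi' hib).2, hk⟩
      · rw [R.off i hi' hij hib] at h2 h3
        rw [R.ep] at h2
        exact hc.closed i hi' hib h2 h3
    refine ⟨?_, fun u hu h6 h7 => ?_⟩
    · by_cases hib : X.hm i = X.base
      · rw [R.port_b i hi' hib]; exact key.1
      · rw [R.off i hi' hij hib]; exact key.1
    · rw [R.W, Finset.mem_insert] at hu
      by_cases hub : u = X.base
      · rw [hub, hparb] at h7; exact absurd h7.symm h1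
      · rw [hpar hub] at h7
        obtain ⟨i', h8, rfl, h9⟩ := key.2 u (hu.resolve_left h6) hub h7
        have hij' : i' ≠ j := by
          rintro rfl
          exact h6 hjx
        exact ⟨i', R.at_of h8, R.hm i' hij', by rw [R.off i' h8 hij' hub, R.ep]; exact h9⟩
  · intro i hi ho
    obtain ⟨hij, hi', ho'⟩ := hopen i hi ho
    rw [R.hm i hij, hpar ho'.1, R.base]
    obtain h1 | ⟨i', h1, h2, h3⟩ := hc.opened i hi' ho'
    -- Only the top of the stack points to the old base, and that is `j`.
    · refine absurd (hc.opened_inj i j hi' hj ho' hjo ?_) hij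
      rw [h1, hjx, hjb]
    · by_cases hij' : i' = j
      · subst hij'
        left
        rw [← h3, hjx]
      · exact Or.inr ⟨i', R.at_of h1, (R.open_iff h1 hij' h2.1).2 h2, by rw [R.hm i' hij', h3]⟩
  · intro i i' hi hi' ho ho' he
    obtain ⟨hij, h1, h2⟩ := hopen i hi ho
    obtain ⟨hij', h1', h2'⟩ := hopen i' hi' ho'
    rw [R.hm i hij, R.hm i' hij', hpar h2.1, hpar h2'.1] at he
    exact hc.opened_inj i i' h1 h1' h2 h2' he

/-- The weight changes only for the old base robot, if it is alive, and for `j`: `c` bounds the rise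
of the former and `d` the fall of the latter. -/
theorem pot_add_le (R : Rebase P S X Y j x) (h : Good P S X) {c d e : ℕ}
    (hb : ∀ b, X.At S b → X.hm b = X.base → weight P S Y b ≤ weight P S X b + c)
    (hj : weight P S Y j + d ≤ weight P S X j) (he : c + e ≤ d) :
    pot P S Y + e ≤ pot P S X := by
  have h1 : ∀ i ∈ S, weight P S Y i + (if i = j then d else 0) ≤
      weight P S X i + if (X.rc i).settled = true ∧ X.hm i = X.base then c else 0 := by
    intro i hi
    by_cases hij : i = j
    · subst hij
      rw [if_pos rfl]
      omega
    rw [if_neg hij, add_zero]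
    by_cases hs : (X.rc i).settled = true
    swap
    · simp [weight, R.settled i hij, hs]
    by_cases hib : X.hm i = X.base
    · rw [if_pos ⟨hs, hib⟩]
      exact hb i ⟨hi, hs⟩ hib
    · have h2 := R.away i ⟨hi, hs⟩ hij
      have h3 := R.off i ⟨hi, hs⟩ hij hib
      have h4 : Y.liveKids P S (X.rc i) (X.hm i) = X.liveKids P S (X.rc i) (X.hm i) := by
        rw [R.liveKids_of_ne _ h2, Finset.erase_eq_of_notMem (R.notMem_kids hib)]
      simp only [weight, h3, R.hm i hij, h4, R.ep, R.base]
      simp [h2, hib]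
  have h2 := Finset.sum_le_sum h1
  rw [Finset.sum_add_distrib, Finset.sum_add_distrib, Finset.sum_ite_eq', if_pos R.mem] at h2
  have h3 := sum_ite_le S (fun i => (X.rc i).settled = true ∧ X.hm i = X.base) c (by
    intro i hi i' hi' h1 h2
    exact h.hm_inj i i' ⟨hi, h1.1⟩ ⟨hi', h2.1⟩ (h1.2.trans h2.2.symm))
  simp only [pot, R.hurt]
  omega

end Rebase

end Rebase

/-! ### Scanning the ports of the base -/

section Moves

open Classical

variable {n k : ℕ} {G : SimpleGraph (Fin n)} [DecidableRel G.Adj] {P : PortLabelling G}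
  {S : Finset (Fin k)} {X : Abs n k}

/-- The settled robots whose arrows lead to the base. -/
noncomputable def Abs.visitors (X : Abs n k) (S : Finset (Fin k)) : Finset (Fin k) :=
  S.filter fun i => (X.rc i).settled = true ∧ X.hm i ≠ X.base ∧ X.par (X.hm i) = X.base

theorem mem_visitors {i : Fin k} :
    i ∈ X.visitors S ↔ X.At S i ∧ X.hm i ≠ X.base ∧ X.par (X.hm i) = X.base := by
  rw [Abs.visitors, Finset.mem_filter, Abs.At, and_assoc]

/-- When the scan is complete, every child counts as scanned, and distinct robots have distinct
homes. -/
theorem Good.card_visitors (h : Good P S X) {r : Rec} (hr : r.port = 0) :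
    (X.visitors S).card = (X.liveKids P S r X.base).card := by
  have : X.liveKids P S r X.base = (X.visitors S).image X.hm := by
    ext u
    simp only [Abs.liveKids, Abs.kids, Finset.mem_filter, Finset.mem_image, mem_visitors, Scanned,
      hr, true_or, and_true, Abs.Live]
    constructor
    · rintro ⟨⟨-, h1, h2⟩, i, h3, rfl⟩
      exact ⟨i, ⟨h3, h1, h2⟩, rfl⟩
    · rintro ⟨i, ⟨h3, h1, h2⟩, rfl⟩
      exact ⟨⟨h.hm_mem i h3, h1, h2⟩, i, h3, rfl⟩
  rw [this, Finset.card_image_of_injOn]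
  intro i hi j hj
  exact h.hm_inj i j (mem_visitors.1 hi).1 (mem_visitors.1 hj).1

/-- Ports lead to different nodes, none of which is the node itself. -/
theorem PortLabelling.lt_card (P : PortLabelling G) {W : Finset (Fin n)} {v : Fin n} (hv : v ∈ W)
    {p : ℕ} (hp : p ≤ G.degree v) (hW : ∀ q, 1 ≤ q → q ≤ p → P.target v q ∈ W) : p < W.card := by
  have h1 : ((Finset.Icc 1 p).image (P.target v)).card = p := by
    rw [Finset.card_image_of_injOn, Nat.card_Icc, Nat.add_sub_cancel]
    intro a ha b hb hab
    simp only [Finset.coe_Icc, Set.mem_Icc] at ha hb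
    exact P.target_inj (Finset.mem_Icc.2 ⟨ha.1, by omega⟩) (Finset.mem_Icc.2 ⟨hb.1, by omega⟩) hab
  have h2 : (Finset.Icc 1 p).image (P.target v) ⊆ W.erase v := by
    intro u hu
    obtain ⟨q, hq, rfl⟩ := Finset.mem_image.1 hu
    rw [Finset.mem_Icc] at hq
    refine Finset.mem_erase.2 ⟨?_, hW q hq.1 hq.2⟩
    exact (P.adj_target (Finset.mem_Icc.2 ⟨hq.1, by omega⟩)).ne.symm
  have h3 := Finset.card_le_card h2
  have h4 := Finset.card_erase_add_one hv
  omega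

/-- The weight of a robot at the base. -/
theorem weight_base {b : Fin k} (hs : (X.rc b).settled = true) (hbb : X.hm b = X.base)
    (he : (X.rc b).stamp = X.ep) : weight P S X b = (k - 2) + scanCost k (X.rc b) +
      (k - 2) * ((X.rc b).count - (X.liveKids P S (X.rc b) X.base).card) := by
  simp [weight, hs, hbb, he]

/-- Changing the record at the base does not change the structure of the search. -/
theorem liveKids_setBase {b : Fin k} (hb : X.At S b) {r : Rec} (hs : r.settled = true) (r' : Rec)
    (v : Fin n) :
    Abs.liveKids P { X with rc := Function.update X.rc b r } S r' v = X.liveKids P S r' v := by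
  ext u
  simp only [Abs.liveKids, Abs.kids, Finset.mem_filter, Abs.Live, Abs.At]
  refine and_congr_right fun _ => exists_congr fun j => ?_
  by_cases hj : j = b
  · subst hj; simp [hs, hb.2]
  · simp [hj]

theorem weight_setBase {b : Fin k} (hb : X.At S b) (hbb : X.hm b = X.base) {r : Rec}
    (hs : r.settled = true) (he : r.stamp = X.ep) :
    weight P S { X with rc := Function.update X.rc b r } b = (k - 2) + scanCost k r +
      (k - 2) * (r.count - (X.liveKids P S r X.base).card) := by
  refine (weight_base (X := { X with rc := Function.update X.rc b r }) (by simpa using hs) hbb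
    (by simpa using he)).trans ?_
  rw [liveKids_setBase hb hs]
  simp

/-- The base robot turns to its next port. -/
theorem Good.advance (h : Good P S X) {b : Fin k} (hb : X.At S b) (hbb : X.hm b = X.base)
    (h0 : (X.rc b).next ≠ 0) (hd : (X.rc b).next ≤ G.degree X.base) {r : Rec}
    (hr : r = { X.rc b with port := (X.rc b).next, probing := false, flag := true }) :
    Good P S { X with rc := Function.update X.rc b r } ∧
      pot P S { X with rc := Function.update X.rc b r } ≤ pot P S X := by
  have hab := h.at_base b hb hbb
  have hport : (X.rc b).probing = true → (X.rc b).port ≠ 0 := by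
    intro h1 h2
    rw [(h.done b hb h2).1] at h1
    exact absurd h1 Bool.false_ne_true
  -- Replacing a probed port by the next, unprobed one leaves the set of scanned neighbours as it
  -- is; the scan cost does not change for the same reason.
  have hsc : ∀ u, Scanned P r X.base u ↔ Scanned P (X.rc b) X.base u := by
    intro u
    have h2 := h.port_le b hb
    subst hr
    cases hp : (X.rc b).probing <;> simp only [Scanned, Rec.next, hp] at h0 hport ⊢
    · simp
    · have h1 : (X.rc b).port ≠ 0 := hport trivial
      simp only [if_true, h1, false_or, Nat.succ_ne_zero, and_true]
      refine exists_congr fun q => and_congr_right fun _ => and_congr_right fun _ => ?_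
      simp
      omega
  have hk : X.kids P r X.base = X.kids P (X.rc b) X.base := by
    ext u
    simp only [Abs.kids, hsc]
  have hs : r.settled = true := by rw [hr]; exact hb.2
  have he : r.stamp = X.ep := by rw [hr]; exact hab.2
  constructor
  · refine h.setBase hb hbb hs (by rw [hr]; exact hab.1) he ?_ ?_ (by rw [hr]; exact hd) ?_ ?_
    · rw [hk, hr]
      have := h.kids_le b hb
      rw [hbb] at this
      exact this
    · intro h1; rw [hr] at h1; exact absurd h1 h0
    · intro q hq hq'
      rw [hr] at hq'
      have h1 := h.scan b hb q hq
      have h2 := h.probed b hb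
      rw [hbb] at h1 h2
      simp only [Rec.next] at hq'
      split_ifs at hq' with h3
      · rcases Nat.lt_succ_iff_lt_or_eq.1 hq' with h4 | h4
        · exact h1 h4
        · exact h4 ▸ h2 h3
      · exact h1 hq'
    · intro h1; rw [hr] at h1; exact absurd h1 Bool.false_ne_true
  · refine pot_setBase (d := 0) hb hs ?_
    rw [weight_setBase hb hbb hs he, weight_base hb.2 hbb hab.2, Abs.liveKids, hk, ← Abs.liveKids]
    have h1 : scanCost k r ≤ scanCost k (X.rc b) := by
      rw [hr]
      simp only [scanCost, Rec.next] at h0 ⊢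
      split_ifs at * <;> simp_all
      omega
    have h2 : r.count = (X.rc b).count := by rw [hr]
    rw [h2]
    omega

/-- The base robot has probed all its ports. -/
theorem Good.complete (h : Good P S X) {b : Fin k} (hb : X.At S b) (hbb : X.hm b = X.base)
    (h0 : ¬ ((X.rc b).next ≠ 0 ∧ (X.rc b).next ≤ G.degree X.base)) {r : Rec}
    (hr : r = { X.rc b with port := 0, probing := false }) :
    Good P S { X with rc := Function.update X.rc b r } ∧
      pot P S { X with rc := Function.update X.rc b r } ≤ pot P S X := by
  have hab := h.at_base b hb hbb
  have h1 := h.port_le b hb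
  rw [hbb] at h1
  have hall : ∀ q ∈ Finset.Icc 1 (G.degree X.base),
      (X.rc b).port = 0 ∨ q < (X.rc b).port ∨ q = (X.rc b).port ∧ (X.rc b).probing = true := by
    intro q hq
    rw [Finset.mem_Icc] at hq
    simp only [Rec.next] at h0
    split_ifs at h0 with h2
    · simp only [h2, and_true]; omega
    · omega
  -- All ports have been probed, so `port := 0` adds no new kids.
  have hk : X.kids P r X.base = X.kids P (X.rc b) X.base := by
    ext u
    simp only [Abs.kids, Finset.mem_filter]
    refine and_congr_right fun h2 => and_congr_right fun h3 => and_congr_right fun h4 => ?_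
    refine iff_of_true (Or.inl (by rw [hr])) ?_
    have h5 := h.adj u h2 h3
    rw [h4] at h5
    obtain ⟨q, hq, rfl⟩ := P.exists_port h5.symm
    refine (hall q hq).imp _root_.id fun h6 => ⟨q, hq, rfl, h6⟩
  have hs : r.settled = true := by rw [hr]; exact hb.2
  have he : r.stamp = X.ep := by rw [hr]; exact hab.2
  constructor
  · refine h.setBase hb hbb hs (by rw [hr]; exact hab.1) he ?_ ?_ (by rw [hr]; exact Nat.zero_le _)
      ?_ ?_
    · rw [hk, hr]
      have := h.kids_le b hb
      rw [hbb] at this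
      exact this
    · intro _
      refine ⟨by rw [hr], fun u hu => ?_⟩
      obtain ⟨q, hq, rfl⟩ := P.exists_port hu
      have h2 := h.scan b hb q (Finset.mem_Icc.1 hq).1
      have h3 := h.probed b hb
      have h4 := h.done b hb
      rw [hbb] at h2 h3 h4
      obtain h5 | h5 | ⟨h5, h6⟩ := hall q hq
      · exact (h4 h5).2 _ hu
      · exact h2 h5
      · exact h5 ▸ h3 h6
    · intro q hq hq'
      rw [hr] at hq'
      simp at hq'
    · intro h1; rw [hr] at h1; exact absurd h1 Bool.false_ne_true
  · refine pot_setBase (d := 0) hb hs ?_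
    rw [weight_setBase hb hbb hs he, weight_base hb.2 hbb hab.2, Abs.liveKids, hk, ← Abs.liveKids]
    have h1 : scanCost k r = 0 := by rw [hr]; simp [scanCost]
    have h2 : r.count = (X.rc b).count := by rw [hr]
    rw [h1, h2]
    omega

/-- The base robot misses a visitor and starts to scan its ports again. -/
theorem Good.restart (h : Good P S X) {b : Fin k} (hb : X.At S b) (hbb : X.hm b = X.base)
    (h0 : (X.rc b).port = 0) (hd : 1 ≤ G.degree X.base)
    (hV : (X.visitors S).card < (X.rc b).count) {r : Rec}
    (hr : r = { X.rc b with port := 1, probing := false, count := 0, flag := true }) :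
    Good P S { X with rc := Function.update X.rc b r } ∧
      pot P S { X with rc := Function.update X.rc b r } ≤ pot P S X := by
  have hab := h.at_base b hb hbb
  have hk : X.kids P r X.base = ∅ := by
    refine Finset.filter_eq_empty_iff.2 ?_
    rintro u - ⟨-, -, h1 | ⟨q, hq, -, h1 | ⟨-, h1⟩⟩⟩
    · rw [hr] at h1; exact absurd h1 one_ne_zero
    · rw [hr] at h1
      rw [Finset.mem_Icc] at hq
      simp only at h1
      omega
    · rw [hr] at h1; exact absurd h1 Bool.false_ne_true
  have hs : r.settled = true := by rw [hr]; exact hb.2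
  have he : r.stamp = X.ep := by rw [hr]; exact hab.2
  constructor
  · refine h.setBase hb hbb hs (by rw [hr]; exact hab.1) he ?_ ?_ (by rw [hr]; exact hd) ?_ ?_
    · rw [hk]; exact Nat.zero_le _
    · intro h1; rw [hr] at h1; exact absurd h1 one_ne_zero
    · intro q hq hq'
      rw [hr] at hq'
      simp only at hq'
      omega
    · intro h1; rw [hr] at h1; exact absurd h1 Bool.false_ne_true
  · refine pot_setBase (d := 0) hb hs ?_
    rw [h.card_visitors h0] at hV
    rw [weight_setBase hb hbb hs he, weight_base hb.2 hbb hab.2]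
    have h1 : scanCost k r = k - 2 := by
      rw [hr]
      simp only [scanCost, one_ne_zero, if_false, Bool.toNat_false]; omega
    -- The missing visitor is a unit of excess, worth `k - 2`, which pays for the new scan.
    have h2 : 1 ≤ (X.rc b).count - (X.liveKids P S (X.rc b) X.base).card := by omega
    have h3 := Nat.mul_le_mul_left (k - 2) h2
    have h4 : r.count = 0 := by rw [hr]
    rw [h1, h4]
    simp only [Nat.zero_sub, mul_zero, mul_one] at h3 ⊢
    omega

/-- The probed node turns out to be occupied. -/
theorem Good.occupied (h : Good P S X) {b : Fin k} (hb : X.At S b) (hbb : X.hm b = X.base)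
    (h0 : (X.rc b).port ≠ 0) (hp : (X.rc b).probing = false)
    (hf : ∃ i ∈ S, (X.rc i).settled = false)
    (hl : X.Live S (P.target X.base (X.rc b).port)) {c : ℕ}
    (hc : c = if X.par (P.target X.base (X.rc b).port) = X.base then 1 else 0) {r : Rec}
    (hr : r = { X.rc b with probing := true, count := (X.rc b).count + c }) :
    Good P S { X with rc := Function.update X.rc b r } ∧
      pot P S { X with rc := Function.update X.rc b r } + 1 ≤ pot P S X := by
  have hab := h.at_base b hb hbb
  set x := P.target X.base (X.rc b).port with hx
  have hple := h.port_le b hb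
  rw [hbb] at hple
  have hpm : (X.rc b).port ∈ Finset.Icc 1 (G.degree X.base) := Finset.mem_Icc.2 ⟨by omega, hple⟩
  have hxb : x ≠ X.base := (P.adj_target hpm).ne.symm
  have hxW : x ∈ X.W := by
    obtain ⟨i, hi, h1⟩ := hl
    exact h1 ▸ h.hm_mem i hi
  have hk : X.kids P r X.base = X.kids P (X.rc b) X.base ∪ if X.par x = X.base then {x} else ∅ := by
    ext u
    simp only [Abs.kids, Finset.mem_filter, Finset.mem_union]
    have h1 : Scanned P r X.base u ↔ Scanned P (X.rc b) X.base u ∨ u = x := by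
      rw [hr]
      simp only [Scanned, h0, hp, false_or, and_true, Bool.false_eq_true, and_false, or_false]
      constructor
      · rintro ⟨q, hq, rfl, h2 | rfl⟩
        · exact Or.inl ⟨q, hq, rfl, h2⟩
        · exact Or.inr rfl
      · rintro (⟨q, hq, rfl, h2⟩ | rfl)
        · exact ⟨q, hq, rfl, Or.inl h2⟩
        · exact ⟨_, hpm, rfl, Or.inr rfl⟩
    rw [h1]
    by_cases hu : u = x
    · subst hu
      split_ifs with h2 <;> simp [hxb, hxW, h2]
    · split_ifs with h2 <;> simp [hu]
  have hnk : x ∉ X.kids P (X.rc b) X.base := by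
    intro h1
    simp only [Abs.kids, Finset.mem_filter, Scanned, h0, hp, false_or] at h1
    obtain ⟨-, -, -, q, hq, h2, h3 | ⟨-, h3⟩⟩ := h1
    · have := P.target_inj hq hpm h2
      omega
    · exact absurd h3 (by decide)
  have hs : r.settled = true := by rw [hr]; exact hb.2
  have he : r.stamp = X.ep := by rw [hr]; exact hab.2
  have hscan : ∀ q, 1 ≤ q → q ≤ (X.rc b).port → P.target X.base q ∈ X.W := by
    intro q hq hq'
    rcases Nat.lt_or_eq_of_le hq' with h1 | h1
    · exact hbb ▸ h.scan b hb q hq h1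
    · rw [h1]; exact hxW
  constructor
  · refine h.setBase hb hbb hs (by rw [hr]; exact hab.1) he ?_ ?_ (by rw [hr]; exact hple) ?_ ?_
    · rw [hk]
      refine (Finset.card_union_le _ _).trans ?_
      have h1 := h.kids_le b hb
      rw [hbb] at h1
      rw [hr, hc]
      refine add_le_add h1 ?_
      split_ifs <;> simp
    · intro h1; rw [hr] at h1; exact absurd h1 h0
    · intro q hq hq'
      rw [hr] at hq'
      exact hscan q hq hq'.le
    · intro _; rw [hr]; exact hxW
  · refine pot_setBase (d := 1) hb hs ?_
    -- The ports up to the current one lead to distinct nodes of `W` other than the base, and a free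
    -- robot exists; so the port is at most `k - 2`, and the truncated subtraction in `scanCost`
    -- does drop.
    have h1 := P.lt_card h.base_mem hple hscan
    have h2 : 1 ≤ (S.filter fun i => (X.rc i).settled = false).card := by
      obtain ⟨i, hi, hi'⟩ := hf
      exact Finset.card_pos.2 ⟨i, Finset.mem_filter.2 ⟨hi, hi'⟩⟩
    have h3 := h.card_le
    -- The node found was not a scanned kid before and its robot is alive, so live kids and `count`
    -- both rise by `c` and the excess stays the same.
    have h4 : (X.liveKids P S r X.base).card = (X.liveKids P S (X.rc b) X.base).card + c := by
      have : X.liveKids P S r X.base = X.liveKids P S (X.rc b) X.base ∪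
          if X.par x = X.base then {x} else ∅ := by
        rw [Abs.liveKids, hk, Finset.filter_union, ← Abs.liveKids]
        congr 1
        refine Finset.filter_true_of_mem ?_
        intro u hu
        split_ifs at hu with h5
        · rw [Finset.mem_singleton.1 hu]; exact hl
        · simp at hu
      rw [this, Finset.card_union_of_disjoint, hc]
      · split_ifs <;> simp
      · have h6 : x ∉ X.liveKids P S (X.rc b) X.base := fun h7 => hnk (Finset.mem_filter.1 h7).1
        split_ifs <;> simp [h6]
    rw [weight_setBase hb hbb hs he, weight_base hb.2 hbb hab.2, h4]
    have h5 : scanCost k r + 1 ≤ scanCost k (X.rc b) := by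
      rw [hr]
      simp only [scanCost, h0, hp, if_false, Bool.toNat_true, Bool.toNat_false]
      omega
    have h6 : r.count = (X.rc b).count + c := by rw [hr]
    rw [h6, Nat.add_sub_add_right]
    omega

end Moves

/-! ### Walking, new epochs and settling -/

section Moves

open Classical

variable {n k : ℕ} {G : SimpleGraph (Fin n)} [DecidableRel G.Adj] {P : PortLabelling G}
  {S : Finset (Fin k)} {X : Abs n k}

theorem Rebase.live_of {Y : Abs n k} {j : Fin k} {x : Fin n} (R : Rebase P S X Y j x) {u : Fin n}
    (hu : X.Live S u) : Y.Live S u := by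
  obtain ⟨i, hi, rfl⟩ := hu
  exact ⟨i, R.at_of hi, R.hm_of hi⟩

/-- If the scan at `x` is complete, the old base is a new live kid, which offsets the increment of
`count` in `Rec.arrive`. -/
theorem Rebase.card_liveKids_self {Y : Abs n k} {j : Fin k} {x : Fin n} (R : Rebase P S X Y j x)
    (h : Good P S X) (hl : X.Live S X.base) (r : Rec) :
    (X.liveKids P S r x).card + (if r.port = 0 then 1 else 0) ≤ (Y.liveKids P S r x).card := by
  have hsub : X.liveKids P S r x ⊆ Y.liveKids P S r x := by
    intro u hu
    simp only [Abs.liveKids, R.kids_self h, Finset.mem_filter, Finset.mem_union] at hu ⊢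
    exact ⟨Or.inl hu.1, R.live_of hu.2⟩
  split_ifs with h0
  · have h1 : X.base ∉ X.liveKids P S r x := by simp [Abs.liveKids, Abs.kids]
    rw [← Finset.card_insert_of_notMem h1]
    refine Finset.card_le_card (Finset.insert_subset ?_ hsub)
    simp only [Abs.liveKids, R.kids_self h, Finset.mem_filter, Finset.mem_union]
    refine ⟨Or.inr ?_, R.live_of hl⟩
    rw [if_pos (show Scanned P r x X.base from Or.inl h0)]
    exact Finset.mem_singleton_self _
  · exact Finset.card_le_card hsub

/-- If as many visitors come as have been counted, then all children of the base are alive. -/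
theorem Good.live_of_card (h : Good P S X) {b : Fin k} (hb : X.At S b) (hbb : X.hm b = X.base)
    (h0 : (X.rc b).port = 0) (hV : (X.rc b).count ≤ (X.visitors S).card) {u : Fin n} (hu : u ∈ X.W)
    (hub : u ≠ X.base) (hup : X.par u = X.base) : ∃ i ∈ X.visitors S, X.hm i = u := by
  have h1 := h.kids_le b hb
  rw [hbb] at h1
  rw [h.card_visitors h0] at hV
  have h2 : X.liveKids P S (X.rc b) X.base = X.kids P (X.rc b) X.base :=
    Finset.eq_of_subset_of_card_le (Finset.filter_subset _ _) (h1.trans hV)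
  have h3 : u ∈ X.kids P (X.rc b) X.base :=
    Finset.mem_filter.2 ⟨hu, hub, hup, Or.inl h0⟩
  rw [← h2] at h3
  obtain ⟨i, hi, rfl⟩ := (Finset.mem_filter.1 h3).2
  exact ⟨i, mem_visitors.2 ⟨hi, hub, hup⟩, rfl⟩

/-- The free robots walk to the home of a visitor. -/
theorem Good.walk (h : Good P S X) {b : Fin k} (hb : X.At S b) (hbb : X.hm b = X.base)
    (h0 : (X.rc b).port = 0) {j : Fin k} (hj : j ∈ X.visitors S) {q : ℕ}
    (hq : q ∈ Finset.Icc 1 (G.degree X.base)) (hqt : P.target X.base q = X.hm j) {fl : Bool}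
    (hfl : fl = true ∧ (X.rc j).stamp ≠ X.ep ∨ fl = false ∧ (X.rc j).stamp = X.ep ∧
      (X.rc j).flag = true ∧ (X.rc b).count ≤ (X.visitors S).card ∧
      ∀ i ∈ X.visitors S, (X.rc i).stamp = X.ep) {r : Rec}
    (hr : r = { X.rc b with arrow := q, count := (X.rc b).count - 1, flag := fl }) {Y : Abs n k}
    (hY : Y = { X with
      rc := Function.update (Function.update X.rc b r) j ((X.rc j).arrive X.ep)
      base := X.hm j
      par := Function.update X.par X.base (X.hm j) }) :
    Good P S Y ∧ pot P S Y + 1 ≤ pot P S X := by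
  obtain ⟨hjA, hjb, hjp⟩ := mem_visitors.1 hj
  have hbj : b ≠ j := by rintro rfl; exact hjb hbb
  have hab := h.at_base b hb hbb
  have hdone := h.done b hb h0
  have huniq : ∀ b', X.At S b' → X.hm b' = X.base → b' = b := fun b' h1 h2 =>
    h.hm_inj b' b h1 hb (h2.trans hbb.symm)
  have hYb : Y.rc b = r := by simp [hY, hbj]
  have hYj : Y.rc j = (X.rc j).arrive X.ep := by simp [hY]
  have hYi : ∀ i, i ≠ j → i ≠ b → Y.rc i = X.rc i := fun i h1 h2 => by simp [hY, h1, h2]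
  have hrp : r.port = (X.rc b).port := by rw [hr]
  have hrq : r.probing = (X.rc b).probing := by rw [hr]
  have hrs : r.stamp = X.ep := by rw [hr]; exact hab.2
  have hrc : r.count = (X.rc b).count - 1 := by rw [hr]
  have hrf : r.flag = fl := by rw [hr]
  have hra : r.arrow = q := by rw [hr]
  have hset : ∀ i, (Y.rc i).settled = (X.rc i).settled := by
    intro i
    by_cases h1 : i = j
    · rw [h1, hYj]; rfl
    · by_cases h2 : i = b
      · rw [h2, hYb, hr]
      · rw [hYi i h1 h2]
  have hWj : X.hm j ∈ X.W := h.hm_mem j hjA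
  have R : Rebase P S X Y j (X.hm j) :=
    { ne := hjb
      adj := hqt ▸ P.adj_target hq
      base := by rw [hY]
      W := by rw [hY, Finset.insert_eq_of_mem hWj]
      par := by rw [hY]
      ep := by rw [hY]
      hurt := by rw [hY]
      hm := fun i _ => by rw [hY]
      hm_j := by rw [hY]
      mem := hjA.1
      settled := fun i _ => hset i
      settled_j := (hset j).trans hjA.2
      arrow_j := by rw [hYj]; rfl
      stamp_j := by rw [hYj]; rfl
      probing_j := by rw [hYj]; exact h.not_probing j hjA hjb
      port_j := Or.inr ⟨hjA, by rw [hYj]; rfl⟩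
      old_j := fun _ => ⟨rfl, hjp⟩
      away := fun i hi hij he => hij (h.hm_inj i j hi hjA he)
      off := fun i hi hij hib => hYi i hij fun he => hib (he ▸ hbb)
      arrow_mem := fun b' h1 h2 => by rw [huniq b' h1 h2, hYb, hra]; exact hq
      target := fun b' h1 h2 => by rw [huniq b' h1 h2, hYb, hra]; exact hqt
      port_b := fun b' h1 h2 => by rw [huniq b' h1 h2, hYb, hrp]
      port_eq := fun b' h1 h2 h3 => by
        rw [huniq b' h1 h2, hYb, hrp] at h3
        exact absurd h0 h3
      probing_b := fun b' h1 h2 => by rw [huniq b' h1 h2, hYb, hrq]; exact hdone.1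
      probing_old := fun b' h1 h2 => by rw [huniq b' h1 h2]; exact hdone.1
      stamp_b := fun b' h1 h2 => by rw [huniq b' h1 h2, hYb, hrs] }
  have hjK : X.hm j ∈ X.liveKids P S (X.rc b) X.base :=
    Finset.mem_filter.2 ⟨Finset.mem_filter.2 ⟨hWj, hjb, hjp, Or.inl h0⟩, j, hjA, rfl⟩
  have hjc : (Y.rc j).count =
      if (X.rc j).port = 0 then (X.rc j).count + 1 else (X.rc j).count := by rw [hYj]; rfl
  have hjport : (Y.rc j).port = (X.rc j).port := by rw [hYj]; rfl
  have hjpr : (Y.rc j).probing = (X.rc j).probing := by rw [hYj]; rfl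
  constructor
  · refine R.good h ?_ ?_ ?_ ?_
    · intro b' h1 h2
      rw [huniq b' h1 h2, hYb, hrc, Finset.card_erase_of_mem (Finset.mem_filter.1 hjK).1]
      have := h.kids_le b hb
      rw [hbb] at this
      omega
    · rw [kids_congr P X _ hjport hjpr, hjc, hjport]
      have := h.kids_le j hjA
      split_ifs <;> omega
    · simp only [hset]
      rw [R.W, Finset.insert_eq_of_mem hWj]
      exact h.card_le
    · rcases hfl with ⟨h1, h2⟩ | ⟨h1, h2, h3, h4, h5⟩
      · refine R.calm_forward h ?_ ?_
        · intro b' h3 h4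
          rw [huniq b' h3 h4, hYb, hrf, h1]
        · intro i hi ho he
          rw [h.hm_inj i j hi hjA he] at ho
          exact h2 ho.2.1
      · refine R.calm_back hjA ⟨hjb, h2, h3⟩ ?_ ?_
        · intro b' h6 h7
          rw [huniq b' h6 h7, hYb, hrf, h1]
          exact ⟨rfl, h0⟩
        · intro u hu hub hup
          obtain ⟨i, hi, rfl⟩ := h.live_of_card hb hbb h0 h4 hu hub hup
          exact ⟨i, (mem_visitors.1 hi).1, rfl, h5 i hi⟩
  -- Forwards, the new base robot falls from 2 to 0 and the old one rises from 0 to 1. Backwards,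
  -- the new one falls from 1 to 0 and the old one is closed at no cost.
  · refine R.pot_add_le h (c := if fl = true then 1 else 0) (d := if fl = true then 2 else 1)
      ?_ ?_ ?_
    · intro b' h1 h2
      rw [huniq b' h1 h2, weight_base hb.2 hbb hab.2]
      have h3 : (Y.liveKids P S r X.base).card = (X.liveKids P S (X.rc b) X.base).card - 1 := by
        rw [R.liveKids_of_ne _ hjb.symm, liveKids_congr P X S _ hrp hrq,
          Finset.card_erase_of_mem hjK]
      have h4 := Finset.card_pos.2 ⟨_, hjK⟩
      have h5 : scanCost k r = scanCost k (X.rc b) := by simp [scanCost, hrp, hrq]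
      have h6 : r.settled = true := by rw [hr]; exact hb.2
      have h7 : Y.hm b = X.base := by rw [R.hm b hbj, hbb]
      simp only [weight, hYb, h6, h7, h3, h5, hrs, hrc, hrf, R.ep, R.base, if_true]
      -- The visitor leaves both the count and the live kids, of which there is at least one, so
      -- truncation does no harm.
      have h8 : (X.rc b).count - 1 - ((X.liveKids P S (X.rc b) X.base).card - 1) =
        (X.rc b).count - (X.liveKids P S (X.rc b) X.base).card := by omega
      rw [h8]
      have h9 : (if fl = true ∧ X.base ≠ X.hm j then 1 else 0) ≤ if fl = true then 1 else 0 := by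
        split_ifs <;> simp_all
      omega
    · have h1 := R.card_liveKids_self h ⟨b, hb, hbb⟩ (Y.rc j)
      rw [liveKids_congr P X S _ hjport hjpr, hjport] at h1
      rw [weight_base R.at_j.2 (by rw [R.hm_j, R.base]) (by rw [R.stamp_j, R.ep])]
      have h2 : scanCost k (Y.rc j) = scanCost k (X.rc j) := by simp [scanCost, hjport, hjpr]
      have h3 : (Y.rc j).count - (Y.liveKids P S (Y.rc j) Y.base).card ≤
          (X.rc j).count - (X.liveKids P S (X.rc j) (X.hm j)).card := by
        rw [hjc, R.base]
        split_ifs at * <;> omega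
      have h4 := Nat.mul_le_mul_left (k - 2) h3
      have h5 : (if fl = true then 2 else 1) ≤ if (X.rc j).stamp = X.ep then
          if (X.rc j).flag = true ∧ X.hm j ≠ X.base then 1 else 0 else 2 := by
        rcases hfl with ⟨h5, h6⟩ | ⟨h5, h6, h7, -⟩
        · simp [h5, h6]
        · simp [h5, h6, h7, hjb]
      rw [h2]
      simp only [weight, hjA.2, if_true]
      omega
    · split_ifs <;> omega

/-- If the whole tree has been visited without finding a free node, then a settled robot has
crashed. -/
theorem Good.hurt_of_visited (h : Good P S X) (hG : G.Connected) (hkn : k ≤ n) {b : Fin k}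
    (hb : X.At S b) (hbb : X.hm b = X.base) (h0 : (X.rc b).port = 0)
    (hf : ∃ i ∈ S, (X.rc i).settled = false)
    (hV : (X.rc b).count ≤ (X.visitors S).card)
    (hcl : ∀ i ∈ X.visitors S, (X.rc i).stamp = X.ep ∧ (X.rc i).flag = false) : X.hurt := by
  by_contra hh
  have hc := h.calm hh
  -- Induction along the pointers, starting from the base: in a calm epoch every node of `W` is
  -- manned by a robot that has completed its scan and, away from the base, is closed.
  have key : ∀ w ∈ X.W, ∃ i, X.At S i ∧ X.hm i = w ∧ (X.rc i).port = 0 ∧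
      (w = X.base ∨ (X.rc i).stamp = X.ep ∧ (X.rc i).flag = false) := by
    intro w hw
    refine Relation.ReflTransGen.head_induction_on (h.chain w hw) ⟨b, hb, hbb, h0, Or.inl rfl⟩ ?_
    rintro a c ⟨haW, hac⟩ - ⟨i, hi, hic, hi0, hi1⟩
    by_cases hab : a = X.base
    · exact ⟨b, hb, hbb.trans hab.symm, h0, Or.inl hab⟩
    by_cases hcb : c = X.base
    · obtain ⟨i', hi', rfl⟩ := h.live_of_card hb hbb h0 hV haW hab (hac.trans hcb)
      have h1 := (mem_visitors.1 hi').1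
      have h2 := hcl i' hi'
      exact ⟨i', h1, rfl, (hc.closed i' h1 hab h2.1 h2.2).1, Or.inr h2⟩
    · obtain ⟨h3, h4⟩ := hi1.resolve_left hcb
      have hib : X.hm i ≠ X.base := hic ▸ hcb
      obtain ⟨i', h5, h6, h7⟩ := (hc.closed i hi hib h3 h4).2 a haW hab (hac.trans hic.symm)
      -- An open robot points to the base or to the home of an open robot, but `c` is neither.
      have h8 : (X.rc i').flag = false := by
        rw [← Bool.not_eq_true]
        intro h8
        obtain h9 | ⟨i'', h9, h10, h11⟩ := hc.opened i' h5 ⟨h6 ▸ hab, h7, h8⟩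
        · rw [h6, hac] at h9
          exact hcb h9
        · rw [h6, hac, ← hic] at h11
          have := h10.2.2
          rw [h.hm_inj i'' i h9 hi h11, h4] at this
          exact Bool.false_ne_true this
      exact ⟨i', h5, h6, (hc.closed i' h5 (h6 ▸ hab) h7 h8).1, Or.inr ⟨h7, h8⟩⟩
  -- Completed scans make `W` closed under adjacency, so it contains every node that a walk from the
  -- base reaches.
  have huniv : ∀ w, w ∈ X.W := by
    intro w
    obtain ⟨p⟩ := hG.preconnected X.base w
    have hp : ∀ {u v : Fin n} (_ : G.Walk u v), u ∈ X.W → v ∈ X.W := by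
      intro u v p
      induction p with
      | nil => exact _root_.id
      | cons huv _ ih =>
        intro hu
        obtain ⟨i, hi, rfl, hi0, -⟩ := key _ hu
        exact ih ((h.done i hi hi0).2 _ huv)
    exact hp p h.base_mem
  have h1 : X.W = Finset.univ := Finset.eq_univ_iff_forall.2 huniv
  have h2 := h.card_le
  have h3 : 1 ≤ (S.filter fun i => (X.rc i).settled = false).card := by
    obtain ⟨i, hi, hi'⟩ := hf
    exact Finset.card_pos.2 ⟨i, Finset.mem_filter.2 ⟨hi, hi'⟩⟩
  rw [h1, Finset.card_univ, Fintype.card_fin] at h2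
  omega

/-- A new epoch begins. -/
theorem Good.newEpoch (h : Good P S X) {b : Fin k} (hb : X.At S b) (hbb : X.hm b = X.base)
    (hh : X.hurt) {r : Rec} (hr : r = { X.rc b with stamp := X.ep + 1 }) {Y : Abs n k}
    (hY : Y = { X with rc := Function.update X.rc b r, ep := X.ep + 1, hurt := False }) :
    Good P S Y ∧ pot P S Y + 1 ≤ pot P S X := by
  have hYb : Y.rc b = r := by simp [hY]
  have hYi : ∀ i, i ≠ b → Y.rc i = X.rc i := fun i h1 => by simp [hY, h1]
  have hrb : ∀ i, { Y.rc i with stamp := (X.rc i).stamp } = X.rc i := by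
    intro i
    by_cases h1 : i = b
    · rw [h1, hYb, hr]
    · rw [hYi i h1]
  have hset : ∀ i, (Y.rc i).settled = (X.rc i).settled := 
    fun i => (congrArg Rec.settled (hrb i) :)
  have harr : ∀ i, (Y.rc i).arrow = (X.rc i).arrow := 
    fun i => (congrArg Rec.arrow (hrb i) :)
  have hport : ∀ i, (Y.rc i).port = (X.rc i).port := 
    fun i => (congrArg Rec.port (hrb i) :)
  have hprob : ∀ i, (Y.rc i).probing = (X.rc i).probing := 
    fun i => (congrArg Rec.probing (hrb i) :)
  have hcnt : ∀ i, (Y.rc i).count = (X.rc i).count := 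
    fun i => (congrArg Rec.count (hrb i) :)
  have hbase : Y.base = X.base := by rw [hY]
  have hW : Y.W = X.W := by rw [hY]
  have hpar : Y.par = X.par := by rw [hY]
  have hhm : Y.hm = X.hm := by rw [hY]
  have hep : Y.ep = X.ep + 1 := by rw [hY]
  have hat : ∀ i, Y.At S i ↔ X.At S i := fun i => by rw [Abs.At, Abs.At, hset]
  have hkids : ∀ i, Y.kids P (Y.rc i) = X.kids P (X.rc i) := by
    intro i
    ext v u
    have : Scanned P (Y.rc i) v u ↔ Scanned P (X.rc i) v u := by simp only [Scanned, hport, hprob]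
    simp only [Abs.kids, Finset.mem_filter, hW, hbase, hpar, this]
  have huniq : ∀ b', X.At S b' → X.hm b' = X.base → b' = b := fun b' h1 h2 =>
    h.hm_inj b' b h1 hb (h2.trans hbb.symm)
  have hstamp : ∀ i, X.At S i → X.hm i ≠ X.base → (Y.rc i).stamp ≠ Y.ep := by
    intro i hi hib
    have h1 := h.stamp_le i hi
    have h2 : i ≠ b := by rintro rfl; exact hib hbb
    rw [hYi i h2, hep]
    omega
  constructor
  · refine ⟨?_, ?_, ?_, ?_, ?_, ?_, ?_, ?_, ?_, ?_, ?_, ?_, ?_, ?_, ?_, ?_, ?_, ?_⟩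
    · rw [hbase, hW]; exact h.base_mem
    · intro i hi; rw [hhm, hW]; exact h.hm_mem i ((hat i).1 hi)
    · intro i j hi hj; rw [hhm]; exact h.hm_inj i j ((hat i).1 hi) ((hat j).1 hj)
    · intro i hi hib
      rw [hhm, hbase] at hib
      obtain rfl := huniq i ((hat i).1 hi) hib
      rw [harr, hep, hYb, hr]
      exact ⟨(h.at_base i hb hib).1, rfl⟩
    · intro i hi; rw [hhm, hbase, harr]; exact h.arrow_mem i ((hat i).1 hi)
    · intro i hi; rw [hhm, hbase, harr, hpar]; exact h.target_arrow i ((hat i).1 hi)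
    · intro i hi; rw [hhm, hbase, hprob]; exact h.not_probing i ((hat i).1 hi)
    · intro i hi; rw [hhm, hbase, hport, harr]; exact h.port_eq i ((hat i).1 hi)
    · rw [hW, hbase, hpar]; exact h.adj
    · rw [hW, hbase, hpar]; exact h.chain
    · intro i hi; rw [hkids, hhm, hcnt]; exact h.kids_le i ((hat i).1 hi)
    · intro i hi; rw [hhm, hport, hprob, hW]; exact h.done i ((hat i).1 hi)
    · intro i hi; rw [hhm, hport]; exact h.port_le i ((hat i).1 hi)
    · intro i hi; rw [hhm, hport, hW]; exact h.scan i ((hat i).1 hi)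
    · intro i hi; rw [hhm, hport, hprob, hW]; exact h.probed i ((hat i).1 hi)
    · simp only [hset, hW]; exact h.card_le
    · intro i hi
      by_cases hib : i = b
      · rw [hib, hYb, hr, hep]
      · rw [hYi i hib, hep]; exact (h.stamp_le i ((hat i).1 hi)).trans (Nat.le_succ _)
    -- Apart from the base, nobody carries the new stamp, so all conditions on visited robots are
    -- vacuous.
    · intro _
      refine ⟨⟨b, (hat b).2 hb, by rw [hhm, hbase, hbb]⟩, ?_, ?_, ?_⟩
      · intro i hi hib he
        rw [hhm, hbase] at hib
        exact absurd he (hstamp i ((hat i).1 hi) hib)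
      · rintro i hi ⟨hib, he, -⟩
        rw [hhm, hbase] at hib
        exact absurd he (hstamp i ((hat i).1 hi) hib)
      · rintro i j hi - ⟨hib, he, -⟩
        rw [hhm, hbase] at hib
        exact absurd he (hstamp i ((hat i).1 hi) hib)
  · have hlk : ∀ i, Y.liveKids P S (Y.rc i) (Y.hm i) = X.liveKids P S (X.rc i) (X.hm i) := by
      intro i
      rw [Abs.liveKids, hkids, hhm, Abs.liveKids]
      congr 1
      funext u
      simp only [Abs.Live, hat, hhm]
    -- The visits become outdated, which costs at most 2 for each robot and nothing for the base
    -- robot, which gets the new stamp. The `2 * S.card` released by `hurt` suffices with 2 to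
    -- spare.
    have h1 : ∀ i ∈ S, weight P S Y i + (if i = b then 2 else 0) ≤ weight P S X i + 2 := by
      intro i hi
      by_cases hs : (X.rc i).settled = true
      · have h2 : scanCost k (Y.rc i) = scanCost k (X.rc i) := by
          simp only [scanCost, hport, hprob]
        by_cases hib : i = b
        · subst hib
          rw [weight_base hb.2 hbb (h.at_base i hb hbb).2,
            weight_base (by rw [hset]; exact hs) (by rw [hhm, hbase, hbb])
              (by rw [hYb, hr, hep]), h2, hcnt, hbase]
          have h3 := hlk i
          rw [hhm, hbb] at h3
          rw [h3, if_pos rfl]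
        · simp only [weight, hset, hs, if_true, h2, hcnt, hlk, hib, if_false]
          have h3 : (if (Y.rc i).stamp = Y.ep then
            if (Y.rc i).flag = true ∧ Y.hm i ≠ Y.base then 1 else 0 else 2) ≤ 2 := by
            split_ifs <;> omega
          omega
      · have hib : i ≠ b := by rintro rfl; exact hs hb.2
        simp [weight, hset, hs, hib]
    have h2 := Finset.sum_le_sum h1
    rw [Finset.sum_add_distrib, Finset.sum_add_distrib, Finset.sum_ite_eq', if_pos hb.1,
      Finset.sum_const, smul_eq_mul] at h2
    have h3 : ¬ Y.hurt := by rw [hY]; exact not_false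
    simp only [pot, if_neg h3, if_pos hh]
    omega

/-- A robot settles at an unoccupied node that has been probed. -/
theorem Good.settleNew (h : Good P S X) {p : ℕ} (hp : p ∈ Finset.Icc 1 (G.degree X.base))
    (hx : ¬ X.Live S (P.target X.base p)) (hb : ∀ b, X.At S b → X.hm b = X.base →
      (X.rc b).port = p ∧ (X.rc b).probing = false ∧ (X.rc b).flag = true)
    {i₀ : Fin k} (hi₀ : i₀ ∈ S) (hf : (X.rc i₀).settled = false) {r : Rec} (hs : r.settled = true)
    (ha : r.arrow = 0) (hrp : r.port = 1) (hpr : r.probing = false) (hrc : r.count = 0)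
    (hrs : r.stamp = X.ep) {Y : Abs n k}
    (hY : Y = { X with
      rc := Function.update
        (fun i => if X.hm i = X.base then { X.rc i with arrow := p } else X.rc i) i₀ r
      hm := Function.update X.hm i₀ (P.target X.base p)
      base := P.target X.base p
      W := insert (P.target X.base p) X.W
      par := Function.update X.par X.base (P.target X.base p) }) :
    Good P S Y ∧ pot P S Y + 1 ≤ pot P S X := by
  set x := P.target X.base p with hxd
  have hadj : G.Adj X.base x := P.adj_target hp
  have hne : ∀ i, X.At S i → i ≠ i₀ := by
    rintro i hi rfl
    rw [hi.2] at hf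
    exact Bool.false_ne_true hf.symm
  have hYj : Y.rc i₀ = r := by simp [hY]
  have hYb : ∀ b, X.At S b → X.hm b = X.base → Y.rc b = { X.rc b with arrow := p } :=
    fun b h1 h2 => by simp [hY, hne b h1, h2]
  have hYi : ∀ i, i ≠ i₀ → X.hm i ≠ X.base → Y.rc i = X.rc i := fun i h1 h2 => by
    simp [hY, h1, h2]
  have hset : ∀ i, i ≠ i₀ → (Y.rc i).settled = (X.rc i).settled := by
    intro i hi
    simp only [hY, Function.update_of_ne hi]
    split_ifs <;> rfl
  have R : Rebase P S X Y i₀ x :=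
    { ne := hadj.ne.symm
      adj := hadj
      base := by rw [hY]
      W := by rw [hY]
      par := by rw [hY]
      ep := by rw [hY]
      hurt := by rw [hY]
      hm := fun i hi => by simp [hY, hi]
      hm_j := by simp [hY]
      mem := hi₀
      settled := hset
      settled_j := by rw [hYj]; exact hs
      arrow_j := by rw [hYj]; exact ha
      stamp_j := by rw [hYj]; exact hrs
      probing_j := by rw [hYj]; exact hpr
      port_j := Or.inl (by rw [hYj]; exact hrp)
      old_j := fun h1 => absurd rfl (hne _ h1)
      away := fun i hi _ he => hx ⟨i, hi, he⟩
      off := fun i hi hij hib => hYi i hij hib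
      arrow_mem := fun b h1 h2 => by rw [hYb b h1 h2]; exact hp
      target := fun b h1 h2 => by rw [hYb b h1 h2]
      port_b := fun b h1 h2 => by rw [hYb b h1 h2]
      port_eq := fun b h1 h2 h3 => by rw [hYb b h1 h2]; exact (hb b h1 h2).1
      probing_b := fun b h1 h2 => by rw [hYb b h1 h2]; exact (hb b h1 h2).2.1
      probing_old := fun b h1 h2 => (hb b h1 h2).2.1
      stamp_b := fun b h1 h2 => by rw [hYb b h1 h2]; exact (h.at_base b h1 h2).2 }
  have hk0 : X.kids P r x = ∅ := by
    refine Finset.filter_eq_empty_iff.2 ?_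
    rintro u - ⟨-, -, h1 | ⟨q, hq, -, h1 | ⟨-, h1⟩⟩⟩
    · omega
    · rw [Finset.mem_Icc] at hq
      omega
    · rw [hpr] at h1; exact Bool.false_ne_true h1
  constructor
  · refine R.good h ?_ ?_ ?_ ?_
    · intro b h1 h2
      rw [hYb b h1 h2]
      have := h.kids_le b h1
      rw [h2] at this
      exact (Finset.card_le_card (Finset.erase_subset _ _)).trans this
    · rw [hYj, hk0, hrp, hrc]; simp
    -- The node may be an abandoned home that is already in `W`; in any case `W` gains at most one
    -- node and the free robots lose one.
    · have h1 : (S.filter fun i => (Y.rc i).settled = false) =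
          (S.filter fun i => (X.rc i).settled = false).erase i₀ := by
        ext i
        simp only [Finset.mem_filter, Finset.mem_erase]
        by_cases hi : i = i₀
        · subst hi
          simp [hYj, hs]
        · rw [hset i hi]
          tauto
      have h2 := h.card_le
      have h3 := Finset.card_insert_le x X.W
      have h4 : i₀ ∈ S.filter fun i => (X.rc i).settled = false := Finset.mem_filter.2 ⟨hi₀, hf⟩
      have h5 := Finset.card_erase_add_one h4
      rw [h1, R.W]
      omega
    · refine R.calm_forward h ?_ ?_
      · intro b h1 h2
        rw [hYb b h1 h2]; exact (hb b h1 h2).2.2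
      · intro i hi _ he
        exact hx ⟨i, hi, he⟩
  -- The settling robot falls from `2 * (k - 2) + 2` to `2 * (k - 2)`; the old base robot, if alive,
  -- becomes open and rises by 1.
  · refine R.pot_add_le h (c := 1) (d := 2) ?_ ?_ le_rfl
    · intro b h1 h2
      have h3 : (Y.liveKids P S (Y.rc b) X.base).card = (X.liveKids P S (X.rc b) X.base).card := by
        rw [R.liveKids_of_ne _ R.ne.symm, liveKids_congr P X S _ (R.port_b b h1 h2)
          ((R.probing_b b h1 h2).trans (R.probing_old b h1 h2).symm), Finset.erase_eq_of_notMem]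
        intro h4
        exact hx (Finset.mem_filter.1 h4).2
      rw [weight_base h1.2 h2 (h.at_base b h1 h2).2]
      have h4 : (Y.rc b).settled = true := (hset b (hne b h1)).trans h1.2
      have h5 : scanCost k (Y.rc b) = scanCost k (X.rc b) := by rw [hYb b h1 h2]; rfl
      have h6 : (Y.rc b).count = (X.rc b).count := by rw [hYb b h1 h2]
      have h7 : (Y.rc b).stamp = Y.ep := (R.stamp_b b h1 h2).trans R.ep.symm
      have h8 : Y.hm b = X.base := (R.hm b (hne b h1)).trans h2
      simp only [weight, h4, h5, h6, h7, h8, h3, if_true]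
      split_ifs <;> omega
    · rw [weight_base R.settled_j (by rw [R.hm_j, R.base]) (by rw [R.stamp_j, R.ep]), hYj, hrc]
      simp only [scanCost, hrp, hpr, weight, hf, Nat.zero_sub, mul_zero, one_ne_zero, if_false,
        Bool.toNat_false, Bool.false_eq_true]
      omega

/-- A robot settles at the base after the base robot has crashed. -/
theorem Good.settleHere (h : Good P S X) (hx : ¬ X.Live S X.base)
    {i₀ : Fin k} (hi₀ : i₀ ∈ S) (hf : (X.rc i₀).settled = false) {r : Rec} (hs : r.settled = true)
    (ha : r.arrow = 0) (hrp : r.port = 1) (hpr : r.probing = false) (hrc : r.count = 0)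
    (hrs : r.stamp = X.ep) (hd : 1 ≤ G.degree X.base) {Y : Abs n k}
    (hY : Y = { X with
      rc := Function.update X.rc i₀ r
      hm := Function.update X.hm i₀ X.base }) :
    Good P S Y ∧ pot P S Y + 1 ≤ pot P S X := by
  -- The base robot can only be missing after a crash in this epoch, so nothing has to be shown
  -- about `Calm`.
  have hh : X.hurt := by
    by_contra hh
    exact hx (h.calm hh).base_live
  have hne : ∀ i, X.At S i → i ≠ i₀ := by
    rintro i hi rfl
    rw [hi.2] at hf
    exact Bool.false_ne_true hf.symm
  have hYj : Y.rc i₀ = r := by simp [hY]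
  have hYi : ∀ i, i ≠ i₀ → Y.rc i = X.rc i := fun i h1 => by simp [hY, h1]
  have hbase : Y.base = X.base := by rw [hY]
  have hW : Y.W = X.W := by rw [hY]
  have hpar : Y.par = X.par := by rw [hY]
  have hep : Y.ep = X.ep := by rw [hY]
  have hhurt : Y.hurt = X.hurt := by rw [hY]
  have hhj : Y.hm i₀ = X.base := by simp [hY]
  have hhi : ∀ i, i ≠ i₀ → Y.hm i = X.hm i := fun i h1 => by simp [hY, h1]
  have hkids : ∀ r v, Y.kids P r v = X.kids P r v := by
    intro r v
    rw [Abs.kids, hW, hbase, hpar, Abs.kids]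
  have hcases : ∀ i, Y.At S i → i = i₀ ∨ (X.At S i ∧ Y.hm i = X.hm i ∧ X.hm i ≠ X.base ∧
      Y.rc i = X.rc i) := by
    intro i hi
    by_cases hij : i = i₀
    · exact Or.inl hij
    · have h1 : X.At S i := by rw [Abs.At, ← hYi i hij]; exact hi
      exact Or.inr ⟨h1, hhi i hij, fun he => hx ⟨i, h1, he⟩, hYi i hij⟩
  have hat : ∀ i, X.At S i → Y.At S i := by
    intro i hi
    rw [Abs.At, hYi i (hne i hi)]
    exact hi
  have hk0 : X.kids P r X.base = ∅ := by
    refine Finset.filter_eq_empty_iff.2 ?_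
    rintro u - ⟨-, -, h1 | ⟨q, hq, -, h1 | ⟨-, h1⟩⟩⟩
    · omega
    · rw [Finset.mem_Icc] at hq
      omega
    · rw [hpr] at h1; exact Bool.false_ne_true h1
  constructor
  · refine ⟨?_, ?_, ?_, ?_, ?_, ?_, ?_, ?_, ?_, ?_, ?_, ?_, ?_, ?_, ?_, ?_, ?_, ?_⟩
    · rw [hbase, hW]; exact h.base_mem
    · intro i hi
      obtain rfl | ⟨h1, h2, -, -⟩ := hcases i hi
      · rw [hhj, hW]; exact h.base_mem
      · rw [h2, hW]; exact h.hm_mem i h1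
    · intro i j hi hj he
      obtain rfl | ⟨h1, h2, h3, -⟩ := hcases i hi <;> obtain rfl | ⟨h1', h2', h3', -⟩ := hcases j hj
      · rfl
      · rw [hhj, h2'] at he; exact absurd he.symm h3'
      · rw [hhj, h2] at he; exact absurd he h3
      · rw [h2, h2'] at he; exact h.hm_inj i j h1 h1' he
    · intro i hi he
      obtain rfl | ⟨h1, h2, h3, h4⟩ := hcases i hi
      · rw [hYj, hep]; exact ⟨ha, hrs⟩
      · rw [h2, hbase] at he; exact absurd he h3
    · intro i hi he
      obtain rfl | ⟨h1, h2, h3, h4⟩ := hcases i hi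
      · exact absurd (hhj.trans hbase.symm) he
      · rw [h2, h4]; exact h.arrow_mem i h1 h3
    · intro i hi he
      obtain rfl | ⟨h1, h2, h3, h4⟩ := hcases i hi
      · exact absurd (hhj.trans hbase.symm) he
      · rw [h2, h4, hpar]; exact h.target_arrow i h1 h3
    · intro i hi he
      obtain rfl | ⟨h1, h2, h3, h4⟩ := hcases i hi
      · exact absurd (hhj.trans hbase.symm) he
      · rw [h4]; exact h.not_probing i h1 h3
    · intro i hi he
      obtain rfl | ⟨h1, h2, h3, h4⟩ := hcases i hi
      · exact absurd (hhj.trans hbase.symm) he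
      · rw [h4]; exact h.port_eq i h1 h3
    · rw [hW, hbase, hpar]; exact h.adj
    · rw [hW, hbase, hpar]; exact h.chain
    · intro i hi
      obtain rfl | ⟨h1, h2, h3, h4⟩ := hcases i hi
      · rw [hkids, hYj, hhj, hk0]; exact Nat.zero_le _
      · rw [hkids, h2, h4]; exact h.kids_le i h1
    · intro i hi
      obtain rfl | ⟨h1, h2, h3, h4⟩ := hcases i hi
      · rw [hYj]; intro h5; omega
      · rw [h2, h4, hW]; exact h.done i h1
    · intro i hi
      obtain rfl | ⟨h1, h2, h3, h4⟩ := hcases i hi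
      · rw [hYj, hrp, hhj]; exact hd
      · rw [h2, h4]; exact h.port_le i h1
    · intro i hi
      obtain rfl | ⟨h1, h2, h3, h4⟩ := hcases i hi
      · rw [hYj]; intro q h5 h6; omega
      · rw [h2, h4, hW]; exact h.scan i h1
    · intro i hi
      obtain rfl | ⟨h1, h2, h3, h4⟩ := hcases i hi
      · rw [hYj, hpr]; intro h5; exact absurd h5 Bool.false_ne_true
      · rw [h2, h4, hW]; exact h.probed i h1
    · refine le_trans ?_ h.card_le
      rw [hW]
      refine Nat.add_le_add_left (Finset.card_le_card ?_) _
      intro i hi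
      rw [Finset.mem_filter] at hi ⊢
      refine ⟨hi.1, ?_⟩
      by_cases hij : i = i₀
      · rw [hij]; exact hf
      · rw [← hYi i hij]; exact hi.2
    · intro i hi
      obtain rfl | ⟨h1, h2, h3, h4⟩ := hcases i hi
      · rw [hYj, hrs, hep]
      · rw [h4, hep]; exact h.stamp_le i h1
    · intro h1
      rw [hhurt] at h1
      exact absurd hh h1
  · have h1 : ∀ i ∈ S, weight P S Y i + (if i = i₀ then 1 else 0) ≤ weight P S X i := by
      intro i hi
      by_cases hij : i = i₀
      · subst hij
        rw [weight_base (by rw [hYj]; exact hs) (hhj.trans hbase.symm) (by rw [hYj, hrs, hep]), hYj,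
          hrc]
        simp only [scanCost, hrp, hpr, weight, hf, Nat.zero_sub, mul_zero, one_ne_zero, if_false,
          Bool.toNat_false, Bool.false_eq_true, if_true]
        omega
      · have h2 : X.liveKids P S (X.rc i) (X.hm i) ⊆ Y.liveKids P S (X.rc i) (X.hm i) := by
          intro u hu
          obtain ⟨h3, j, h4, h5⟩ := Finset.mem_filter.1 hu
          refine Finset.mem_filter.2 ⟨by rw [hkids]; exact h3, j, hat j h4, ?_⟩
          rw [hhi j (hne j h4)]
          exact h5
        have h3 := Nat.mul_le_mul_left (k - 2)
          (Nat.sub_le_sub_left (Finset.card_le_card h2) (X.rc i).count)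
        simp only [weight, hYi i hij, hhi i hij, hep, hbase, hij, if_false]
        split_ifs <;> omega
    have h2 := Finset.sum_le_sum h1
    rw [Finset.sum_add_distrib, Finset.sum_ite_eq', if_pos hi₀] at h2
    simp only [pot, hhurt]
    omega

end Moves

/-! ### Abstract states and actual configurations -/

section Relations

open Classical

variable {n k : ℕ} {G : SimpleGraph (Fin n)} [DecidableRel G.Adj] (P : PortLabelling G)

/-- The states of the robots at the beginning of an odd round: the settled robots visit the nodes
to which their arrows lead, except that a robot may have to learn yet that the free robots have
not returned from a probe. -/
structure OddRel (S : Finset (Fin k)) (X : Abs n k) (c : Fin k → Rob n) (hit : Bool) : Prop where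
  settled : ∀ i ∈ S, (c i).info.settled = (X.rc i).settled
  free : ∀ i ∈ S, (X.rc i).settled = false → (c i).pos = X.base ∧ (c i).info.id = i + 1 ∧
    (c i).info.probing = false ∧ (c i).info.stamp = X.ep ∧ (c i).info.flag = hit
  base : ∀ i, X.At S i → X.hm i = X.base → (c i).pos = X.base ∧ X.rc i = (c i).info.absorb hit
  off : ∀ i, X.At S i → X.hm i ≠ X.base →
    (c i).info = X.rc i ∧ ((c i).pos, (c i).entry) = P.traverse (X.hm i) (X.rc i).arrow ∨
    (c i).info = { X.rc i with arrow := 0, probing := true } ∧ (c i).pos = X.hm i ∧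
      (X.rc i).arrow = (X.rc i).port ∧
      ∀ b, X.At S b → X.hm b = X.base → (X.rc b).port = 1 ∧ (X.rc b).probing = false

/-- The states of the robots at the beginning of an even round: the settled robots are at home, and
the free robots are at the node `y`. -/
structure EvenRel (S : Finset (Fin k)) (X : Abs n k) (c : Fin k → Rob n) (y : Fin n)
    (e : Option ℕ) (out hit : Bool) : Prop where
  settled : ∀ i ∈ S, (c i).info.settled = (X.rc i).settled
  free : ∀ i ∈ S, (X.rc i).settled = false → (c i).pos = y ∧ (c i).entry = e ∧
    (c i).info.id = i + 1 ∧ (c i).info.probing = out ∧ (c i).info.stamp = X.ep ∧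
    (c i).info.flag = hit
  home : ∀ i, X.At S i → (c i).pos = X.hm i
  off : ∀ i, X.At S i → X.hm i ≠ X.base → (c i).info = X.rc i

/-- The free robots are at the base, or have just walked there. -/
def NearRel (S : Finset (Fin k)) (X : Abs n k) (c : Fin k → Rob n) : Prop :=
  ∃ e hit, EvenRel S X c X.base e false hit ∧ ∀ i, X.At S i → X.hm i = X.base →
    (X.rc i).probing = false ∧
      ((c i).info = X.rc i ∨ (c i).info.arrow ≠ 0 ∧ X.rc i = (c i).info.arrive X.ep)

/-- The free robots probe a port of the base. -/
def FarRel (S : Finset (Fin k)) (X : Abs n k) (c : Fin k → Rob n) : Prop :=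
  ∃ p q hit, EvenRel S X c (P.target X.base p) (some q) true hit ∧
    p ∈ Finset.Icc 1 (G.degree X.base) ∧ P.traverse (P.target X.base p) q = (X.base, some p) ∧
    ∀ i, X.At S i → X.hm i = X.base → (c i).info = { X.rc i with probing := true } ∧
      (X.rc i).port = p ∧ (X.rc i).probing = false ∧ (X.rc i).flag = true

variable {P} {S : Finset (Fin k)} {X : Abs n k} {c : Fin k → Rob n}

/-- All clauses speak of living robots only and none mentions `hurt`, so crashes preserve the
relation. -/
theorem EvenRel.mono {y e out hit} (h : EvenRel S X c y e out hit) {T : Finset (Fin k)}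
    (hT : T ⊆ S) (hurt : Prop) : EvenRel T { X with hurt := hurt } c y e out hit :=
  ⟨fun i hi => h.settled i (hT hi), fun i hi => h.free i (hT hi),
    fun i hi => h.home i ⟨hT hi.1, hi.2⟩, fun i hi => h.off i ⟨hT hi.1, hi.2⟩⟩

theorem NearRel.mono (h : NearRel S X c) {T : Finset (Fin k)} (hT : T ⊆ S) (hurt : Prop) :
    NearRel T { X with hurt := hurt } c := by
  obtain ⟨e, hit, h1, h2⟩ := h
  exact ⟨e, hit, h1.mono hT hurt, fun i hi => h2 i ⟨hT hi.1, hi.2⟩⟩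

theorem FarRel.mono (h : FarRel P S X c) {T : Finset (Fin k)} (hT : T ⊆ S) (hurt : Prop) :
    FarRel P T { X with hurt := hurt } c := by
  obtain ⟨p, q, hit, h1, h2, h3, h4⟩ := h
  exact ⟨p, q, hit, h1.mono hT hurt, h2, h3, fun i hi => h4 i ⟨hT hi.1, hi.2⟩⟩

theorem OddRel.mono {hit : Bool} (h : OddRel P S X c hit) {T : Finset (Fin k)} (hT : T ⊆ S)
    (hurt : Prop) : OddRel P T { X with hurt := hurt } c hit := by
  refine ⟨fun i hi => h.settled i (hT hi), fun i hi => h.free i (hT hi),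
    fun i hi => h.base i ⟨hT hi.1, hi.2⟩, fun i hi hib => ?_⟩
  refine (h.off i ⟨hT hi.1, hi.2⟩ hib).imp _root_.id ?_
  rintro ⟨h1, h2, h3, h4⟩
  exact ⟨h1, h2, h3, fun b hb => h4 b ⟨hT hb.1, hb.2⟩⟩

theorem pick_spec {V : Multiset Seen} {p : Rec → Prop} (h : ∃ x ∈ V, p x.1) :
    p (pick V p) ∧ ∃ y, (pick V p, y) ∈ V := by
  obtain ⟨⟨r, y⟩, hx, hp⟩ := h
  exact Classical.epsilon_spec (p := fun r => p r ∧ ∃ y, (r, y) ∈ V) ⟨r, hp, y, hx⟩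

theorem step_of_action {t : ℕ} {i : Fin k} {r : Rec} {o : Option ℕ}
    (h : action t G S c i = (r, o)) :
    step P t S c i = ⟨(P.move (c i).pos o).1, r, (P.move (c i).pos o).2⟩ := by
  rw [step, h]

theorem action_odd {t : ℕ} (ht : ¬ Even t) (i : Fin k) : action t G S c i =
    actOdd (G.degree (c i).pos) (c i).info (c i).entry (scene S c i) := by
  rw [action, actRec, if_neg ht]

theorem action_even {t : ℕ} (ht : Even t) (i : Fin k) : action t G S c i =
    actEven (c i).info (c i).entry (scene S c i) := by
  rw [action, actRec, if_pos ht]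

/-- The robots at the node `v` that have left their homes, as they are seen there. -/
noncomputable def visible (S : Finset (Fin k)) (c : Fin k → Rob n) (v : Fin n) : Multiset Seen :=
  (S.filter fun i => (c i).pos = v ∧ (c i).info.settled = true ∧ (c i).info.arrow ≠ 0).val.map
    fun i => ((c i).info, (c i).entry)

/-- A scene omits its observer. An observer that is not itself a visitor loses nothing by this, so
all robots staying at a node work with the same set of visitors. -/
theorem filter_scene {i : Fin k}
    (hi : ¬ ((c i).info.settled = true ∧ (c i).info.arrow ≠ 0)) :
    ((scene S c i).filter fun x => x.1.settled = true ∧ x.1.arrow ≠ 0) =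
      visible S c (c i).pos := by
  rw [scene, visible, Multiset.filter_map, ← Finset.filter_val]
  congr 2
  ext j
  simp only [Finset.mem_filter, Function.comp_apply]
  constructor
  · rintro ⟨⟨h1, -, h2⟩, h3⟩
    exact ⟨h1, h2, h3⟩
  · rintro ⟨h1, h2, h3⟩
    refine ⟨⟨h1, ?_, h2⟩, h3⟩
    rintro rfl
    exact hi h3

namespace OddRel

variable {hit : Bool} {t : ℕ}

theorem info_free (h : OddRel P S X c hit) {i : Fin k} (hi : i ∈ S)
    (hf : (X.rc i).settled = false) : (c i).info.settled = false := (h.settled i hi).trans hf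

/-- A robot that is away returns through its entry port. A former base robot still waiting at home
sees no free robot and takes the probed port as its arrow. -/
theorem step_off (h : OddRel P S X c hit) (hg : Good P S X) (ht : ¬ Even t) {i : Fin k}
    (hi : X.At S i) (hib : X.hm i ≠ X.base) :
    (step P t S c i).pos = X.hm i ∧ (step P t S c i).info = X.rc i := by
  have harr := (Finset.mem_Icc.1 (hg.arrow_mem i hi hib)).1
  obtain ⟨h1, h2⟩ | ⟨h1, h2, h3, -⟩ := h.off i hi hib
  · have ha : action t G S c i = ((c i).info, (c i).entry) := by
      rw [action_odd ht, actOdd, if_pos]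
      rw [h1]
      exact ⟨hi.2, by omega⟩
    rw [step_of_action ha, h1]
    refine ⟨?_, rfl⟩
    have h3 := P.move_back (X.hm i) (X.rc i).arrow
    rw [← h2] at h3
    exact h3
  · have hnf : ¬ ∃ x ∈ scene S c i, x.1.settled = false := by
      rintro ⟨x, hx, hxs⟩
      obtain ⟨j, hj, -, hp, rfl⟩ := mem_scene.1 hx
      have h4 := h.free j hj ((h.settled j hj).symm.trans hxs)
      exact hib (h2.symm.trans (hp.symm.trans h4.1))
    have hs : (c i).info.settled = true := (h.settled i hi.1).trans hi.2
    have ha : action t G S c i = ((c i).info.commit, none) := by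
      rw [action_odd ht, actOdd, if_neg (by rw [h1]; simp)]
      simp only [hs, if_true, hnf, if_false]
      rw [if_pos (by rw [h1])]
    rw [step_of_action ha]
    refine ⟨h2, ?_⟩
    rw [h1]
    ext <;> simp [Rec.commit, h3, hg.not_probing i hi hib]

/-- A base robot would be recognised by its arrow `0`. Visitors have other arrows, and a robot
waiting at home for the outcome of a probe is at a different node. -/
theorem step_free_of_dead (h : OddRel P S X c hit) (hg : Good P S X) (ht : ¬ Even t)
    (hd : ¬ X.Live S X.base) {i : Fin k} (hi : i ∈ S) (hf : (X.rc i).settled = false) :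
    step P t S c i = ⟨X.base, (c i).info, none⟩ := by
  have h0 := h.info_free hi hf
  obtain ⟨h1, -⟩ := h.free i hi hf
  have hns : ¬ ∃ x ∈ scene S c i, x.1.settled = true ∧ x.1.arrow = 0 := by
    rintro ⟨x, hx, hxs, hxa⟩
    obtain ⟨j, hj, -, hp, rfl⟩ := mem_scene.1 hx
    have hj' : X.At S j := ⟨hj, (h.settled j hj).symm.trans hxs⟩
    have hjb : X.hm j ≠ X.base := fun he => hd ⟨j, hj', he⟩
    have := (Finset.mem_Icc.1 (hg.arrow_mem j hj' hjb)).1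
    obtain ⟨h2, -⟩ | ⟨-, h2, -⟩ := h.off j hj' hjb
    · simp only [h2] at hxa
      omega
    · exact hjb (h2.symm.trans (hp.trans h1))
  have ha : action t G S c i = ((c i).info, none) := by
    rw [action_odd ht, actOdd, if_neg (by rw [h0]; simp)]
    simp only [h0, Bool.false_eq_true, if_false, hns]
  rw [step_of_action ha, h1]
  rfl

variable {b : Fin k}

theorem arrow_base (h : OddRel P S X c hit) (hg : Good P S X) (hb : X.At S b)
    (hbb : X.hm b = X.base) : (c b).info.arrow = 0 := by
  have h1 := (hg.at_base b hb hbb).1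
  rw [(h.base b hb hbb).2] at h1
  exact h1

/-- The base robot takes the epoch and the result of the last probe from any free robot, as they all
agree. It thus evaluates the same `plan` as the free robots, which read its record. -/
theorem step_base (h : OddRel P S X c hit) (hg : Good P S X) (ht : ¬ Even t) (hb : X.At S b)
    (hbb : X.hm b = X.base) (hf : ∃ i ∈ S, (X.rc i).settled = false) :
    step P t S c b = ⟨X.base,
      (plan (G.degree X.base) (X.rc b) X.ep (visible S c X.base)).base, none⟩ := by
  obtain ⟨h1, h2⟩ := h.base b hb hbb
  have h3 := h.arrow_base hg hb hbb
  have hs : (c b).info.settled = true := (h.settled b hb.1).trans hb.2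
  have hex : ∃ x ∈ scene S c b, x.1.settled = false := by
    obtain ⟨i, hi, hf⟩ := hf
    refine ⟨_, mem_scene.2 ⟨i, hi, ?_, ?_, rfl⟩, h.info_free hi hf⟩
    · rintro rfl
      rw [hb.2] at hf
      exact Bool.false_ne_true hf.symm
    · rw [h1, (h.free i hi hf).1]
  obtain ⟨h4, y, h5⟩ := pick_spec (p := fun x => x.settled = false) hex
  obtain ⟨i, hi, -, -, h6⟩ := mem_scene.1 h5
  have h7 : pick (scene S c b) (fun x => x.settled = false) = (c i).info :=
    (congrArg Prod.fst h6).symm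
  have h8 := h.free i hi ((h.settled i hi).symm.trans (h7 ▸ h4))
  have ha : action t G S c b =
      ((plan (G.degree X.base) (X.rc b) X.ep (visible S c X.base)).base, none) := by
    have hn : ¬ ((c b).info.settled = true ∧ (c b).info.arrow ≠ 0) := by simp [h3]
    rw [action_odd ht, actOdd, if_neg hn]
    simp only [filter_scene hn, hs, if_true]
    rw [if_pos hex, h7, h8.2.2.2.1, h8.2.2.2.2, ← h2, h1]
  rw [step_of_action ha, h1]
  rfl

theorem step_free (h : OddRel P S X c hit) (hg : Good P S X) (ht : ¬ Even t) (hb : X.At S b)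
    (hbb : X.hm b = X.base) {i : Fin k} (hi : i ∈ S) (hf : (X.rc i).settled = false) :
    step P t S c i =
      ⟨(P.move X.base (plan (G.degree X.base) (X.rc b) X.ep (visible S c X.base)).exit).1,
      { (c i).info with
        probing := (plan (G.degree X.base) (X.rc b) X.ep (visible S c X.base)).probe
        stamp := (plan (G.degree X.base) (X.rc b) X.ep (visible S c X.base)).epoch },
      (P.move X.base (plan (G.degree X.base) (X.rc b) X.ep (visible S c X.base)).exit).2⟩ := by
  have h0 := h.info_free hi hf
  obtain ⟨h1, h1', h1'', h1e, h1f⟩ := h.free i hi hf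
  obtain ⟨h2, h2'⟩ := h.base b hb hbb
  have h3 := h.arrow_base hg hb hbb
  have hs : (c b).info.settled = true := (h.settled b hb.1).trans hb.2
  have hex : ∃ x ∈ scene S c i, x.1.settled = true ∧ x.1.arrow = 0 := by
    refine ⟨_, mem_scene.2 ⟨b, hb.1, ?_, ?_, rfl⟩, hs, h3⟩
    · rintro rfl
      rw [hb.2] at hf
      exact Bool.false_ne_true hf.symm
    · rw [h1, h2]
  obtain ⟨⟨h4, h4'⟩, y, h5⟩ := pick_spec (p := fun x => x.settled = true ∧ x.arrow = 0) hex
  obtain ⟨j, hj, -, h6', h6⟩ := mem_scene.1 h5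
  have h7 : pick (scene S c i) (fun x => x.settled = true ∧ x.arrow = 0) = (c j).info :=
    (congrArg Prod.fst h6).symm
  have hjA : X.At S j := ⟨hj, (h.settled j hj).symm.trans (h7 ▸ h4)⟩
  have hjb : j = b := by
    by_contra hjb
    have hjb' : X.hm j ≠ X.base := fun he => hjb (hg.hm_inj j b hjA hb (he.trans hbb.symm))
    have := (Finset.mem_Icc.1 (hg.arrow_mem j hjA hjb')).1
    obtain ⟨h8, -⟩ | ⟨-, h8, -⟩ := h.off j hjA hjb'
    · rw [h7, h8] at h4'
      omega
    · exact hjb' (h8.symm.trans (h6'.trans h1))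
  subst hjb
  have ha : action t G S c i = ({ (c i).info with
        probing := (plan (G.degree X.base) (X.rc j) X.ep (visible S c X.base)).probe
        stamp := (plan (G.degree X.base) (X.rc j) X.ep (visible S c X.base)).epoch },
      (plan (G.degree X.base) (X.rc j) X.ep (visible S c X.base)).exit) := by
    have hn : ¬ ((c i).info.settled = true ∧ (c i).info.arrow ≠ 0) := by simp [h0]
    rw [action_odd ht, actOdd, if_neg hn]
    simp only [filter_scene hn]
    rw [if_neg (by rw [h0]; exact Bool.false_ne_true), if_pos hex, h7, h1f, ← h2', h1, h1e]
  rw [step_of_action ha, h1]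

/-- If nobody is away, then the robots that can be seen at the base are the visitors. -/
theorem filter_visible (h : OddRel P S X c hit) (hg : Good P S X) (hb : X.At S b)
    (hbb : X.hm b = X.base) (hd : 1 ≤ G.degree X.base)
    (hn : ¬ ((X.rc b).next ≠ 0 ∧ (X.rc b).next ≤ G.degree X.base)) :
    (S.filter fun i => (c i).pos = X.base ∧ (c i).info.settled = true ∧ (c i).info.arrow ≠ 0) =
      X.visitors S ∧ ∀ i ∈ X.visitors S, (c i).info = X.rc i ∧
        ((c i).pos, (c i).entry) = P.traverse (X.hm i) (X.rc i).arrow := by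
  have hoff : ∀ i, X.At S i → X.hm i ≠ X.base → (c i).info = X.rc i ∧
        ((c i).pos, (c i).entry) = P.traverse (X.hm i) (X.rc i).arrow := by
    intro i hi hib
    refine (h.off i hi hib).resolve_right ?_
    -- If a former base robot were still waiting at home, the new base robot would have its port 1
    -- yet to probe, against `hn`.
    rintro ⟨-, -, -, h1⟩
    obtain ⟨h2, h3⟩ := h1 b hb hbb
    simp [Rec.next, h2, h3] at hn
    omega
  constructor
  · ext i
    rw [mem_visitors, Finset.mem_filter]
    constructor
    · rintro ⟨hi, h1, h2, h3⟩
      have hi' : X.At S i := ⟨hi, (h.settled i hi).symm.trans h2⟩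
      have hib : X.hm i ≠ X.base := fun he => h3 (h.arrow_base hg hi' he)
      obtain ⟨h4, h5⟩ := hoff i hi' hib
      have h6 := congrArg Prod.fst h5
      refine ⟨hi', hib, ?_⟩
      rw [← hg.target_arrow i hi' hib]
      exact h6.symm.trans h1
    · rintro ⟨hi, hib, hp⟩
      obtain ⟨h4, h5⟩ := hoff i hi hib
      have h6 := congrArg Prod.fst h5
      have h7 := (Finset.mem_Icc.1 (hg.arrow_mem i hi hib)).1
      refine ⟨hi.1, h6.trans ((hg.target_arrow i hi hib).trans hp), ?_, ?_⟩
      · rw [h4]; exact hi.2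
      · rw [h4]; omega
  · intro i hi
    rw [mem_visitors] at hi
    exact hoff i hi.1 hi.2.1

end OddRel

theorem one_le_degree (hG : G.Connected) (hn : 2 ≤ n) (v : Fin n) : 1 ≤ G.degree v := by
  have : Nontrivial (Fin n) := Fin.nontrivial_iff_two_le.2 hn
  exact hG.preconnected.degree_pos_of_nontrivial v

end Relations

/-! ### Odd rounds: executing the plan -/

section Rounds

open Classical

variable {n k : ℕ} {G : SimpleGraph (Fin n)} [DecidableRel G.Adj] {P : PortLabelling G}
  {S : Finset (Fin k)} {X Y : Abs n k} {c : Fin k → Rob n} {hit : Bool} {t : ℕ} {b : Fin k}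

namespace OddRel

/-- The record at the base of `Y` is left open, because its robot may learn only in the next round
that it has become the base robot. -/
theorem evenRel_step (h : OddRel P S X c hit) (hg : Good P S X) (ht : ¬ Even t) (hb : X.At S b)
    (hbb : X.hm b = X.base) (hf : ∃ i ∈ S, (X.rc i).settled = false) {d : Plan}
    (hd : plan (G.degree X.base) (X.rc b) X.ep (visible S c X.base) = d)
    (hds : d.base.settled = true) (hset : ∀ i ∈ S, (Y.rc i).settled = (X.rc i).settled)
    (hhm : Y.hm = X.hm) (hep : Y.ep = d.epoch) (hYb : X.base ≠ Y.base → Y.rc b = d.base)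
    (hY : ∀ i, X.At S i → X.hm i ≠ X.base → X.hm i ≠ Y.base → Y.rc i = X.rc i) :
    EvenRel S Y (step P t S c) (P.move X.base d.exit).1 (P.move X.base d.exit).2 d.probe hit := by
  have huniq : ∀ i, X.At S i → X.hm i = X.base → i = b := fun b' h1 h2 =>
    hg.hm_inj b' b h1 hb (h2.trans hbb.symm)
  refine ⟨?_, ?_, ?_, ?_⟩
  · intro i hi
    rw [hset i hi]
    by_cases hs : (X.rc i).settled = true
    · by_cases hib : X.hm i = X.base
      · rw [huniq i ⟨hi, hs⟩ hib, h.step_base hg ht hb hbb hf, hd]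
        exact hds.trans hb.2.symm
      · rw [(h.step_off hg ht ⟨hi, hs⟩ hib).2]
    · rw [Bool.not_eq_true] at hs
      rw [h.step_free hg ht hb hbb hi hs]
      exact h.settled i hi
  · intro i hi hs
    rw [hset i hi] at hs
    obtain ⟨h1, h2, h3, h4, h5⟩ := h.free i hi hs
    rw [h.step_free hg ht hb hbb hi hs, hd, hep]
    exact ⟨rfl, rfl, h2, rfl, rfl, h5⟩
  · intro i hi
    have hi' : X.At S i := ⟨hi.1, (hset i hi.1).symm.trans hi.2⟩
    rw [hhm]
    by_cases hib : X.hm i = X.base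
    · rw [huniq i hi' hib, h.step_base hg ht hb hbb hf, hbb]
    · exact (h.step_off hg ht hi' hib).1
  · intro i hi hiY
    have hi' : X.At S i := ⟨hi.1, (hset i hi.1).symm.trans hi.2⟩
    rw [hhm] at hiY
    by_cases hib : X.hm i = X.base
    · rw [hib] at hiY
      rw [huniq i hi' hib, h.step_base hg ht hb hbb hf, hYb hiY, hd]
    · rw [(h.step_off hg ht hi' hib).2, hY i hi' hib hiY]

theorem far_step (h : OddRel P S X c hit) (hg : Good P S X) (ht : ¬ Even t) (hb : X.At S b)
    (hbb : X.hm b = X.base) (hf : ∃ i ∈ S, (X.rc i).settled = false) {p : ℕ}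
    (hp : p ∈ Finset.Icc 1 (G.degree X.base)) {r : Rec} (hs : r.settled = true) (hrp : r.port = p)
    (hpr : r.probing = false) (hfl : r.flag = true)
    (hd : plan (G.degree X.base) (X.rc b) X.ep (visible S c X.base) =
      ⟨{ r with probing := true }, some p, true, X.ep⟩) :
    FarRel P S { X with rc := Function.update X.rc b r } (step P t S c) := by
  obtain ⟨q, -, -, h1, h2⟩ := P.traverse_of_mem hp
  refine ⟨p, q, hit, ?_, hp, h2, ?_⟩
  · have h3 := h.evenRel_step (Y := { X with rc := Function.update X.rc b r }) hg ht hb hbb hf hd hs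
      (by
        intro i _
        by_cases hi : i = b
        · subst hi; simp [hs, hb.2]
        · simp [hi])
      rfl rfl (fun h => absurd rfl h) (by
        intro i _ h3 _
        have : i ≠ b := by rintro rfl; exact h3 hbb
        simp [this])
    have h4 : P.move X.base (some p) = (P.target X.base p, some q) := h1
    rw [h4] at h3
    exact h3
  · intro i hi hib
    have hi' : X.At S i := by
      refine ⟨hi.1, ?_⟩
      by_cases hib : i = b
      · rw [hib]; exact hb.2
      · have := hi.2
        simpa [hib] using this
    obtain rfl : i = b := hg.hm_inj i b hi' hb (hib.trans hbb.symm)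
    rw [h.step_base hg ht hb hbb hf, hd]
    simp [hrp, hpr, hfl]

theorem mem_portsOf (h : OddRel P S X c hit) (hg : Good P S X) (hb : X.At S b)
    (hbb : X.hm b = X.base) (hd : 1 ≤ G.degree X.base)
    (hn : ¬ ((X.rc b).next ≠ 0 ∧ (X.rc b).next ≤ G.degree X.base)) {p : Rec → Prop} {q : ℕ} :
    q ∈ portsOf (visible S c X.base) p ↔ ∃ j ∈ X.visitors S, p (X.rc j) ∧ (c j).entry = some q := by
  obtain ⟨h1, h2⟩ := h.filter_visible hg hb hbb hd hn
  simp only [portsOf, visible, h1, Set.mem_ofPred_eq, Multiset.mem_map, Finset.mem_val]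
  constructor
  · rintro ⟨_, ⟨j, hj, rfl⟩, h3, h4⟩
    rw [(h2 j hj).1] at h3
    exact ⟨j, hj, h3, h4⟩
  · rintro ⟨j, hj, h3, h4⟩
    rw [← (h2 j hj).1] at h3
    exact ⟨_, ⟨j, hj, rfl⟩, h3, h4⟩

/-- A visitor has entered through the port that leads to its home. -/
theorem entry_visitor (h : OddRel P S X c hit) (hg : Good P S X) (hb : X.At S b)
    (hbb : X.hm b = X.base) (hd : 1 ≤ G.degree X.base)
    (hn : ¬ ((X.rc b).next ≠ 0 ∧ (X.rc b).next ≤ G.degree X.base)) {j : Fin k}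
    (hj : j ∈ X.visitors S) : ∃ q ∈ Finset.Icc 1 (G.degree X.base), (c j).entry = some q ∧
      P.target X.base q = X.hm j := by
  have h1 := ((h.filter_visible hg hb hbb hd hn).2 j hj).2
  obtain ⟨hjA, hjb, hjp⟩ := mem_visitors.1 hj
  obtain ⟨q, h2, -, h3, h4⟩ := P.traverse_of_mem (hg.arrow_mem j hjA hjb)
  rw [hg.target_arrow j hjA hjb, hjp] at h2 h3 h4
  rw [h3] at h1
  exact ⟨q, h2, congrArg Prod.snd h1, congrArg Prod.fst h4⟩

/-- `plan` ends the scan and directs the walk in a single update; abstractly this is `Good.complete`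
followed by `Good.walk`. -/
theorem walk_step (h : OddRel P S X c hit) (hg : Good P S X) (ht : ¬ Even t) (hb : X.At S b)
    (hbb : X.hm b = X.base) (hd : 1 ≤ G.degree X.base)
    (hf : ∃ i ∈ S, (X.rc i).settled = false)
    (hn : ¬ ((X.rc b).next ≠ 0 ∧ (X.rc b).next ≤ G.degree X.base)) {p : Rec → Prop} {fl : Bool}
    (hne : (portsOf (visible S c X.base) p).Nonempty)
    (hp : ∀ j ∈ X.visitors S, p (X.rc j) → fl = true ∧ (X.rc j).stamp ≠ X.ep ∨ fl = false ∧
      (X.rc j).stamp = X.ep ∧ (X.rc j).flag = true ∧ (X.rc b).count ≤ (X.visitors S).card ∧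
      ∀ i ∈ X.visitors S, (X.rc i).stamp = X.ep)
    (hpl : plan (G.degree X.base) (X.rc b) X.ep (visible S c X.base) =
      ⟨{ X.rc b with
          port := 0, probing := false, arrow := sInf (portsOf (visible S c X.base) p)
          count := (X.rc b).count - 1, flag := fl },
        some (sInf (portsOf (visible S c X.base) p)), false, X.ep⟩) :
    ∃ Y, Good P S Y ∧ pot P S Y + 1 ≤ pot P S X ∧ NearRel S Y (step P t S c) := by
  obtain ⟨j, hj, hpj, hqj⟩ := (h.mem_portsOf hg hb hbb hd hn).1 (Nat.sInf_mem hne)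
  set q := sInf (portsOf (visible S c X.base) p) with hq
  obtain ⟨q', hq1, hq2, hq3⟩ := h.entry_visitor hg hb hbb hd hn hj
  obtain rfl : q = q' := Option.some.inj (hqj.symm.trans hq2)
  obtain ⟨hjA, hjb, hjp⟩ := mem_visitors.1 hj
  have hbj : b ≠ j := by rintro rfl; exact hjb hbb
  set r₁ : Rec := { X.rc b with port := 0, probing := false } with hr₁
  set X₁ : Abs n k := { X with rc := Function.update X.rc b r₁ } with hX₁
  obtain ⟨hg₁, hpot₁⟩ := hg.complete hb hbb hn hr₁
  have hb₁ : X₁.rc b = r₁ := by simp [hX₁]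
  have hi₁ : ∀ i, i ≠ b → X₁.rc i = X.rc i := fun i hi => by simp [hX₁, hi]
  have hset₁ : ∀ i, (X₁.rc i).settled = (X.rc i).settled := by
    intro i
    by_cases hi : i = b
    · rw [hi, hb₁, hr₁]
    · rw [hi₁ i hi]
  have hat₁ : ∀ i, X₁.At S i ↔ X.At S i := fun i => by rw [Abs.At, hset₁, Abs.At]
  have hvis : X₁.visitors S = X.visitors S := by
    ext i
    rw [mem_visitors, mem_visitors, hat₁]
  have hj₁ : X₁.rc j = X.rc j := hi₁ j hbj.symm
  have hvne : ∀ i ∈ X.visitors S, i ≠ b := by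
    rintro i hi rfl
    exact (mem_visitors.1 hi).2.1 hbb
  obtain ⟨hgY, hpotY⟩ := hg₁.walk (b := b) (j := j) (q := q) (fl := fl) ((hat₁ b).2 hb) hbb
    (by rw [hb₁]) (hvis ▸ hj) hq1 hq3 (by
      rw [hj₁, hb₁, hvis]
      refine (hp j hj hpj).imp _root_.id ?_
      rintro ⟨h1, h2, h3, h4, h5⟩
      refine ⟨h1, h2, h3, h4, fun i hi => ?_⟩
      rw [hi₁ i (hvne i hi)]
      exact h5 i hi) rfl rfl
  refine ⟨_, hgY, by omega, ?_⟩
  have hlast : (step P t S c j).info = X.rc j := (h.step_off hg ht hjA hjb).2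
  refine ⟨some (X.rc j).arrow, hit, ?_, ?_⟩
  · have h3 := h.evenRel_step (Y := { X₁ with
      rc := Function.update (Function.update X₁.rc b { X₁.rc b with
        arrow := q, count := (X₁.rc b).count - 1, flag := fl }) j ((X₁.rc j).arrive X₁.ep)
      base := X₁.hm j
      par := Function.update X₁.par X₁.base (X₁.hm j) }) hg ht hb hbb hf hpl hb.2 (by
        intro i _
        by_cases h1 : i = j
        · subst h1
          simp [Rec.arrive, hset₁]
        · by_cases h2 : i = b
          · subst h2
            simp [h1, hset₁]
          · simp [h1, h2, hset₁]) rfl rfl (by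
        intro _
        simp only [Function.update_of_ne hbj, Function.update_self, hb₁, hr₁]) (by
        intro i hi h1 h2
        have h3 : i ≠ b := by rintro rfl; exact h1 hbb
        have h4 : i ≠ j := by rintro rfl; exact h2 rfl
        simp only [Function.update_of_ne h3, Function.update_of_ne h4, hi₁ i h3])
    -- Leaving through the visitor's entry port, the free robots enter its home through the port
    -- that is its arrow.
    have h4 : P.move X.base (some q) = (X.hm j, some (X.rc j).arrow) := by
      obtain ⟨q'', -, -, h5, h6⟩ := P.traverse_of_mem hq1
      rw [hq3] at h5 h6
      have h7 : P.traverse (X.hm j) (X.rc j).arrow =  ((c j).pos, (c j).entry) :=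
        ((h.filter_visible hg hb hbb hd hn).2 j hj).2.symm
      obtain ⟨q₃, h8, -, h9, h10⟩ := P.traverse_of_mem (hg.arrow_mem j hjA hjb)
      rw [hg.target_arrow j hjA hjb, hjp] at h9 h10
      rw [h9] at h7
      have h11 : q₃ = q := Option.some.inj ((congrArg Prod.snd h7).trans hqj)
      rw [h11] at h10
      exact h10
    rw [h4] at h3
    exact h3
  · intro i hi hib
    have hij : i = j := by
      by_contra hij
      have hi' : X.At S i := by
        refine ⟨hi.1, ?_⟩
        have := hi.2
        by_cases h2 : i = b
        · rw [h2]; exact hb.2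
        · simpa [hij, h2] using this
      exact hij (hg.hm_inj i j hi' hjA hib)
    subst hij
    have harr := (Finset.mem_Icc.1 (hg.arrow_mem i hjA hjb)).1
    simp only [Function.update_self]
    -- The robot `j` is home again with its old record; it notices the free robots only in the
    -- coming even round.
    refine ⟨?_, Or.inr ⟨?_, ?_⟩⟩
    · rw [Function.update_of_ne hbj.symm]; exact hg.not_probing i hjA hjb
    · rw [hlast]; omega
    · rw [hlast, Function.update_of_ne hbj.symm]

/-- What happens in an odd round. -/
theorem next_state (h : OddRel P S X c hit) (hg : Good P S X) (hG : G.Connected) (hk : 2 ≤ k)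
    (hkn : k ≤ n) (ht : ¬ Even t) (hf : ∃ i ∈ S, (X.rc i).settled = false) :
    ∃ Y, Good P S Y ∧ pot P S Y ≤ pot P S X ∧
      (NearRel S Y (step P t S c) ∧ (pot P S Y + 1 ≤ pot P S X ∨ ¬ Y.Live S Y.base) ∨
        FarRel P S Y (step P t S c) ∧ Y.Live S Y.base) := by
  have hd := one_le_degree hG (hk.trans hkn) X.base
  by_cases hl : X.Live S X.base
  swap
  · refine ⟨X, hg, le_rfl, Or.inl ⟨⟨none, hit, ⟨?_, ?_, ?_, ?_⟩, ?_⟩, Or.inr hl⟩⟩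
    · intro i hi
      by_cases hs : (X.rc i).settled = true
      · rw [(h.step_off hg ht ⟨hi, hs⟩ fun he => hl ⟨i, ⟨hi, hs⟩, he⟩).2]
      · rw [Bool.not_eq_true] at hs
        rw [h.step_free_of_dead hg ht hl hi hs]
        exact h.settled i hi
    · intro i hi hs
      rw [h.step_free_of_dead hg ht hl hi hs]
      exact ⟨rfl, rfl, (h.free i hi hs).2⟩
    · exact fun i hi => (h.step_off hg ht hi fun he => hl ⟨i, hi, he⟩).1
    · exact fun i hi hib => (h.step_off hg ht hi hib).2
    · exact fun i hi he => absurd ⟨i, hi, he⟩ hl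
  obtain ⟨b, hb, hbb⟩ := hl
  by_cases hn : (X.rc b).next ≠ 0 ∧ (X.rc b).next ≤ G.degree X.base
  · obtain ⟨h1, h2⟩ := hg.advance hb hbb hn.1 hn.2 rfl
    refine ⟨_, h1, h2, Or.inr ⟨?_, b, ⟨hb.1, ?_⟩, hbb⟩⟩
    · refine h.far_step hg ht hb hbb hf (p := (X.rc b).next)
        (Finset.mem_Icc.2 ⟨Nat.one_le_iff_ne_zero.2 hn.1, hn.2⟩) hb.2 rfl rfl rfl ?_
      rw [plan, if_pos hn]
    · simpa using hb.2
  have hvis := (h.filter_visible hg hb hbb hd hn).1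
  have hcard : Multiset.card (visible S c X.base) = (X.visitors S).card := by
    rw [visible, Multiset.card_map, hvis]
    rfl
  set r₁ : Rec := { X.rc b with port := 0, probing := false } with hr₁
  set X₁ : Abs n k := { X with rc := Function.update X.rc b r₁ } with hX₁
  obtain ⟨hg₁, hpot₁⟩ := hg.complete hb hbb hn hr₁
  have hb₁ : X₁.rc b = r₁ := by simp [hX₁]
  have hi₁ : ∀ i, i ≠ b → X₁.rc i = X.rc i := fun i hi => by simp [hX₁, hi]
  have hset₁ : ∀ i, (X₁.rc i).settled = (X.rc i).settled := by
    intro i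
    by_cases hi : i = b
    · rw [hi, hb₁, hr₁]
    · rw [hi₁ i hi]
  have hat₁ : ∀ i, X₁.At S i ↔ X.At S i := fun i => by rw [Abs.At, hset₁, Abs.At]
  have hvis₁ : X₁.visitors S = X.visitors S := by
    ext i
    rw [mem_visitors, mem_visitors, hat₁]
  by_cases hV : Multiset.card (visible S c X.base) < (X.rc b).count
  · obtain ⟨h1, h2⟩ := hg₁.restart (b := b) ((hat₁ b).2 hb) hbb (by rw [hb₁]) hd
      (by rw [hvis₁, hb₁, ← hcard]; exact hV) rfl
    have he : ∀ r, Function.update X₁.rc b r = Function.update X.rc b r := fun r =>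
      Function.update_idem _ _ _
    refine ⟨_, h1, h2.trans hpot₁, Or.inr ⟨?_, b, ⟨hb.1, ?_⟩, hbb⟩⟩
    · rw [he]
      refine h.far_step hg ht hb hbb hf (p := 1) (Finset.mem_Icc.2 ⟨le_rfl, hd⟩) ?_ rfl rfl rfl ?_
      · rw [hb₁]; exact hb.2
      · rw [plan, if_neg hn, if_pos hV, hb₁]
    · simp only [Function.update_self]; exact hb.2
  by_cases hA : (portsOf (visible S c X.base) fun r => r.stamp ≠ X.ep).Nonempty
  · obtain ⟨Y, h1, h2, h3⟩ := h.walk_step hg ht hb hbb hd hf hn (fl := true) hA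
      (fun j hj hpj => Or.inl ⟨rfl, hpj⟩) (by rw [plan, if_neg hn, if_neg hV, if_pos hA])
    exact ⟨Y, h1, by omega, Or.inl ⟨h3, Or.inl h2⟩⟩
  have hstamp : ∀ i ∈ X.visitors S, (X.rc i).stamp = X.ep := by
    intro i hi
    by_contra hst
    obtain ⟨q, -, hq, -⟩ := h.entry_visitor hg hb hbb hd hn hi
    exact hA ⟨q, (h.mem_portsOf hg hb hbb hd hn).2 ⟨i, hi, hst, hq⟩⟩
  have hcount : (X.rc b).count ≤ (X.visitors S).card := by omega
  by_cases hB : (portsOf (visible S c X.base) fun r => r.stamp = X.ep ∧ r.flag = true).Nonempty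
  · obtain ⟨Y, h1, h2, h3⟩ := h.walk_step hg ht hb hbb hd hf hn (fl := false) hB
      (fun j hj hpj => Or.inr ⟨rfl, hpj.1, hpj.2, hcount, hstamp⟩)
      (by rw [plan, if_neg hn, if_neg hV, if_neg hA, if_pos hB])
    exact ⟨Y, h1, by omega, Or.inl ⟨h3, Or.inl h2⟩⟩
  have hclosed : ∀ i ∈ X.visitors S, (X.rc i).stamp = X.ep ∧ (X.rc i).flag = false := by
    intro i hi
    refine ⟨hstamp i hi, ?_⟩
    rw [← Bool.not_eq_true]
    intro hfl
    obtain ⟨q, -, hq, -⟩ := h.entry_visitor hg hb hbb hd hn hi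
    exact hB ⟨q, (h.mem_portsOf hg hb hbb hd hn).2 ⟨i, hi, ⟨hstamp i hi, hfl⟩, hq⟩⟩
  have hvne : ∀ i ∈ X.visitors S, i ≠ b := by
    rintro i hi rfl
    exact (mem_visitors.1 hi).2.1 hbb
  -- All children have reported and are closed, so the search of this epoch has ended.
  have hhurt : X₁.hurt := hg₁.hurt_of_visited hG hkn (b := b) ((hat₁ b).2 hb) hbb (by rw [hb₁])
    (by
      obtain ⟨i, hi, hs⟩ := hf
      exact ⟨i, hi, (hset₁ i).trans hs⟩)
    (by rw [hvis₁, hb₁]; exact hcount) (by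
      intro i hi
      rw [hvis₁] at hi
      rw [hi₁ i (hvne i hi)]
      exact hclosed i hi)
  have hpl : plan (G.degree X.base) (X.rc b) X.ep (visible S c X.base) =
      ⟨{ X.rc b with port := 0, probing := false, stamp := X.ep + 1 }, none, false, X.ep + 1⟩ := by
    rw [plan, if_neg hn, if_neg hV, if_neg hA, if_neg hB]
  obtain ⟨h1, h2⟩ := hg₁.newEpoch (b := b) ((hat₁ b).2 hb) hbb hhurt rfl rfl
  refine ⟨_, h1, by omega, Or.inl ⟨⟨none, hit, ?_, ?_⟩, Or.inl (by omega)⟩⟩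
  · refine h.evenRel_step hg ht hb hbb hf hpl hb.2 ?_ rfl rfl (fun h => absurd rfl h) ?_
    · intro i _
      by_cases h2 : i = b
      · subst h2
        simp only [Function.update_self]
        rfl
      · simp only [Function.update_of_ne h2]
    · intro i _ h3 _
      have h4 : i ≠ b := by rintro rfl; exact h3 hbb
      simp only [Function.update_of_ne h4]
  · intro i hi hib
    have hi' : X.At S i := by
      refine ⟨hi.1, ?_⟩
      have := hi.2
      by_cases h2 : i = b
      · rw [h2]; exact hb.2
      · simpa [h2] using this
    obtain rfl : i = b := hg.hm_inj i b hi' hb (hib.trans hbb.symm)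
    rw [h.step_base hg ht hb hbb hf, hpl]
    simp [hr₁]

end OddRel

end Rounds

/-! ### Even rounds: arriving, probing and settling -/

section Rounds

open Classical

variable {n k : ℕ} {G : SimpleGraph (Fin n)} [DecidableRel G.Adj] {P : PortLabelling G}
  {S : Finset (Fin k)} {X Y : Abs n k} {c : Fin k → Rob n} {hit out : Bool} {t : ℕ} {y : Fin n}
  {e : Option ℕ}

namespace EvenRel

/-- Settled robots stay at home only for free robots that have come to stay. Those on a probe do not
delay them, hence the alternative `out = true`. -/
theorem step_off (h : EvenRel S X c y e out hit) (hg : Good P S X) (ht : Even t) {i : Fin k}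
    (hi : X.At S i) (hib : X.hm i ≠ X.base) (hy : X.hm i ≠ y ∨ out = true) :
    (step P t S c i).info = X.rc i ∧ ((step P t S c i).pos, (step P t S c i).entry) =
      P.traverse (X.hm i) (X.rc i).arrow := by
  have harr := (Finset.mem_Icc.1 (hg.arrow_mem i hi hib)).1
  have hnf : ¬ ∃ x ∈ scene S c i, x.1.settled = false ∧ x.1.probing = false := by
    rintro ⟨x, hx, hxs, hxp⟩
    obtain ⟨j, hj, -, hp, rfl⟩ := mem_scene.1 hx
    obtain ⟨h1, -, -, h2, -⟩ := h.free j hj ((h.settled j hj).symm.trans hxs)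
    rcases hy with hy | hy
    · exact hy ((h.home i hi).symm.trans (hp.symm.trans h1))
    · rw [hy] at h2
      exact Bool.false_ne_true (hxp.symm.trans h2)
  have h1 := h.off i hi hib
  have ha : action t G S c i = (X.rc i, some (X.rc i).arrow) := by
    rw [action_even ht, actEven, h1, if_pos hi.2, if_neg (by omega), if_neg hnf]
  rw [step_of_action ha, h.home i hi]
  exact ⟨rfl, rfl⟩

theorem step_stay (h : EvenRel S X c y e out hit) (ht : Even t) {i : Fin k} (hi : X.At S i)
    (ha : (c i).info.arrow = 0) : step P t S c i = ⟨X.hm i, (c i).info, none⟩ := by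
  have hs : (c i).info.settled = true := (h.settled i hi.1).trans hi.2
  have ha : action t G S c i = ((c i).info, none) := by
    rw [action_even ht, actEven, if_pos hs, if_pos ha]
  rw [step_of_action ha, h.home i hi]
  rfl

theorem step_arrive (h : EvenRel S X c y e false hit) (ht : Even t) {i : Fin k} (hi : X.At S i)
    (hy : X.hm i = y) (ha : (c i).info.arrow ≠ 0) (hf : ∃ i ∈ S, (X.rc i).settled = false) :
    step P t S c i = ⟨X.hm i, (c i).info.arrive X.ep, none⟩ := by
  have hs : (c i).info.settled = true := (h.settled i hi.1).trans hi.2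
  have hex : ∃ x ∈ scene S c i, x.1.settled = false ∧ x.1.probing = false := by
    obtain ⟨j, hj, hjf⟩ := hf
    obtain ⟨h1, -, -, h2, -⟩ := h.free j hj hjf
    refine ⟨_, mem_scene.2 ⟨j, hj, ?_, ?_, rfl⟩, (h.settled j hj).trans hjf, h2⟩
    · rintro rfl
      rw [hi.2] at hjf
      exact Bool.false_ne_true hjf.symm
    · rw [h1, h.home i hi, hy]
  obtain ⟨h4, z, h5⟩ := pick_spec (V := scene S c i) (p := fun x => x.settled = false)
    (by obtain ⟨x, hx, hx', -⟩ := hex; exact ⟨x, hx, hx'⟩)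
  obtain ⟨j, hj, -, -, h6⟩ := mem_scene.1 h5
  have h7 : pick (scene S c i) (fun x => x.settled = false) = (c j).info :=
    (congrArg Prod.fst h6).symm
  have h8 := h.free j hj ((h.settled j hj).symm.trans (h7 ▸ h4))
  have ha : action t G S c i = ((c i).info.arrive X.ep, none) := by
    rw [action_even ht, actEven, if_pos hs, if_neg ha, if_pos hex, h7, h8.2.2.2.2.1]
  rw [step_of_action ha, h.home i hi]
  rfl

/-- A free robot that meets settled robots learns whether an arrow leads back. -/
theorem step_free (h : EvenRel S X c y e out hit) (ht : Even t) (hl : X.Live S y) {i : Fin k}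
    (hi : i ∈ S) (hf : (X.rc i).settled = false) :
    step P t S c i = ⟨(P.move y (if out = true then e else none)).1,
      { (c i).info with
        probing := false
        flag := decide (∃ j, X.At S j ∧ X.hm j = y ∧ e = some (c j).info.arrow) },
      (P.move y (if out = true then e else none)).2⟩ := by
  obtain ⟨h1, h2, -, h3, -⟩ := h.free i hi hf
  have h0 : (c i).info.settled = false := (h.settled i hi).trans hf
  have hmem : ∀ j, X.At S j → X.hm j = y → ((c j).info, (c j).entry) ∈ scene S c i := by
    intro j hj hjy
    refine mem_scene.2 ⟨j, hj.1, ?_, ?_, rfl⟩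
    · rintro rfl
      rw [hj.2] at hf
      exact Bool.false_ne_true hf.symm
    · rw [h.home j hj, hjy, h1]
  have hset : ∀ j, X.At S j → (c j).info.settled = true := fun j hj =>
    (h.settled j hj.1).trans hj.2
  have hex : ∃ x ∈ scene S c i, x.1.settled = true := by
    obtain ⟨j, hj, hjy⟩ := hl
    exact ⟨_, hmem j hj hjy, hset j hj⟩
  have hiff : (∃ x ∈ scene S c i, x.1.settled = true ∧ e = some x.1.arrow) ↔
      ∃ j, X.At S j ∧ X.hm j = y ∧ e = some (c j).info.arrow := by
    constructor
    · rintro ⟨x, hx, hxs, hxe⟩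
      obtain ⟨j, hj, -, hp, rfl⟩ := mem_scene.1 hx
      have hj' : X.At S j := ⟨hj, (h.settled j hj).symm.trans hxs⟩
      exact ⟨j, hj', (h.home j hj').symm.trans (hp.trans h1), hxe⟩
    · rintro ⟨j, hj, hjy, hje⟩
      exact ⟨_, hmem j hj hjy, hset j hj, hje⟩
  have ha : action t G S c i = ({ (c i).info with
        probing := false
        flag := decide (∃ j, X.At S j ∧ X.hm j = y ∧ e = some (c j).info.arrow) },
      if out = true then e else none) := by
    rw [action_even ht, actEven, if_neg (by rw [h0]; exact Bool.false_ne_true), if_pos hex, h2, h3]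
    simp only [hiff]
  rw [step_of_action ha, h1]

/-- If no settled robot is met, then the free robot with the smallest ID settles. -/
theorem step_settle (h : EvenRel S X c y e out hit) (ht : Even t) (hl : ¬ X.Live S y)
    (hf : ∃ i ∈ S, (X.rc i).settled = false) :
    ∃ i₀ ∈ S, (X.rc i₀).settled = false ∧ step P t S c i₀ = ⟨y, (c i₀).info.fresh, none⟩ ∧
      ∀ i ∈ S, (X.rc i).settled = false → i ≠ i₀ →
        step P t S c i = ⟨y, { (c i).info with probing := false }, none⟩ := by
  have hne : (S.filter fun i => (X.rc i).settled = false).Nonempty := by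
    obtain ⟨i, hi, hif⟩ := hf
    exact ⟨i, Finset.mem_filter.2 ⟨hi, hif⟩⟩
  obtain ⟨hi₀, hf₀⟩ := Finset.mem_filter.1 (Finset.min'_mem _ hne)
  have hmin : ∀ i ∈ S, (X.rc i).settled = false →
      (S.filter fun i => (X.rc i).settled = false).min' hne ≤ i :=
    fun i hi hif => Finset.min'_le _ _ (Finset.mem_filter.2 ⟨hi, hif⟩)
  set i₀ := (S.filter fun i => (X.rc i).settled = false).min' hne
  have hns : ∀ i ∈ S, (X.rc i).settled = false →
      ¬ ∃ x ∈ scene S c i, x.1.settled = true := by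
    rintro i hi hif ⟨x, hx, hxs⟩
    obtain ⟨j, hj, -, hp, rfl⟩ := mem_scene.1 hx
    have hj' : X.At S j := ⟨hj, (h.settled j hj).symm.trans hxs⟩
    exact hl ⟨j, hj', (h.home j hj').symm.trans (hp.trans (h.free i hi hif).1)⟩
  have hset : ∀ i ∈ S, (X.rc i).settled = false → ¬ (c i).info.settled = true := by
    intro i hi hif
    rw [h.settled i hi, hif]
    exact Bool.false_ne_true
  refine ⟨i₀, hi₀, hf₀, ?_, ?_⟩
  · have ha : action t G S c i₀ = ((c i₀).info.fresh, none) := by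
      rw [action_even ht, actEven, if_neg (hset i₀ hi₀ hf₀), if_neg (hns i₀ hi₀ hf₀), if_pos]
      intro x hx
      have hxs : ¬ x.1.settled = true := fun hxs => hns i₀ hi₀ hf₀ ⟨x, hx, hxs⟩
      obtain ⟨j, hj, -, -, rfl⟩ := mem_scene.1 hx
      have hjf : (X.rc j).settled = false := by
        rw [← h.settled j hj]
        simpa using hxs
      simp only [(h.free i₀ hi₀ hf₀).2.2.1, (h.free j hj hjf).2.2.1]
      exact Nat.succ_le_succ (hmin j hj hjf)
    rw [step_of_action ha, (h.free i₀ hi₀ hf₀).1]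
    rfl
  · intro i hi hif hne
    have ha : action t G S c i = ({ (c i).info with probing := false }, none) := by
      rw [action_even ht, actEven, if_neg (hset i hi hif), if_neg (hns i hi hif), if_neg]
      intro hall
      have h1 := hall _ (mem_scene.2 ⟨i₀, hi₀, hne.symm, ?_, rfl⟩)
      · simp only [(h.free i₀ hi₀ hf₀).2.2.1, (h.free i hi hif).2.2.1] at h1
        exact hne (le_antisymm (Fin.le_def.2 (by omega)) (hmin i hi hif))
      · rw [(h.free i₀ hi₀ hf₀).1, (h.free i hi hif).1]
    rw [step_of_action ha, (h.free i hi hif).1]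
    rfl

end EvenRel

/-- If the base robot is alive, the actual records merely catch up with `X`; the flag that the free
robots compute has no effect, since the base robot is not probing. If it is dead, a free robot
replaces it. -/
theorem NearRel.next_state (h : NearRel S X c) (hg : Good P S X) (hG : G.Connected) (hk : 2 ≤ k)
    (hkn : k ≤ n) (ht : Even t) (hf : ∃ i ∈ S, (X.rc i).settled = false) :
    ∃ Y hit, Good P S Y ∧ OddRel P S Y (step P t S c) hit ∧ pot P S Y ≤ pot P S X ∧
      (¬ X.Live S X.base → pot P S Y + 1 ≤ pot P S X) := by
  obtain ⟨e, hit, h1, h2⟩ := h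
  by_cases hl : X.Live S X.base
  · refine ⟨X, decide (∃ j, X.At S j ∧ X.hm j = X.base ∧ e = some (c j).info.arrow), hg,
      ⟨?_, ?_, ?_, ?_⟩, le_rfl, fun h => absurd hl h⟩
    · intro i hi
      by_cases hs : (X.rc i).settled = true
      · by_cases hib : X.hm i = X.base
        · obtain ⟨-, h3 | ⟨h3, h4⟩⟩ := h2 i ⟨hi, hs⟩ hib
          · rw [h1.step_stay ht ⟨hi, hs⟩ (by rw [h3]; exact (hg.at_base i ⟨hi, hs⟩ hib).1), h3]
          · rw [h1.step_arrive ht ⟨hi, hs⟩ hib h3 hf, h4]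
        · rw [(h1.step_off hg ht ⟨hi, hs⟩ hib (Or.inl hib)).1]
      · rw [Bool.not_eq_true] at hs
        rw [h1.step_free ht hl hi hs]
        exact h1.settled i hi
    · intro i hi hs
      rw [h1.step_free ht hl hi hs]
      obtain ⟨h3, h4, h5, h6, h7, h8⟩ := h1.free i hi hs
      exact ⟨rfl, h5, rfl, h7, rfl⟩
    · intro i hi hib
      obtain ⟨h0, h3⟩ := h2 i hi hib
      have h4 : step P t S c i = ⟨X.hm i, X.rc i, none⟩ := by
        obtain h3 | ⟨h3, h4⟩ := h3
        · rw [h1.step_stay ht hi (by rw [h3]; exact (hg.at_base i hi hib).1), h3]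
        · rw [h1.step_arrive ht hi hib h3 hf, h4]
      rw [h4]
      refine ⟨hib, ?_⟩
      ext <;> simp [Rec.absorb, h0]
    · intro i hi hib
      exact Or.inl (h1.step_off hg ht hi hib (Or.inl hib))
  · obtain ⟨i₀, hi₀, hf₀, h3, h4⟩ := h1.step_settle (P := P) ht hl hf
    have h5 := h1.free i₀ hi₀ hf₀
    obtain ⟨hgY, hpot⟩ := hg.settleHere hl hi₀ hf₀ (r := (c i₀).info.fresh) rfl rfl rfl rfl rfl
      h5.2.2.2.2.1 (one_le_degree hG (hk.trans hkn) X.base) rfl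
    have hne : ∀ i, X.At S i → i ≠ i₀ := by
      rintro i hi rfl
      exact Bool.false_ne_true (hf₀.symm.trans hi.2)
    have hoff : ∀ i, X.At S i → X.hm i ≠ X.base := fun i hi he => hl ⟨i, hi, he⟩
    have hcases : ∀ i, Abs.At { X with
        rc := Function.update X.rc i₀ (c i₀).info.fresh
        hm := Function.update X.hm i₀ X.base } S i → i ≠ i₀ → X.At S i := by
      intro i hi hii
      refine ⟨hi.1, ?_⟩
      have := hi.2
      simpa [hii] using this
    refine ⟨_, hit, hgY, ⟨?_, ?_, ?_, ?_⟩, by omega, fun _ => hpot⟩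
    · intro i hi
      by_cases hii : i = i₀
      · subst hii
        rw [h3]
        simp
      · simp only [Function.update_of_ne hii]
        by_cases hs : (X.rc i).settled = true
        · rw [(h1.step_off hg ht ⟨hi, hs⟩ (hoff i ⟨hi, hs⟩) (Or.inl (hoff i ⟨hi, hs⟩))).1]
        · rw [Bool.not_eq_true] at hs
          rw [h4 i hi hs hii]
          exact h1.settled i hi
    · intro i hi hs
      have hii : i ≠ i₀ := by
        rintro rfl
        simp [Rec.fresh] at hs
      simp only [Function.update_of_ne hii] at hs
      rw [h4 i hi hs hii]
      obtain ⟨h6, h7, h8, h9, h10, h11⟩ := h1.free i hi hs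
      exact ⟨rfl, h8, rfl, h10, h11⟩
    · intro i hi hib
      have hii : i = i₀ := by
        by_contra hii
        simp only [Function.update_of_ne hii] at hib
        exact hoff i (hcases i hi hii) hib
      subst hii
      rw [h3]
      simp [Rec.absorb, Rec.fresh]
    · intro i hi hib
      have hii : i ≠ i₀ := by
        rintro rfl
        simp at hib
      simp only [Function.update_of_ne hii]
      have hi' := hcases i hi hii
      exact Or.inl (h1.step_off hg ht hi' (hoff i hi') (Or.inl (hoff i hi')))

/-- An occupied node costs a unit of the scan, an empty one is settled. Nothing is gained only if
the node is occupied and the base robot has crashed meanwhile; then the crash itself has lowered the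
potential. -/
theorem FarRel.next_state (h : FarRel P S X c) (hg : Good P S X) (ht : Even t)
    (hf : ∃ i ∈ S, (X.rc i).settled = false) :
    ∃ Y hit, Good P S Y ∧ OddRel P S Y (step P t S c) hit ∧ pot P S Y ≤ pot P S X ∧
      (X.Live S X.base → pot P S Y + 1 ≤ pot P S X) := by
  obtain ⟨p, q, hit, h1, hp, hq, h2⟩ := h
  have hxb : P.target X.base p ≠ X.base := (P.adj_target hp).ne.symm
  have hstay : ∀ i, X.At S i → X.hm i = X.base →
      step P t S c i = ⟨X.base, { X.rc i with probing := true }, none⟩ := by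
    intro i hi hib
    obtain ⟨h3, -⟩ := h2 i hi hib
    rw [h1.step_stay ht hi (by rw [h3]; exact (hg.at_base i hi hib).1), hib, h3]
  have hfree : ∀ i ∈ S, (X.rc i).settled = false → (c i).info.settled = false :=
    fun i hi hs => (h1.settled i hi).trans hs
  by_cases hl : X.Live S (P.target X.base p)
  · obtain ⟨hit', hhit⟩ : ∃ hit', hit' = decide (∃ j, X.At S j ∧ X.hm j = P.target X.base p ∧
        some q = some (c j).info.arrow) := ⟨_, rfl⟩
    have hfr : ∀ i ∈ S, (X.rc i).settled = false →
        (step P t S c i).pos = X.base ∧ (step P t S c i).info.id = i + 1 ∧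
        (step P t S c i).info.probing = false ∧ (step P t S c i).info.stamp = X.ep ∧
        (step P t S c i).info.flag = hit' ∧ (step P t S c i).info.settled = false := by
      intro i hi hs
      rw [h1.step_free ht hl hi hs]
      obtain ⟨h3, h4, h5, h6, h7, h8⟩ := h1.free i hi hs
      refine ⟨?_, h5, rfl, h7, hhit.symm, hfree i hi hs⟩
      simp [PortLabelling.move, hq]
    by_cases hlb : X.Live S X.base
    · obtain ⟨b, hb, hbb⟩ := hlb
      obtain ⟨h3, h4, h5, h6⟩ := h2 b hb hbb
      have hp1 := (Finset.mem_Icc.1 hp).1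
      -- Different ports lead to different nodes, so the arrow of the robot met is the entry port of
      -- the probe exactly if it leads to the base.
      have hpar : hit' = true ↔ X.par (P.target X.base p) = X.base := by
        rw [hhit, decide_eq_true_iff]
        obtain ⟨j, hj, hjx⟩ := hl
        have hjb : X.hm j ≠ X.base := hjx ▸ hxb
        have h7 := hg.target_arrow j hj hjb
        have h8 := hg.arrow_mem j hj hjb
        have h9 := h1.off j hj hjb
        rw [hjx] at h7 h8
        constructor
        · rintro ⟨j', hj', hjx', h10⟩
          obtain rfl : j' = j := hg.hm_inj j' j hj' hj (hjx'.trans hjx.symm)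
          rw [h9, Option.some.injEq] at h10
          rw [← h7, ← h10, PortLabelling.target, hq]
        · intro h10
          refine ⟨j, hj, hjx, ?_⟩
          have h11 : q ∈ Finset.Icc 1 (G.degree (P.target X.base p)) := by
            by_contra h12
            rw [P.traverse_of_notMem h12] at hq
            exact hxb (congrArg Prod.fst hq)
          rw [h9, P.target_inj h11 h8 ?_]
          rw [h7, h10, PortLabelling.target, hq]
      obtain ⟨hgY, hpot⟩ := hg.occupied hb hbb (by omega) h5 hf (by rw [h4]; exact hl)
        (c := if hit' = true then 1 else 0) (by simp only [h4, hpar]) rfl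
      have huniq : ∀ i, X.At S i → X.hm i = X.base → i = b := fun b' h1 h2 =>
        hg.hm_inj b' b h1 hb (h2.trans hbb.symm)
      have hset : ∀ i, (Function.update X.rc b { X.rc b with
          probing := true
          count := (X.rc b).count + if hit' = true then 1 else 0 } i).settled =
          (X.rc i).settled := by
        intro i
        by_cases hib : i = b
        · subst hib; simp
        · simp [hib]
      refine ⟨_, hit', hgY, ⟨?_, ?_, ?_, ?_⟩, by omega, fun _ => hpot⟩
      · intro i hi
        simp only [hset]
        by_cases hs : (X.rc i).settled = true
        · by_cases hib : X.hm i = X.base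
          · rw [hstay i ⟨hi, hs⟩ hib]
          · rw [(h1.step_off hg ht ⟨hi, hs⟩ hib (Or.inr rfl)).1]
        · rw [Bool.not_eq_true] at hs
          rw [(hfr i hi hs).2.2.2.2.2, hs]
      · intro i hi hs
        simp only [hset] at hs
        obtain ⟨h7, h8, h9, h10, h11, -⟩ := hfr i hi hs
        exact ⟨h7, h8, h9, h10, h11⟩
      · intro i hi hib
        have hi' : X.At S i := ⟨hi.1, (hset i).symm.trans hi.2⟩
        rw [hstay i hi' hib]
        obtain rfl := huniq i hi' hib
        refine ⟨rfl, ?_⟩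
        simp only [Function.update_self, Rec.absorb, true_and]
        ext <;> simp
        split_ifs <;> rfl
      · intro i hi hib
        have hi' : X.At S i := ⟨hi.1, (hset i).symm.trans hi.2⟩
        have hib' : i ≠ b := by rintro rfl; exact hib hbb
        simp only [Function.update_of_ne hib']
        exact Or.inl (h1.step_off hg ht hi' hib (Or.inr rfl))
    · have hoff : ∀ i, X.At S i → X.hm i ≠ X.base := fun i hi he => hlb ⟨i, hi, he⟩
      refine ⟨X, hit', hg, ⟨?_, ?_, ?_, ?_⟩, le_rfl, fun h => absurd h hlb⟩
      · intro i hi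
        by_cases hs : (X.rc i).settled = true
        · rw [(h1.step_off hg ht ⟨hi, hs⟩ (hoff i ⟨hi, hs⟩) (Or.inr rfl)).1]
        · rw [Bool.not_eq_true] at hs
          rw [(hfr i hi hs).2.2.2.2.2, hs]
      · intro i hi hs
        obtain ⟨h7, h8, h9, h10, h11, -⟩ := hfr i hi hs
        exact ⟨h7, h8, h9, h10, h11⟩
      · exact fun i hi hib => absurd hib (hoff i hi)
      · exact fun i hi hib => Or.inl (h1.step_off hg ht hi hib (Or.inr rfl))
  · obtain ⟨i₀, hi₀, hf₀, h3, h4⟩ := h1.step_settle (P := P) ht hl hf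
    have h5 := h1.free i₀ hi₀ hf₀
    obtain ⟨hgY, hpot⟩ := hg.settleNew hp hl (fun b hb hbb => (h2 b hb hbb).2) hi₀ hf₀
      (r := (c i₀).info.fresh) rfl rfl rfl rfl rfl h5.2.2.2.2.1 rfl
    obtain ⟨Y, hY⟩ : ∃ Y : Abs n k, Y = { X with
      rc := Function.update
        (fun i => if X.hm i = X.base then { X.rc i with arrow := p } else X.rc i) i₀
          (c i₀).info.fresh
      hm := Function.update X.hm i₀ (P.target X.base p)
      base := P.target X.base p
      W := insert (P.target X.base p) X.W
      par := Function.update X.par X.base (P.target X.base p) } := ⟨_, rfl⟩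
    rw [← hY] at hgY hpot
    have hYj : Y.rc i₀ = (c i₀).info.fresh := by simp [hY]
    have hYb : ∀ b, b ≠ i₀ → X.hm b = X.base → Y.rc b = { X.rc b with arrow := p } :=
      fun b h1 h2 => by simp [hY, h1, h2]
    have hYi : ∀ i, i ≠ i₀ → X.hm i ≠ X.base → Y.rc i = X.rc i := fun i h1 h2 => by
      simp [hY, h1, h2]
    have hYs : ∀ i, i ≠ i₀ → (Y.rc i).settled = (X.rc i).settled := by
      intro i hi
      by_cases hib : X.hm i = X.base
      · rw [hYb i hi hib]
      · rw [hYi i hi hib]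
    have hYh : ∀ i, i ≠ i₀ → Y.hm i = X.hm i := fun i hi => by simp [hY, hi]
    have hYhj : Y.hm i₀ = P.target X.base p := by simp [hY]
    have hYbase : Y.base = P.target X.base p := by rw [hY]
    have hYep : Y.ep = X.ep := by rw [hY]
    have hcases : ∀ i, Y.At S i → i ≠ i₀ → X.At S i := fun i hi hii =>
      ⟨hi.1, (hYs i hii).symm.trans hi.2⟩
    have hbase : ∀ i, Y.At S i → Y.hm i = Y.base → i = i₀ := by
      intro i hi hib
      by_contra hii
      rw [hYh i hii, hYbase] at hib
      exact hl ⟨i, hcases i hi hii, hib⟩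
    refine ⟨Y, hit, hgY, ⟨?_, ?_, ?_, ?_⟩, by omega, fun _ => hpot⟩
    · intro i hi
      by_cases hii : i = i₀
      · rw [hii, h3, hYj]
      · rw [hYs i hii]
        by_cases hs : (X.rc i).settled = true
        · by_cases hib : X.hm i = X.base
          · rw [hstay i ⟨hi, hs⟩ hib]
          · rw [(h1.step_off hg ht ⟨hi, hs⟩ hib (Or.inr rfl)).1]
        · rw [Bool.not_eq_true] at hs
          rw [h4 i hi hs hii]
          exact h1.settled i hi
    · intro i hi hs
      have hii : i ≠ i₀ := by
        rintro rfl
        rw [hYj] at hs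
        exact Bool.false_ne_true hs.symm
      rw [hYs i hii] at hs
      rw [h4 i hi hs hii, hYbase, hYep]
      obtain ⟨h6, h7, h8, h9, h10, h11⟩ := h1.free i hi hs
      exact ⟨rfl, h8, rfl, h10, h11⟩
    · intro i hi hib
      obtain rfl := hbase i hi hib
      rw [h3, hYj, hYbase]
      simp [Rec.absorb, Rec.fresh]
    · intro i hi hib
      have hii : i ≠ i₀ := by
        rintro rfl
        exact hib (hYhj.trans hYbase.symm)
      have hi' := hcases i hi hii
      rw [hYh i hii]
      by_cases hib' : X.hm i = X.base
      -- The old base robot does not know yet that the free robots have stayed away. The new base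
      -- robot, at its fresh port 1, is the witness that this situation is recent.
      · right
        obtain ⟨h6, h7, h8, h9⟩ := h2 i hi' hib'
        rw [hstay i hi' hib', hYb i hii hib']
        refine ⟨?_, hib'.symm, h7.symm, ?_⟩
        · have := (hg.at_base i hi' hib').1
          ext <;> simp [this]
        · intro b hb hbb
          rw [hbase b hb hbb, hYj]
          exact ⟨rfl, rfl⟩
      · rw [hYi i hii hib']
        exact Or.inl (h1.step_off hg ht hi' hib' (Or.inr rfl))

end Rounds

/-! ### The running time -/

section Run

open Classical

variable {n k : ℕ} {G : SimpleGraph (Fin n)} [DecidableRel G.Adj] (P : PortLabelling G)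

/-- In an even round all robots are at different homes. -/
def HomeEven (S : Finset (Fin k)) (c : Fin k → Rob n) : Prop :=
  (∀ i ∈ S, (c i).info.settled = true) ∧ ∀ i ∈ S, ∀ j ∈ S, (c i).pos = (c j).pos → i = j

/-- In an odd round all robots have different homes, which they will find again. -/
def HomeOdd (S : Finset (Fin k)) (c : Fin k → Rob n) : Prop :=
  ∃ h : Fin k → Fin n, (∀ i ∈ S, ∀ j ∈ S, h i = h j → i = j) ∧ ∀ i ∈ S,
    (c i).info.settled = true ∧ ((c i).info.arrow ≠ 0 ∧
      ((c i).pos, (c i).entry) = P.traverse (h i) (c i).info.arrow ∨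
      (c i).info.arrow = 0 ∧ (c i).pos = h i)

variable {P} {S T : Finset (Fin k)} {X : Abs n k} {c c' : Fin k → Rob n} {t : ℕ}

theorem HomeEven.mono (h : HomeEven S c) (hT : T ⊆ S) (hc : ∀ i ∈ T, c' i = c i) :
    HomeEven T c' := by
  refine ⟨fun i hi => ?_, fun i hi j hj he => ?_⟩
  · rw [hc i hi]; exact h.1 i (hT hi)
  · rw [hc i hi, hc j hj] at he
    exact h.2 i (hT hi) j (hT hj) he

theorem HomeOdd.mono (h : HomeOdd P S c) (hT : T ⊆ S) (hc : ∀ i ∈ T, c' i = c i) :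
    HomeOdd P T c' := by
  obtain ⟨f, h1, h2⟩ := h
  refine ⟨f, fun i hi j hj => h1 i (hT hi) j (hT hj), fun i hi => ?_⟩
  rw [hc i hi]
  exact h2 i (hT hi)

/-- Without free robots, every settled robot only commutes between its home and the target of its
arrow, whoever else crashes. -/
theorem HomeEven.step (h : HomeEven S c) (ht : Even t) : HomeOdd P S (step P t S c) := by
  refine ⟨fun i => (c i).pos, h.2, fun i hi => ?_⟩
  have hs := h.1 i hi
  have hnf : ¬ ∃ x ∈ scene S c i, x.1.settled = false ∧ x.1.probing = false := by
    rintro ⟨x, hx, hxs, -⟩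
    obtain ⟨j, hj, -, -, rfl⟩ := mem_scene.1 hx
    exact Bool.false_ne_true (hxs.symm.trans (h.1 j hj))
  by_cases ha : (c i).info.arrow = 0
  · have h1 : action t G S c i = ((c i).info, none) := by
      rw [action_even ht, actEven, if_pos hs, if_pos ha]
    rw [step_of_action h1]
    exact ⟨hs, Or.inr ⟨ha, rfl⟩⟩
  · have h1 : action t G S c i = ((c i).info, some (c i).info.arrow) := by
      rw [action_even ht, actEven, if_pos hs, if_neg ha, if_neg hnf]
    rw [step_of_action h1]
    exact ⟨hs, Or.inl ⟨ha, rfl⟩⟩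

theorem HomeOdd.step (h : HomeOdd P S c) (ht : ¬ Even t) : HomeEven S (step P t S c) := by
  obtain ⟨f, h1, h2⟩ := h
  have key : ∀ i ∈ S, (Dispersion.step P t S c i).info.settled = true ∧
      (Dispersion.step P t S c i).pos = f i := by
    intro i hi
    have hnf : ¬ ∃ x ∈ scene S c i, x.1.settled = false := by
      rintro ⟨x, hx, hxs⟩
      obtain ⟨j, hj, -, -, rfl⟩ := mem_scene.1 hx
      exact Bool.false_ne_true (hxs.symm.trans (h2 j hj).1)
    obtain ⟨hs, ⟨ha, h3⟩ | ⟨ha, h3⟩⟩ := h2 i hi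
    · have h4 : action t G S c i = ((c i).info, (c i).entry) := by
        rw [action_odd ht, actOdd, if_pos ⟨hs, ha⟩]
      rw [step_of_action h4]
      refine ⟨hs, ?_⟩
      have h5 := P.move_back (f i) (c i).info.arrow
      rw [← h3] at h5
      exact h5
    · have hn : ¬ ((c i).info.settled = true ∧ (c i).info.arrow ≠ 0) := by simp [ha]
      by_cases hp : (c i).info.probing = true
      · have h4 : action t G S c i = ((c i).info.commit, none) := by
          rw [action_odd ht, actOdd, if_neg hn]
          simp only [hs, if_true, hnf, if_false, hp]
        rw [step_of_action h4]
        exact ⟨hs, h3⟩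
      · have h4 : action t G S c i = ((c i).info, none) := by
          rw [action_odd ht, actOdd, if_neg hn]
          simp only [hs, if_true, hnf, if_false, hp]
          rfl
        rw [step_of_action h4]
        exact ⟨hs, h3⟩
  refine ⟨fun i hi => (key i hi).1, fun i hi j hj he => ?_⟩
  rw [(key i hi).2, (key j hj).2] at he
  exact h1 i hi j hj he

theorem at_of_not_free (hf : ¬ ∃ i ∈ S, (X.rc i).settled = false) {i : Fin k} (hi : i ∈ S) :
    X.At S i := by
  refine ⟨hi, ?_⟩
  by_contra h
  exact hf ⟨i, hi, by simpa using h⟩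

theorem OddRel.homeOdd {hit : Bool} (h : OddRel P S X c hit) (hg : Good P S X)
    (hf : ¬ ∃ i ∈ S, (X.rc i).settled = false) : HomeOdd P S c := by
  refine ⟨X.hm, fun i hi j hj => hg.hm_inj i j (at_of_not_free hf hi) (at_of_not_free hf hj), ?_⟩
  intro i hi
  have hi' := at_of_not_free hf hi
  refine ⟨(h.settled i hi).trans hi'.2, ?_⟩
  by_cases hib : X.hm i = X.base
  · exact Or.inr ⟨h.arrow_base hg hi' hib, ((h.base i hi' hib).1).trans hib.symm⟩
  · have harr := (Finset.mem_Icc.1 (hg.arrow_mem i hi' hib)).1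
    obtain ⟨h1, h2⟩ | ⟨h1, h2, -⟩ := h.off i hi' hib
    · rw [h1]
      exact Or.inl ⟨by omega, h2⟩
    · exact Or.inr ⟨by rw [h1], h2⟩

theorem EvenRel.homeEven {y e out hit} (h : EvenRel S X c y e out hit) (hg : Good P S X)
    (hf : ¬ ∃ i ∈ S, (X.rc i).settled = false) : HomeEven S c := by
  refine ⟨fun i hi => (h.settled i hi).trans (at_of_not_free hf hi).2, fun i hi j hj he => ?_⟩
  have hi' := at_of_not_free hf hi
  have hj' := at_of_not_free hf hj
  rw [h.home i hi', h.home j hj'] at he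
  exact hg.hm_inj i j hi' hj' he

theorem OddRel.congr {hit : Bool} (h : OddRel P S X c hit) (hc : ∀ i ∈ S, c' i = c i) :
    OddRel P S X c' hit := by
  refine ⟨?_, ?_, ?_, ?_⟩
  · intro i hi; rw [hc i hi]; exact h.settled i hi
  · intro i hi; rw [hc i hi]; exact h.free i hi
  · intro i hi; rw [hc i hi.1]; exact h.base i hi
  · intro i hi; rw [hc i hi.1]; exact h.off i hi

theorem EvenRel.congr {y e out hit} (h : EvenRel S X c y e out hit) (hc : ∀ i ∈ S, c' i = c i) :
    EvenRel S X c' y e out hit := by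
  refine ⟨?_, ?_, ?_, ?_⟩
  · intro i hi; rw [hc i hi]; exact h.settled i hi
  · intro i hi; rw [hc i hi]; exact h.free i hi
  · intro i hi; rw [hc i hi.1]; exact h.home i hi
  · intro i hi; rw [hc i hi.1]; exact h.off i hi

theorem NearRel.congr (h : NearRel S X c) (hc : ∀ i ∈ S, c' i = c i) : NearRel S X c' := by
  obtain ⟨e, hit, h1, h2⟩ := h
  refine ⟨e, hit, h1.congr hc, fun i hi => ?_⟩
  rw [hc i hi.1]
  exact h2 i hi

theorem FarRel.congr (h : FarRel P S X c) (hc : ∀ i ∈ S, c' i = c i) : FarRel P S X c' := by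
  obtain ⟨p, q, hit, h1, h2, h3, h4⟩ := h
  refine ⟨p, q, hit, h1.congr hc, h2, h3, fun i hi => ?_⟩
  rw [hc i hi.1]
  exact h4 i hi

/-- The situation at the beginning of an odd round. -/
def Progress (P : PortLabelling G) (S : Finset (Fin k)) (c : Fin k → Rob n) (m : ℕ) : Prop :=
  HomeOdd P S c ∨ ∃ X hit, Good P S X ∧ OddRel P S X c hit ∧ pot P S X + m ≤ 3 * k ^ 2 - 2 * k

theorem Progress.mono {m : ℕ} (h : Progress P S c m) (hT : T ⊆ S) (hc : ∀ i ∈ T, c' i = c i) :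
    Progress P T c' m := by
  obtain h | ⟨X, hit, h1, h2, h3⟩ := h
  · exact Or.inl (h.mono hT hc)
  · obtain ⟨hurt, h4, h5⟩ := h1.crash hT
    have h6 := Finset.card_le_card hT
    exact Or.inr ⟨_, hit, h4, (h2.mono hT hurt).congr hc, by omega⟩

/-- Two rounds. -/
theorem Progress.step {m : ℕ} (h : Progress P S c m) (hG : G.Connected) (hk : 2 ≤ k) (hkn : k ≤ n)
    (ht : ¬ Even t) (hT : T ⊆ S) (hc : ∀ i ∈ T, c' i = step P t S c i) :
    Progress P T (Dispersion.step P (t + 1) T c') (m + 1) := by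
  have ht' : Even (t + 1) := by
    rw [Nat.even_add_one]
    exact ht
  obtain h | ⟨X, hit, hg, hr, hpot⟩ := h
  · exact Or.inl (((h.step ht).mono hT hc).step ht')
  by_cases hf : ∃ i ∈ S, (X.rc i).settled = false
  swap
  · exact Or.inl ((((hr.homeOdd hg hf).step ht).mono hT hc).step ht')
  obtain ⟨Y, hgY, hpY, hY⟩ := hr.next_state hg hG hk hkn ht hf
  obtain ⟨hurt, hgZ, hpZ⟩ := hgY.crash hT
  obtain ⟨Z, hZ⟩ : ∃ Z : Abs n k, Z = { Y with hurt := hurt } := ⟨_, rfl⟩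
  rw [← hZ] at hgZ hpZ
  have hlive : ∀ u, Z.Live T u → Y.Live S u := by
    rintro u ⟨i, hi, rfl⟩
    subst hZ
    exact ⟨i, ⟨hT hi.1, hi.2⟩, rfl⟩
  have hbase : Z.base = Y.base := by rw [hZ]
  have hcard := Finset.card_le_card hT
  obtain ⟨hn, hs⟩ | ⟨hn, hs⟩ := hY
  · have hn' : NearRel T Z c' := by
      rw [hZ]
      exact (hn.mono hT hurt).congr hc
    by_cases hf' : ∃ i ∈ T, (Z.rc i).settled = false
    swap
    · obtain ⟨e, hit', h1, -⟩ := hn'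
      exact Or.inl ((h1.homeEven hgZ hf').step ht')
    obtain ⟨U, hit', hgU, hU, hpU, hdU⟩ := hn'.next_state hgZ hG hk hkn ht' hf'
    refine Or.inr ⟨U, hit', hgU, hU, ?_⟩
    -- Either the odd round has lowered the potential, or the base was dead and is now manned again.
    rcases hs with hs | hs
    · omega
    · have := hdU fun hl => hs (hbase ▸ hlive _ hl)
      omega
  · have hn' : FarRel P T Z c' := by
      rw [hZ]
      exact (hn.mono hT hurt).congr hc
    by_cases hf' : ∃ i ∈ T, (Z.rc i).settled = false
    swap
    · obtain ⟨p, q, hit', h1, -⟩ := hn'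
      exact Or.inl ((h1.homeEven hgZ hf').step ht')
    obtain ⟨U, hit', hgU, hU, hpU, hdU⟩ := hn'.next_state hgZ ht' hf'
    refine Or.inr ⟨U, hit', hgU, hU, ?_⟩
    by_cases hl : Z.Live T Z.base
    · have := hdU hl
      omega
    -- The base robot was alive when the probe started, so it has crashed since, and `Good.crash`
    -- supplies the decrease.
    · have hlt : T.card < S.card := by
        refine Finset.card_lt_card (Finset.ssubset_iff_subset_ne.2 ⟨hT, ?_⟩)
        rintro rfl
        obtain ⟨i, hi, hib⟩ := hs
        refine hl ⟨i, ?_, ?_⟩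
        · rw [hZ]; exact hi
        · rw [hZ]; exact hib
      omega

/-- The first round. -/
theorem Progress.start (root : Fin n) (hG : G.Connected) (hk : 2 ≤ k) (hkn : k ≤ n)
    (hc : ∀ i ∈ S, c i = ⟨root, ⟨i + 1, false, 0, 0, false, 0, 0, false⟩, none⟩) :
    Progress P S (Dispersion.step P 0 S c) 0 := by
  obtain rfl | hS := S.eq_empty_or_nonempty
  · exact Or.inl ⟨fun _ => root, by simp, by simp⟩
  -- This state only describes the configuration before the first round. Its base is not manned, so
  -- the invariant is established only afterwards.
  set X₀ : Abs n k :=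
    ⟨fun i => ⟨i + 1, false, 0, 0, false, 0, 0, false⟩, fun _ => root, root, {root}, fun _ => root,
      0, False⟩ with hX₀
  have hf₀ : ∀ i, (X₀.rc i).settled = false := fun _ => rfl
  have h₀ : EvenRel S X₀ c root none false false := by
    refine ⟨?_, ?_, ?_, ?_⟩
    · intro i hi; rw [hc i hi]
    · intro i hi _; rw [hc i hi]; exact ⟨rfl, rfl, rfl, rfl, rfl, rfl⟩
    · intro i hi; exact absurd hi.2 Bool.false_ne_true
    · intro i hi; exact absurd hi.2 Bool.false_ne_true
  obtain ⟨i₀, hi₀, -, h1, h2⟩ := h₀.step_settle (P := P) Even.zero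
    (by rintro ⟨i, hi, -⟩; exact absurd hi.2 Bool.false_ne_true)
    (by obtain ⟨i, hi⟩ := hS; exact ⟨i, hi, hf₀ i⟩)
  set r := (c i₀).info.fresh with hr
  obtain ⟨X, hX⟩ : ∃ X : Abs n k, X = { X₀ with rc := Function.update X₀.rc i₀ r } := ⟨_, rfl⟩
  have hXi : X.rc i₀ = r := by simp [hX]
  have hXn : ∀ i, i ≠ i₀ → (X.rc i).settled = false := fun i hi => by simp [hX, hi, hX₀]
  have hat : ∀ i, X.At S i → i = i₀ := by
    intro i hi
    by_contra hii
    exact Bool.false_ne_true ((hXn i hii).symm.trans hi.2)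
  have hbase : X.base = root := by rw [hX]
  have hhm : ∀ i, X.hm i = root := fun i => by rw [hX]
  have hW : X.W = {root} := by rw [hX]
  have hat₀ : X.At S i₀ := ⟨hi₀, by rw [hXi]; rfl⟩
  have hrs : r.stamp = X.ep := by rw [hX, hr, hc i₀ hi₀]; rfl
  have hd := one_le_degree hG (hk.trans hkn) root
  have hkids : ∀ r v, X.kids P r v = ∅ := by
    intro r v
    refine Finset.filter_eq_empty_iff.2 ?_
    rintro u hu ⟨h3, -⟩
    rw [hW, Finset.mem_singleton] at hu
    exact h3 (hu.trans hbase.symm)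
  have hoff : ∀ i, X.hm i = X.base := fun i => (hhm i).trans hbase.symm
  have hfree : (S.filter fun i => (X.rc i).settled = false) = S.erase i₀ := by
    ext i
    rw [Finset.mem_filter, Finset.mem_erase]
    by_cases hii : i = i₀
    · subst hii
      simp [hXi, hr, Rec.fresh]
    · simp [hii, hXn i hii]
  have hScard : S.card ≤ k := by simpa using Finset.card_le_univ S
  have hS1 := Finset.card_erase_add_one hi₀
  refine Or.inr ⟨X, false, ⟨?_, ?_, ?_, ?_, ?_, ?_, ?_, ?_, ?_, ?_, ?_, ?_, ?_, ?_, ?_, ?_, ?_, ?_⟩,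
    ⟨?_, ?_, ?_, ?_⟩, ?_⟩
  · rw [hbase, hW]; exact Finset.mem_singleton_self _
  · intro i _; rw [hhm, hW]; exact Finset.mem_singleton_self _
  · intro i j hi hj _; rw [hat i hi, hat j hj]
  · intro i hi _
    obtain rfl := hat i hi
    rw [hXi]
    exact ⟨rfl, hrs⟩
  · intro i _ h; exact absurd (hoff i) h
  · intro i _ h; exact absurd (hoff i) h
  · intro i _ h; exact absurd (hoff i) h
  · intro i _ h; exact absurd (hoff i) h
  · intro u hu h
    rw [hW, Finset.mem_singleton] at hu
    exact absurd (hu.trans hbase.symm) h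
  · intro u hu
    rw [hW, Finset.mem_singleton] at hu
    rw [hu, hbase]
  · intro i _; rw [hkids]; exact Nat.zero_le _
  · intro i hi h
    obtain rfl := hat i hi
    rw [hXi] at h
    exact absurd h one_ne_zero
  · intro i hi
    obtain rfl := hat i hi
    rw [hXi, hhm]
    exact hd
  · intro i hi q h3 h4
    obtain rfl := hat i hi
    rw [hXi] at h4
    exact absurd (Nat.lt_one_iff.1 h4) (by omega)
  · intro i hi h
    obtain rfl := hat i hi
    rw [hXi] at h
    exact absurd h Bool.false_ne_true
  · rw [hfree, hW, Finset.card_singleton]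
    omega
  · intro i hi
    obtain rfl := hat i hi
    rw [hXi, hrs]
  · intro _
    refine ⟨⟨i₀, hat₀, hoff i₀⟩, ?_, ?_, ?_⟩
    · intro i _ h; exact absurd (hoff i) h
    · rintro i _ ⟨h, -⟩; exact absurd (hoff i) h
    · rintro i j - - ⟨h, -⟩; exact absurd (hoff i) h
  · intro i hi
    by_cases hii : i = i₀
    · rw [hii, h1, hXi]
    · rw [h2 i hi (hf₀ i) hii, hXn i hii, hc i hi]
  · intro i hi hs
    have hii : i ≠ i₀ := by
      rintro rfl
      rw [hXi] at hs
      exact Bool.false_ne_true hs.symm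
    rw [h2 i hi (hf₀ i) hii, hc i hi, hX]
    exact ⟨rfl, rfl, rfl, rfl, rfl⟩
  · intro i hi _
    obtain rfl := hat i hi
    rw [h1, hXi, hbase]
    simp [Rec.absorb, hr, Rec.fresh]
  · intro i _ h; exact absurd (hoff i) h
  -- The initial potential is at most `k ^ 2 + k * (2 * (k - 2) + 2) = 3 * k ^ 2 - 2 * k`.
  · have h3 : ∀ i ∈ S, weight P S X i ≤ 2 * (k - 2) + 2 := by
      intro i hi
      by_cases hii : i = i₀
      · rw [hii, weight_base hat₀.2 (hoff i₀) (by rw [hXi, hrs]), hXi]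
        have h4 : scanCost k r ≤ k - 2 := by
          simp only [hr, scanCost, Rec.fresh, one_ne_zero, if_false, Bool.toNat_false]
          omega
        have h5 : r.count = 0 := rfl
        rw [h5]
        simp only [Nat.zero_sub, mul_zero]
        omega
      · simp [weight, hXn i hii]
    have h4 : ∑ i ∈ S, weight P S X i ≤ S.card * (2 * (k - 2) + 2) :=
      Finset.sum_le_card_nsmul S _ _ h3
    have h5 : ¬ X.hurt := by rw [hX]; exact not_false
    rw [pot, if_neg h5]
    have h6 : S.card ^ 2 ≤ k ^ 2 := Nat.pow_le_pow_left hScard 2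
    have h7 : S.card * (2 * (k - 2) + 2) ≤ k * (2 * (k - 2) + 2) := Nat.mul_le_mul_right _ hScard
    obtain ⟨d, rfl⟩ := Nat.exists_eq_add_of_le hk
    have h8 : 2 * (2 + d - 2) + 2 = 2 * d + 2 := by omega
    rw [h8] at h7 h4
    have h9 : 3 * (2 + d) ^ 2 - 2 * (2 + d) = (2 + d) ^ 2 + (2 + d) * (2 * d + 2) := by
      refine Nat.sub_eq_of_eq_add ?_
      ring
    omega

variable (P) (root : Fin n) (crash : Fin k → ℕ∞)

theorem progress_views (hG : G.Connected) (hk : 2 ≤ k) (hkn : k ≤ n) (m : ℕ)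
    (hm : 2 * m + 1 ≤ 6 * k ^ 2) :
    Progress P (aliveSet crash (2 * m + 1)) (views P root crash (2 * m + 1)) m := by
  induction m with
  | zero =>
    refine (Progress.start (c := views P root crash 0) (S := aliveSet crash 0) root hG hk hkn
      fun i _ => views_zero P root crash i).mono (aliveSet_anti crash (Nat.zero_le _)) fun i hi => ?_
    exact views_succ P root crash (by omega) (aliveSet_anti crash (Nat.zero_le _) hi)
  | succ m ih =>
    have h1 := (ih (by omega)).step (t := 2 * m + 1) hG hk hkn (by simp)
      (aliveSet_anti crash (Nat.le_succ (2 * m + 1))) (c' := views P root crash (2 * m + 2))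
      fun i hi => views_succ P root crash (by omega) (aliveSet_anti crash (Nat.le_succ _) hi)
    refine h1.mono (aliveSet_anti crash (by omega)) fun i hi => ?_
    exact views_succ P root crash (t := 2 * m + 2) (by omega) (aliveSet_anti crash (by omega) hi)

theorem homeEven_views (hG : G.Connected) (hk : 2 ≤ k) (hkn : k ≤ n) :
    HomeEven (aliveSet crash (6 * k ^ 2)) (views P root crash (6 * k ^ 2)) := by
  have hk2 : 1 ≤ k ^ 2 := Nat.one_le_pow _ _ (by omega)
  have h1 : HomeOdd P (aliveSet crash (2 * (3 * k ^ 2 - 1) + 1))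
      (views P root crash (2 * (3 * k ^ 2 - 1) + 1)) := by
    refine (progress_views P root crash hG hk hkn (3 * k ^ 2 - 1) (by omega)).resolve_right ?_
    -- A potential would have to satisfy `3 * k ^ 2 - 1 ≤ 3 * k ^ 2 - 2 * k`, which is impossible.
    rintro ⟨X, hit, -, -, h⟩
    omega
  have h2 := (h1.step (t := 2 * (3 * k ^ 2 - 1) + 1) (by simp)).mono
    (aliveSet_anti crash (Nat.le_succ _)) fun i hi =>
      views_succ P root crash (by omega) (aliveSet_anti crash (Nat.le_succ _) hi)
  have h3 : 2 * (3 * k ^ 2 - 1) + 1 + 1 = 6 * k ^ 2 := by omega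
  rwa [Nat.succ_eq_add_one, h3] at h2

theorem pingPong_dispersedAt (hG : G.Connected) (hk : 2 ≤ k) (hkn : k ≤ n) {t : ℕ}
    (ht : 6 * k ^ 2 ≤ t) : (pingPong k).DispersedAt P root crash t := by
  have h := (homeEven_views P root crash hG hk hkn).2
  constructor
  · intro i j hi hj hij he
    have hi' := mem_aliveSet.2 hi
    have hj' := mem_aliveSet.2 hj
    rw [(config_of_le P root crash ht hi').1, (config_of_le P root crash ht hj').1] at he
    exact hij (h i (aliveSet_anti crash ht hi') j (aliveSet_anti crash ht hj') he)
  · intro i hi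
    have hi' := mem_aliveSet.2 hi
    have h1 := clock_eq P root crash le_rfl (aliveSet_anti crash ht hi')
    rw [(config_of_le P root crash ht hi').2]
    simp only [pingPong, decide_eq_true_eq] at h1 ⊢
    exact h1.ge

end Run

/-! ### The memory bound -/

section Memory

open Classical

variable {n k : ℕ} {G : SimpleGraph (Fin n)} [DecidableRel G.Adj] (P : PortLabelling G)

theorem portsOf_sInf_lt {V : Multiset Seen} {p : Rec → Prop} {B : ℕ}
    (hV : ∀ x ∈ V, ∀ q, x.2 = some q → q < B) (h : (portsOf V p).Nonempty) :
    sInf (portsOf V p) < B := by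
  obtain ⟨x, hx, -, hq⟩ := Nat.sInf_mem h
  exact hV x hx _ hq

theorem plan_below {deg e B : ℕ} {b : Rec} {V : Multiset Seen} (hb : b.Below (B + 1)) (he : e < B)
    (hd : deg < B) (hV : ∀ x ∈ V, ∀ q, x.2 = some q → q < B) :
    (plan deg b e V).base.Below (B + 1) ∧ (plan deg b e V).epoch < B + 1 := by
  obtain ⟨h1, h2, h3, h4, h5⟩ := hb
  rw [plan]
  split_ifs with g1 g2 g3 g4
  · exact ⟨⟨h1, h2, (g1.2.trans_lt hd).trans (Nat.lt_succ_self B), h4, h5⟩, by simp only; omega⟩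
  · exact ⟨⟨h1, h2, by simp only; omega, by simp only; omega, h5⟩, by simp only; omega⟩
  · have := portsOf_sInf_lt hV g3
    exact ⟨⟨h1, by simp only; omega, by simp only; omega, by simp only; omega, h5⟩,
      by simp only; omega⟩
  · have := portsOf_sInf_lt hV g4
    exact ⟨⟨h1, by simp only; omega, by simp only; omega, by simp only; omega, h5⟩,
      by simp only; omega⟩
  · exact ⟨⟨h1, h2, by simp only; omega, h4, by simp only; omega⟩, by simp only; omega⟩

theorem pick_below {V : Multiset Seen} {p : Rec → Prop} {B : ℕ} (hV : ∀ x ∈ V, x.1.Below B)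
    (h : ∃ x ∈ V, p x.1) : (pick V p).Below B := by
  obtain ⟨-, y, hy⟩ := pick_spec h
  exact hV _ hy

/-- In a round the numbers that are stored grow by at most one. -/
theorem actRec_below {t deg B : ℕ} {r : Rec} {entry : Option ℕ} {V : Multiset Seen}
    (hr : r.Below B) (hd : deg < B) (hV : ∀ x ∈ V, x.1.Below B)
    (hV' : ∀ x ∈ V, ∀ q, x.2 = some q → q < B) : (actRec t deg r entry V).1.Below (B + 1) := by
  have hr' := hr.mono (Nat.le_succ B)
  obtain ⟨h1, h2, h3, h4, h5⟩ := hr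
  have hB : 0 < B := by omega
  rw [actRec]
  split_ifs
  · rw [actEven]
    split_ifs with g1 g2 g3 g4 g5
    · exact hr'
    · have h6 := pick_below (p := fun x => x.settled = false) hV (by
        obtain ⟨x, hx, hx', -⟩ := g3
        exact ⟨x, hx, hx'⟩)
      refine ⟨hr'.1, Nat.succ_pos B, hr'.3, ?_, h6.stamp.trans (Nat.lt_succ_self B)⟩
      simp only [Rec.arrive]
      split_ifs <;> omega
    · exact hr'
    · exact ⟨hr'.1, hr'.2, hr'.3, hr'.4, hr'.5⟩
    · exact ⟨hr'.1, hr'.2, hr'.3, hr'.4, hr'.5⟩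
    · exact ⟨hr'.1, Nat.succ_pos B, Nat.succ_lt_succ hB, Nat.succ_pos B, hr'.5⟩
    · exact ⟨hr'.1, hr'.2, hr'.3, hr'.4, hr'.5⟩
  · rw [actOdd]
    have hW : ∀ x ∈ V.filter fun x => x.1.settled = true ∧ x.1.arrow ≠ 0,
        ∀ q, x.2 = some q → q < B := fun x hx => hV' x (Multiset.mem_of_mem_filter hx)
    split_ifs with g1 g2 g3 g4 g5
    · exact hr'
    · have h6 := pick_below (p := fun x => x.settled = false) hV g3
      refine (plan_below (b := r.absorb (pick V fun x => x.settled = false).flag)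
        ⟨hr'.1, hr'.2, hr'.3, ?_, hr'.5⟩ h6.stamp hd hW).1
      simp only [Rec.absorb]
      split_ifs <;> omega
    · exact ⟨hr'.1, hr'.3, hr'.3, hr'.4, hr'.5⟩
    · exact hr'
    · have h6 := pick_below (p := fun x => x.settled = true ∧ x.arrow = 0) hV g5
      refine ⟨hr'.1, hr'.2, hr'.3, hr'.4, (plan_below ⟨?_, ?_, ?_, ?_, ?_⟩ h5 hd hW).2⟩
      · exact h6.1.trans (Nat.lt_succ_self B)
      · exact h6.2.trans (Nat.lt_succ_self B)
      · exact h6.3.trans (Nat.lt_succ_self B)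
      · have := h6.count
        simp only [Rec.absorb]
        split_ifs <;> omega
      · exact h6.5.trans (Nat.lt_succ_self B)
    · exact hr'

variable (root : Fin n) (crash : Fin k → ℕ∞)

theorem views_below {t : ℕ} (ht : t ≤ 6 * k ^ 2) {i : Fin k} (hi : i ∈ aliveSet crash t) :
    (views P root crash t i).info.Below (k + G.maxDegree + 1 + t) ∧
      ∀ q, (views P root crash t i).entry = some q → q ≤ G.maxDegree := by
  induction t generalizing i with
  | zero =>
    rw [views_zero]
    have := i.isLt
    refine ⟨⟨?_, ?_, ?_, ?_, ?_⟩, fun q hq => by simp at hq⟩ <;> simp only <;> omega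
  | succ t ih =>
    have hi' := aliveSet_anti crash t.le_succ hi
    have hdeg := G.degree_le_maxDegree
    rw [views_succ P root crash (by omega) hi']
    constructor
    · have hmem : ∀ x ∈ scene (aliveSet crash t) (views P root crash t) i,
          x.1.Below (k + G.maxDegree + 1 + t) ∧ ∀ q, x.2 = some q → q ≤ G.maxDegree := by
        intro x hx
        obtain ⟨j, hj, -, -, rfl⟩ := mem_scene.1 hx
        exact ih (by omega) hj
      refine actRec_below (B := k + G.maxDegree + 1 + t) (ih (by omega) hi').1 ?_ (fun x hx => (hmem x hx).1) ?_
      · have := hdeg (views P root crash t i).pos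
        omega
      · intro x hx q hq
        have := (hmem x hx).2 q hq
        omega
    · intro q hq
      simp only [step] at hq
      cases ho : (action t G (aliveSet crash t) (views P root crash t) i).2 with
      | none => rw [ho] at hq; simp [PortLabelling.move] at hq
      | some p =>
        rw [ho] at hq
        exact (Finset.mem_Icc.1 (P.entry_le hq)).2.trans (hdeg _)

theorem pingPong_mem_le (hG : G.Connected) (hk : 2 ≤ k) (hkn : k ≤ n) {t : ℕ} {i : Fin k}
    (hi : Alive crash t i) : ((((pingPong k).config P root crash t i).mem.length : ℕ) : ℝ) ≤
      1280 * Real.logb 2 ((k : ℝ) + (G.maxDegree : ℝ)) := by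
  obtain ⟨m, hm⟩ : ∃ m, m = k + G.maxDegree := ⟨_, rfl⟩
  have hm3 : 3 ≤ m := by
    have h1 := one_le_degree hG (hk.trans hkn) root
    have h2 := G.degree_le_maxDegree root
    omega
  have key : ∀ s ≤ 6 * k ^ 2, ∀ i ∈ aliveSet crash s,
      ((pingPong k).config P root crash s i).mem.length ≤ 256 * (m + 1 + 6 * k ^ 2).size := by
    intro s hs i hi
    rw [mem_eq_enc P root crash hs hi]
    refine enc_length_le (by omega) (by omega) ((views_below P root crash hs hi).1.mono ?_)
    omega
  have hlen : ((pingPong k).config P root crash t i).mem.length ≤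
      256 * (m + 1 + 6 * k ^ 2).size := by
    have hi' := mem_aliveSet.2 hi
    rcases le_total t (6 * k ^ 2) with ht | ht
    · exact key t ht i hi'
    · rw [(config_of_le P root crash ht hi').2]
      exact key _ le_rfl i (aliveSet_anti crash ht hi')
  -- Since `m ≥ 3`, the number is at most `m ^ 4`; its size is thus at most `4 * Real.logb 2 m + 1`,
  -- and the extra bit is absorbed because the logarithm is at least 1. This gives `1280 = 256 * 5`.
  have hsize : ((m + 1 + 6 * k ^ 2).size : ℝ) ≤ 5 * Real.logb 2 m := by
    obtain ⟨s, hs⟩ : ∃ s, (m + 1 + 6 * k ^ 2).size = s + 1 :=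
      Nat.exists_eq_succ_of_ne_zero (Nat.size_pos.2 (by omega)).ne'
    have h1 : 2 ^ s ≤ m + 1 + 6 * k ^ 2 := Nat.lt_size.1 (by omega)
    have h2 : m + 1 + 6 * k ^ 2 ≤ m ^ 4 := by
      have h3 : k ^ 2 ≤ m ^ 2 := Nat.pow_le_pow_left (by omega) 2
      have h4 : 9 ≤ m ^ 2 := Nat.pow_le_pow_left hm3 2
      have h5 : m ^ 4 = m ^ 2 * m ^ 2 := by ring
      have h6 : 3 * m ≤ m ^ 2 := by rw [pow_two]; exact Nat.mul_le_mul_right m hm3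
      nlinarith
    have h3 : ((2 : ℝ) ^ s) ≤ (m : ℝ) ^ 4 := by exact_mod_cast h1.trans h2
    have h4 := Real.logb_le_logb_of_le (b := 2) (by norm_num) (by positivity) h3
    rw [Real.logb_pow, Real.logb_pow, Real.logb_self_eq_one (by norm_num)] at h4
    have h5 : (1 : ℝ) ≤ Real.logb 2 m := by
      rw [Real.le_logb_iff_rpow_le (by norm_num) (by positivity), Real.rpow_one]
      exact_mod_cast (by omega : 2 ≤ m)
    rw [hs]
    push_cast at h4 ⊢
    linarith
  have hmr : (m : ℝ) = (k : ℝ) + (G.maxDegree : ℝ) := by rw [hm]; push_cast; rfl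
  rw [← hmr]
  calc ((((pingPong k).config P root crash t i).mem.length : ℕ) : ℝ)
      ≤ ((256 * (m + 1 + 6 * k ^ 2).size : ℕ) : ℝ) := by exact_mod_cast hlen
    _ = 256 * ((m + 1 + 6 * k ^ 2).size : ℝ) := by push_cast; rfl
    _ ≤ 1280 * Real.logb 2 m := by linarith

theorem idle_mem (t : ℕ) (i : Fin k) : (idle.config P root crash t i).mem = [] := by
  induction t with
  | zero => rfl
  | succ t ih =>
    rw [Algorithm.config]
    simp only
    split_ifs
    · exact ih
    · rfl
    · exact ih

end Memory

end Dispersion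

theorem mainTheorem1 :
    ∃ (A : ℕ → Dispersion.Algorithm) (C : ℝ),
      ∀ (n k f : ℕ), k ≤ n → f ≤ k →
      ∀ (G : SimpleGraph (Fin n)) [DecidableRel G.Adj], G.Connected →
      ∀ (P : Dispersion.PortLabelling G) (root : Fin n) (crash : Fin k → ℕ∞),
        {i : Fin k | crash i ≠ ⊤}.ncard ≤ f →
        (∀ t : ℕ, 7 * k ^ 2 ≤ t → (A k).DispersedAt P root crash t) ∧
        (∀ (t : ℕ) (i : Fin k), Dispersion.Alive crash t i →
          ((((A k).config P root crash t i).mem.length : ℕ) : ℝ) ≤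
            C * Real.logb 2 ((k : ℝ) + (G.maxDegree : ℝ))) := by
  -- For `k = n = 1` the bound allows no bits at all, because `k + Δ = 1`, so not even a clock may
  -- be stored; hence the separate algorithm with empty memory.
  refine ⟨fun k => if k ≤ 1 then Dispersion.idle else Dispersion.pingPong k, 1280, ?_⟩
  intro n k f hkn _ G _ hG P root crash _
  by_cases hk : k ≤ 1
  · simp only [if_pos hk]
    refine ⟨fun t _ => ⟨fun i j _ _ hij => ?_, fun i _ => rfl⟩, fun t i _ => ?_⟩
    · exact absurd (Fin.ext (by omega)) hij
    · rw [Dispersion.idle_mem, List.length_nil, Nat.cast_zero]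
      refine mul_nonneg (by norm_num) ?_
      rw [← Nat.cast_add, Real.logb]
      exact div_nonneg (Real.log_natCast_nonneg _) (Real.log_nonneg (by norm_num))
  · simp only [if_neg hk]
    exact ⟨fun t ht => Dispersion.pingPong_dispersedAt P root crash hG (by omega) hkn (by omega),
      fun t i hi => Dispersion.pingPong_mem_le P root crash hG (by omega) hkn hi⟩
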